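/- \textbf{MPC model.} There are $p$ machines. A word is a natural number less than $W$, and a machine can hold at most $s$ words. The computation proceeds in synchronous rounds. In each round every machine performs an arbitrary randomized local computation on the contents of its memory (different machines and rounds use independent randomness), which determines the words it keeps and the words it sends, each to one specified machine. For every machine and every round, the kept and sent words together, and the kept and received words together, must number at most $s$. The input, the edge set of a graph $G$ with vertex set $\{0,\dots,n-1\}$, is distributed over the machines, each edge being stored on exactly one machine. The output is the union of the sets of edges listed in the memories of the machines after the last round. \textbf{Parameters.} Let $\alpha=96\ln n$ and $\mu_R=(10^6\log_2 n)^{-1}$. Let $\mu_H(r)=\tfrac12 e^{\frac{\alpha}{2}(r-\frac12)}$ if $r\le\tfrac12$ and $\mu_H(r)=1-\tfrac12e^{-\frac{\alpha}{2}(r-\frac12)}$ if $r>\tfrac12$. Let $\mu_F(r)=\max\{r/4,0\}$ if $r\le4$ and $\mu_F(r)=1$ if $r>4$. \textbf{LocalPhase}$(G[U],\Delta_\star)$. Create $R\subseteq U$ by selecting each vertex independently with probability $\mu_R$. Then create $H\subseteq U$ by selecting each $v\in U$ independently with probability $\mu_H\big(|N(v)\cap R|/(\mu_R\Delta_\star)\big)$.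 Then create $F\subseteq U$ by selecting each $v\in U$ independently with probability $\mu_F(|N(v)\cap H|/\Delta_\star)$. Compute a maximal matching $M$ of $G[H\cup F]$ and return $(U\setminus(R\cup H\cup F),\,M)$. \textbf{MatchHeavy}$(H,F)$. Every $v\in F$ picks a uniformly random $v_\star\in N(v)\cap H$. Every vertex is independently coloured red or blue with probability $\tfrac12$ each. Let $E_\star$ be the set of pairs $(v,v_\star)$ with $v\in F$ red and $v_\star\in H$ blue. Every blue vertex incident to an edge of $E_\star$ selects one such edge. Return the selected edges. \textbf{GlobalAlg}$(G,\widetilde\Delta)$. Set $\Delta\leftarrow\widetilde\Delta$, $V'\leftarrow V(G)$ and $M\leftarrow\emptyset$. While $\Delta\ge1$: let $H$ be the set of $v\in V'$ of degree at least $\Delta/2$ in $G[V']$; create $F\subseteq V'$ by selecting each $v\in V'$ independently with probability $|N(v)\cap H|/(4\Delta)$; add the edges returned by MatchHeavy$(H,F)$ to $M$; set $V'\leftarrow V'\setminus(H\cup F)$ and $\Delta\leftarrow\Delta/2$. Return $M$. \textbf{ParallelAlg}$(G,S)$, for a graph $G$ on $n$ vertices and $S\le n$. Set $\Delta\leftarrow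 n$, $V'\leftarrow V(G)$ and $M\leftarrow\emptyset$. While $\Delta\ge\frac nS(200\ln n)^{32}$: \begin{enumerate} \item let $m=\big\lfloor\sqrt{n\Delta/S}\big\rfloor$ and $\tau=\big\lceil\frac1{16}\log_{120\alpha}(\Delta/m)\big\rceil$; \item assign each vertex of $V'$ independently and uniformly to one of $V_1,\dots,V_m$; \item for each $i\in[m]$ independently: if $G[V_i]$ has more than $8S$ edges, set $V_i\leftarrow\emptyset$; then for $j=1,\dots,\tau$ set $(V_i,M_{i,j})\leftarrow$ LocalPhase$\big(G[V_i],\Delta/(2^{j-1}m)\big)$; \item set $V'\leftarrow\bigcup_iV_i$, $M\leftarrow M\cup\bigcup_{i,j}M_{i,j}$ and $\Delta\leftarrow\Delta/2^\tau$. \end{enumerate} Finally remove from $V'$ all vertices of degree at least $2\Delta$ in $G[V']$, let $M'\leftarrow$ GlobalAlg$(G[V'],2\Delta)$, and return $M\cup M'$. For $S>n$, ParallelAlg$(G,S)$ stands for ParallelAlg$(G,n)$. \textbf{Lemma.} For every $\delta>0$ there are constants $C,n_0$, depending only on $\delta$, such that the following holds for all $n\ge n_0$, all $S\ge n^\delta$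 and all $p$. Let any rule for computing the maximal matchings in LocalPhase be given. Then there are a rule for the selection of edges in MatchHeavy and an MPC program for $p$ machines, with at most $C\cdot S$ words of space per machine and words less than $n^{C}$ (that is, of $O(\log n)$ bits), that executes at most $$C\Big((\log\log n)^2+\max\big(\log\tfrac nS,\,0\big)\Big)$$ rounds and implements ParallelAlg with high probability in the following sense. For every graph $G$ on $n$ vertices and every initial distribution of its edges with at most $S$ edges per machine, the run of the program on $G$ can be coupled with a run of ParallelAlg$(G,S)$ so that, with probability at least $1-n^{-2}$, the program respects all space limits and outputs exactly the matching returned by ParallelAlg$(G,S)$. -/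

import Mathlib

noncomputable section

namespace RoundCompression

/-! ## Randomness -/

/-- `k` independent draws, the `i`-th one from `f i`. -/
def indep {β : Type} : (k : ℕ) → (Fin k → PMF β) → PMF (Fin k → β)
  | 0, _ => PMF.pure Fin.elim0
  | k + 1, f => (f 0).bind fun a => (indep k fun i => f i.succ).map fun r => Fin.cons a r

/-- `indep` is the product distribution. -/
theorem indep_apply {β : Type} : ∀ (k : ℕ) (f : Fin k → PMF β) (x : Fin k → β),
    indep k f x = ∏ i, f i (x i)
  | 0, f, x => by
      have hx : x = Fin.elim0 := Subsingleton.elim _ _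
      subst hx
      simp [indep]
  | k + 1, f, x => by
      classical
      have hmap : ∀ a : β, ((indep k fun i => f i.succ).map fun r =>
            (Fin.cons a r : Fin (k + 1) → β)) x
          = if a = x 0 then ∏ i : Fin k, f i.succ (x i.succ) else 0 := by
        intro a
        rw [PMF.map_apply]
        by_cases h : a = x 0
        · subst h
          rw [if_pos rfl, tsum_eq_single (Fin.tail x)]
          · rw [if_pos (Fin.cons_self_tail x).symm, indep_apply]
            rfl
          · intro r hr
            rw [if_neg]
            intro hxr
            apply hr
            rw [hxr, Fin.tail_cons]
        · rw [if_neg h]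
          simp only [ENNReal.tsum_eq_zero]
          intro r
          rw [if_neg]
          intro hxr
          apply h
          rw [hxr, Fin.cons_zero]
      rw [indep, PMF.bind_apply, tsum_eq_single (x 0), hmap, if_pos rfl, Fin.prod_univ_succ]
      intro a ha
      rw [hmap, if_neg ha, mul_zero]

/-- A coin that shows `true` with probability `p` (clamped to `[0,1]`). -/
def coin (p : ℝ) : PMF Bool :=
  PMF.ofFintype (fun b => if b then min 1 (ENNReal.ofReal p) else 1 - min 1 (ENNReal.ofReal p))
    (by simp)

/-- A uniformly random element of `s` (the value `d` if `s` is empty). -/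
def uniformOr {β : Type} (s : Finset β) (d : β) : PMF β :=
  open Classical in if h : s.Nonempty then PMF.uniformOfFinset s h else PMF.pure d

/-- The random subset of `U` that contains each `v ∈ U` independently with probability `p v`. -/
def randomSubset {n : ℕ} (U : Finset (Fin n)) (p : Fin n → ℝ) : PMF (Finset (Fin n)) :=
  (indep n fun v => coin (p v)).map fun b => U.filter fun v => b v = true

/-- Apply the random step `f` to a state `k` times. -/
def iterate {σ : Type} (f : σ → PMF σ) : ℕ → σ → PMF σ
  | 0, x => PMF.pure x
  | k + 1, x => (f x).bind (iterate f k)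

/-- The number of iterations of `while Δ ≥ θ do Δ ← f Δ`, started at `Δ`. -/
def whileCount (f : ℝ → ℝ) (θ Δ : ℝ) : ℕ := sInf {k | f^[k] Δ < θ}

/-! ## Graphs -/

section Graph

variable {n : ℕ}

/-- The set `N(v) ∩ U`. -/
def nbrs (G : SimpleGraph (Fin n)) (U : Finset (Fin n)) (v : Fin n) : Finset (Fin n) :=
  open Classical in U.filter fun u => G.Adj v u

/-- `G[U]`, as a graph on all of `Fin n` with no edges outside `U`. -/
def inducedOn (G : SimpleGraph (Fin n)) (U : Finset (Fin n)) : SimpleGraph (Fin n) where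
  Adj u v := G.Adj u v ∧ u ∈ U ∧ v ∈ U
  symm := ⟨fun _ _ h => ⟨h.1.symm, h.2.2, h.2.1⟩⟩
  loopless := ⟨fun v h => G.loopless.irrefl v h.1⟩

/-- `M` is a set of pairwise disjoint edges of `G`. -/
def IsMatching (G : SimpleGraph (Fin n)) (M : Finset (Sym2 (Fin n))) : Prop :=
  (∀ e ∈ M, e ∈ G.edgeSet) ∧ ∀ e ∈ M, ∀ f ∈ M, ∀ v, v ∈ e → v ∈ f → e = f

/-- `mm` computes a (inclusion-wise) maximal matching of every graph. -/
def IsMaximalMatchingRule (mm : SimpleGraph (Fin n) → Finset (Sym2 (Fin n))) : Prop :=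
  ∀ G, Maximal (IsMatching G) (mm G)

/-! ## GlobalAlg -/

/-- `pick w X` is one of the elements of `X`, for every nonempty set `X`. -/
def IsSelectionRule (pick : Fin n → Finset (Fin n) → Fin n) : Prop :=
  ∀ w X, X.Nonempty → pick w X ∈ X

/-- `MatchHeavy(H, F)`: `star v` is the random heavy neighbour of `v`, `red v` is its colour
(`false` meaning blue); every blue vertex `w` incident to an edge `(v, star v) = (v, w)` of
`E_⋆` selects one such edge. -/
def matchHeavy (pick : Fin n → Finset (Fin n) → Fin n) (G : SimpleGraph (Fin n))
    (H F : Finset (Fin n)) : PMF (Finset (Sym2 (Fin n))) :=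
  open Classical in
  (indep n fun v => uniformOr (nbrs G H v) v).bind fun star =>
  (indep n fun _ => coin (1 / 2)).map fun red =>
    let cand : Fin n → Finset (Fin n) := fun w => F.filter fun v => red v = true ∧ star v = w
    (H.filter fun w => red w = false ∧ (cand w).Nonempty).image fun w => s(pick w (cand w), w)

/-- The variables `(Δ, V', M)` of the algorithms. -/
abbrev State (n : ℕ) : Type := ℝ × Finset (Fin n) × Finset (Sym2 (Fin n))

/-- One phase (iteration of the loop) of `GlobalAlg`. -/
def globalPhase (pick : Fin n → Finset (Fin n) → Fin n) (G : SimpleGraph (Fin n)) :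
    State n → PMF (State n) := fun (Δ, V', M) =>
  open Classical in
  let H := V'.filter fun v => Δ / 2 ≤ ((nbrs G V' v).card : ℝ)
  (randomSubset V' fun v => ((nbrs G H v).card : ℝ) / (4 * Δ)).bind fun F =>
  (matchHeavy pick G H F).map fun M' => (Δ / 2, V' \ (H ∪ F), M ∪ M')

/-- `GlobalAlg(G[U], Δ)`. -/
def globalAlg (pick : Fin n → Finset (Fin n) → Fin n) (G : SimpleGraph (Fin n))
    (U : Finset (Fin n)) (Δ : ℝ) : PMF (Finset (Sym2 (Fin n))) :=
  (iterate (globalPhase pick G) (whileCount (fun x => x / 2) 1 Δ) (Δ, U, ∅)).map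
    fun s => s.2.2

/-! ## LocalPhase -/

/-- The parameter `α`. -/
def alpha (n : ℕ) : ℝ := 96 * Real.log n

/-- The parameter `μ_R`. -/
def muR (n : ℕ) : ℝ := (10 ^ 6 * Real.logb 2 n)⁻¹

/-- The function `μ_H`. -/
def muH (n : ℕ) (r : ℝ) : ℝ :=
  if r ≤ 1 / 2 then 1 / 2 * Real.exp (alpha n / 2 * (r - 1 / 2))
  else 1 - 1 / 2 * Real.exp (-(alpha n / 2) * (r - 1 / 2))

/-- The function `μ_F`. -/
def muF (r : ℝ) : ℝ := if r ≤ 4 then max (r / 4) 0 else 1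

/-- `LocalPhase` on `G[V_i]` with threshold `Δ_⋆`; the matching found is added to `M`, and the
threshold is halved for the next phase. -/
def localPhase (mm : SimpleGraph (Fin n) → Finset (Sym2 (Fin n))) (G : SimpleGraph (Fin n)) :
    State n → PMF (State n) := fun (Δ, U, M) =>
  open Classical in
  (randomSubset U fun _ => muR n).bind fun R =>
  (randomSubset U fun v => muH n (((nbrs G R v).card : ℝ) / muR n / Δ)).bind fun H =>
  (randomSubset U fun v => muF (((nbrs G H v).card : ℝ) / Δ)).map fun F =>
    (Δ / 2, U \ (R ∪ H ∪ F), M ∪ mm (inducedOn G (H ∪ F)))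

/-! ## ParallelAlg -/

/-- The loop of `ParallelAlg` runs while `Δ` is at least this number. -/
def loopThreshold (n S : ℕ) : ℝ := (n : ℝ) / S * (200 * Real.log n) ^ 32

/-- The number `m` of sets in the partition. -/
def numParts (n S : ℕ) (Δ : ℝ) : ℕ := ⌊Real.sqrt (n * Δ / S)⌋₊

/-- The number `τ` of phases to emulate. -/
def numPhases (n S : ℕ) (Δ : ℝ) : ℕ :=
  ⌈1 / 16 * Real.logb (120 * alpha n) (Δ / numParts n S Δ)⌉₊

/-- The update of `Δ` at the end of an iteration. -/
def nextDelta (n S : ℕ) (Δ : ℝ) : ℝ := Δ / 2 ^ numPhases n S Δ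

/-- One iteration of the loop of `ParallelAlg`: `φ` is the random assignment of the vertices to
the `m` sets, and `res i` is the outcome of the computation on the `i`-th set. -/
def parallelIteration (mm : SimpleGraph (Fin n) → Finset (Sym2 (Fin n)))
    (G : SimpleGraph (Fin n)) (S : ℕ) : State n → PMF (State n) := fun (Δ, V', M) =>
  open Classical in
  let m := numParts n S Δ
  let τ := numPhases n S Δ
  (indep n fun _ => uniformOr (Finset.range m) 0).bind fun φ =>
  (indep m fun i =>
    let Vi := V'.filter fun v => φ v = i
    let Ui := if 8 * S < (inducedOn G Vi).edgeSet.ncard then ∅ else Vi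
    iterate (localPhase mm G) τ (Δ / m, Ui, ∅)).map fun res =>
  (nextDelta n S Δ, Finset.univ.biUnion fun i => (res i).2.1,
    M ∪ Finset.univ.biUnion fun i => (res i).2.2)

/-- The law of the output of `ParallelAlg(G, S)`. -/
def parallelAlg (mm : SimpleGraph (Fin n) → Finset (Sym2 (Fin n)))
    (pick : Fin n → Finset (Fin n) → Fin n) (G : SimpleGraph (Fin n)) (S : ℕ) :
    PMF (Finset (Sym2 (Fin n))) :=
  open Classical in
  (iterate (parallelIteration mm G S)
      (whileCount (nextDelta n S) (loopThreshold n S) n) ((n : ℝ), Finset.univ, ∅)).bind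
    fun (Δ, V', M) =>
  (globalAlg pick G (V'.filter fun v => ((nbrs G V' v).card : ℝ) < 2 * Δ) (2 * Δ)).map
    fun M' => M ∪ M'

/-- The loop of `GlobalAlg` terminates. -/
theorem globalAlg_terminates (Δ : ℝ) : ∃ k : ℕ, (fun x : ℝ => x / 2)^[k] Δ < 1 := by
  have hit : ∀ k : ℕ, (fun x : ℝ => x / 2)^[k] Δ = Δ / 2 ^ k := by
    intro k
    induction k with
    | zero => simp
    | succ k ih => rw [Function.iterate_succ_apply', ih, pow_succ, div_div]
  obtain ⟨k, hk⟩ := pow_unbounded_of_one_lt Δ (one_lt_two : (1 : ℝ) < 2)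
  refine ⟨k, ?_⟩
  rw [hit, div_lt_one (by positivity)]
  exact hk

/-- The loop of `ParallelAlg` terminates. -/
theorem parallelAlg_terminates (n S : ℕ) (hn : 2 ≤ n) (hS : 1 ≤ S) (hSn : S ≤ n) :
    ∃ k : ℕ, (nextDelta n S)^[k] n < loopThreshold n S := by
  have hn' : (2 : ℝ) ≤ n := by exact_mod_cast hn
  have hS' : (1 : ℝ) ≤ S := by exact_mod_cast hS
  have hSn' : (S : ℝ) ≤ n := by exact_mod_cast hSn
  have hlog : (0.69 : ℝ) < Real.log n :=
    lt_of_lt_of_le (by linarith [Real.log_two_gt_d9]) (Real.log_le_log (by norm_num) hn')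
  have hq : (1 : ℝ) ≤ n / S := by rw [le_div_iff₀ (by linarith)]; linarith
  have hp : (1 : ℝ) < (200 * Real.log n) ^ 32 :=
    one_lt_pow₀ (by linarith) (by norm_num)
  have hthr : (n : ℝ) / S < loopThreshold n S := by
    unfold loopThreshold
    nlinarith
  have step : ∀ Δ : ℝ, loopThreshold n S ≤ Δ → nextDelta n S Δ ≤ Δ / 2 := by
    intro Δ hΔ
    have hΔ1 : (1 : ℝ) < Δ := by linarith
    have hle : (n : ℝ) / S < Δ := by linarith
    have hlt : Real.sqrt (n * Δ / S) < Δ := by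
      rw [Real.sqrt_lt' (by linarith)]
      have : (n : ℝ) * Δ / S = n / S * Δ := by ring
      rw [this]
      nlinarith
    have h1 : (1 : ℝ) ≤ Real.sqrt (n * Δ / S) := by
      rw [Real.one_le_sqrt]
      have : (n : ℝ) * Δ / S = n / S * Δ := by ring
      rw [this]
      nlinarith
    have hm : 1 ≤ numParts n S Δ := by
      unfold numParts
      exact Nat.le_floor (by simpa using h1)
    have hm' : (1 : ℝ) ≤ numParts n S Δ := by exact_mod_cast hm
    have hmlt : (numParts n S Δ : ℝ) < Δ :=
      lt_of_le_of_lt (Nat.floor_le (Real.sqrt_nonneg _)) hlt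
    have hratio : 1 < Δ / numParts n S Δ := by
      rw [lt_div_iff₀ (by linarith)]; linarith
    have hbase : 1 < 120 * alpha n := by unfold alpha; linarith
    have hτ : 1 ≤ numPhases n S Δ := by
      unfold numPhases
      exact Nat.one_le_ceil_iff.mpr (mul_pos (by norm_num) (Real.logb_pos hbase hratio))
    unfold nextDelta
    have h2 : (2 : ℝ) ≤ 2 ^ numPhases n S Δ := by
      calc (2 : ℝ) = 2 ^ 1 := by norm_num
        _ ≤ _ := pow_le_pow_right₀ (by norm_num) hτ
    exact div_le_div_of_nonneg_left (by linarith) (by norm_num) h2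
  by_contra! hcon
  have hbound : ∀ k : ℕ, (nextDelta n S)^[k] n ≤ n / 2 ^ k := by
    intro k
    induction k with
    | zero => simp
    | succ k ih =>
      rw [Function.iterate_succ_apply']
      calc nextDelta n S ((nextDelta n S)^[k] n) ≤ (nextDelta n S)^[k] n / 2 := step _ (hcon k)
        _ ≤ n / 2 ^ k / 2 := by linarith
        _ = n / 2 ^ (k + 1) := by rw [pow_succ, div_div]
  obtain ⟨k, hk⟩ := pow_unbounded_of_one_lt (n : ℝ) (one_lt_two : (1 : ℝ) < 2)
  have h1 : (n : ℝ) / 2 ^ k < 1 := by rw [div_lt_one (by positivity)]; exact hk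
  linarith [hbound k, hcon k]

end Graph

/-! ## The MPC model -/

/-- An MPC program for `p` machines. A word is a natural number (its range is restricted in
`runRound`). In each of its rounds a machine turns its memory, by a local randomized computation,
into the words that it keeps and a list of messages, a message being one word with the machine it
is addressed to (longer messages are sent word by word). -/
structure Program (p : ℕ) where
  /-- the number of rounds -/
  rounds : ℕ
  /-- the local computation of a machine in a round -/
  step : (t : ℕ) → (i : Fin p) → (memory : List ℕ) → PMF (List ℕ × List (Fin p × ℕ))

/-- The contents of the memories of all machines. -/
abbrev Memories (p : ℕ) : Type := Fin p → List ℕ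

/-- Every machine holds at most `cap` words, all of them less than `W`. -/
def Fits {p : ℕ} (cap W : ℕ) (c : Memories p) : Prop :=
  ∀ i, (c i).length ≤ cap ∧ ∀ w ∈ c i, w < W

/-- The words received by machine `j`, ordered by sender and, for each sender, as sent. -/
def received {p : ℕ} (r : Fin p → List ℕ × List (Fin p × ℕ)) (j : Fin p) : List ℕ :=
  (List.finRange p).flatMap fun i => ((r i).2.filter fun x => x.1 = j).map Prod.snd

/-- The memories after the exchange of messages: the words kept, then the words received. -/
def exchange {p : ℕ} (r : Fin p → List ℕ × List (Fin p × ℕ)) : Memories p :=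
  fun j => (r j).1 ++ received r j

/-- One round; the result is `none` if on some machine the words kept and sent, or the words kept
and received, do not fit. -/
def runRound {p : ℕ} (P : Program p) (cap W : ℕ) (t : ℕ) (c : Memories p) :
    PMF (Option (Memories p)) :=
  open Classical in
  (indep p fun i => P.step t i (c i)).map fun r =>
    if Fits cap W (fun i => (r i).1 ++ (r i).2.map Prod.snd) ∧ Fits cap W (exchange r)
    then some (exchange r) else none

/-- The law of the memories after `t` rounds (`none` if a limit has been violated). -/
def runRounds {p : ℕ} (P : Program p) (cap W : ℕ) (c : Memories p) :
    ℕ → PMF (Option (Memories p))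
  | 0 => open Classical in PMF.pure (if Fits cap W c then some c else none)
  | t + 1 => (runRounds P cap W c t).bind fun o =>
      match o with
      | none => PMF.pure none
      | some d => runRound P cap W t d

/-- The edges listed in a memory: the words `u₁, v₁, u₂, v₂, …` list the edges `{u₁, v₁}`, …. -/
def listedEdges : List ℕ → Finset (Sym2 ℕ)
  | u :: v :: l => insert s(u, v) (listedEdges l)
  | _ => ∅

/-- The edges of `G` are distributed over the machines, each edge to exactly one machine and at
most `S` edges to every machine. An edge `{u, v}` is given as a pair `(u, v)` or `(v, u)`. -/
def IsInputFor {n p : ℕ} (G : SimpleGraph (Fin n)) (S : ℕ)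
    (share : Fin p → List (Fin n × Fin n)) : Prop :=
  (∀ i, (share i).length ≤ S) ∧
  (((List.finRange p).flatMap share).map fun x => s(x.1, x.2)).Nodup ∧
  ∀ e, e ∈ ((List.finRange p).flatMap share).map (fun x => s(x.1, x.2)) ↔ e ∈ G.edgeSet

/-- The initial memories: each machine holds its share `u₁, v₁, u₂, v₂, …` of the edges. -/
def initialMemories {n p : ℕ} (share : Fin p → List (Fin n × Fin n)) : Memories p :=
  fun i => (share i).flatMap fun x => [(x.1 : ℕ), (x.2 : ℕ)]

/-- The law of the set of edges that the machines collectively output, namely the edges listed in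
their memories after the last round (`none` if a limit has been violated). -/
def Program.output {p : ℕ} (P : Program p) (cap W : ℕ) (c : Memories p) :
    PMF (Option (Finset (Sym2 ℕ))) :=
  (runRounds P cap W c P.rounds).map
    (Option.map fun d => Finset.univ.biUnion fun i => listedEdges (d i))

/-- Some coupling of a run `X` (`none` meaning that it failed) with a random set of edges `Y` has
`X = some Y` with probability at least `1 - ε`. -/
def AgreesUpTo {n : ℕ} (ε : ENNReal) (X : PMF (Option (Finset (Sym2 ℕ))))
    (Y : PMF (Finset (Sym2 (Fin n)))) : Prop :=
  ∃ κ : PMF (Option (Finset (Sym2 ℕ)) × Finset (Sym2 (Fin n))),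
    κ.map Prod.fst = X ∧ κ.map Prod.snd = Y ∧
    κ.toOuterMeasure {z | z.1 ≠ some (z.2.image (Sym2.map Fin.val))} ≤ ε

end RoundCompression

end

noncomputable section

namespace RoundCompression

/-! ## Probability mass functions and independent draws -/

/-! The program reproduces `ParallelAlg` exactly: the law of its output is the image of the law of
`parallelAlg`, and no limit is ever violated (`exists_program`). The coupling is then the diagonal
one and the error probability is zero. No concentration argument is needed, because a part with more
than `8 * S` edges is emptied by the algorithm itself, so the arcs of a part always fit on one
machine. It remains to spend a constant number of rounds per loop iteration and to count iterations.

Programs are handled through `Impl`: a fragment with a fixed number of rounds takes memories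
described by a global state to memories described by a random new state. Fragments compose
(`Impl.comp`). A deterministic round is legitimate as soon as what a machine sends is a function of
its own memory and the loads are bounded (`Deliver`). Memories are read as sets of facts, so the
order of words is irrelevant. That a machine can compute something is expressed by saying that
states in which its memory is the same give the same value.

The basic tools take a constant number of rounds because a machine has at least `n^δ` words. A tree
with branching `B` about `n^(1/k)`, where `k > 2 / δ`, has constant depth, and `B * B` words fit on
a machine. Prefix sums run up and down this tree (`exists_impl_prefix_sums`). They give radix sort
in base `B` (`impl_sort`), sums over groups of items (`impl_scan`, `impl_total`), and the gathering
of small groups on single machines (`impl_gather`).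

The items are the two arcs of every edge. The state of a vertex is copied to all arcs leaving it,
and the first of these makes the random draws of the vertex. A phase of `GlobalAlg` needs only
degrees, ranks and smallest candidates: these are sums over arcs with a common source and exchanges
between an arc and its reverse (`impl_globalPhase`). In an iteration of `ParallelAlg` the arcs
inside each part are gathered, and all `τ` phases are run there in a single round (`impl_emulate`).
A vertex without neighbours in its part is not seen there, but it does not influence the others. It
survives each phase independently with probability `survival n`, so one coin with probability
`survival n ^ τ` accounts for it (`iterate_localPhase_union`, `parallelIteration_eq`). Vertices
isolated in the whole graph are stored nowhere and never affect the output.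

For the count, let `x = Δ * S / n`. Since `Δ / m ≥ √x`, an iteration multiplies `log x` by at most
`1 - c / log log n`, while `log x ≥ 1` as long as the loop runs; this gives `O((log log n)^2)`
iterations (`loopCount_le`). Afterwards `Δ` is below `n / S` times a power of `log n`, so
`GlobalAlg` has `O(log (n / S) + log log n)` phases (`phaseCount_le`). -/

theorem bind_congr_of_support {α β : Type*} {p : PMF α} {f g : α → PMF β}
    (h : ∀ a ∈ p.support, f a = g a) : p.bind f = p.bind g := by
  ext b
  rw [PMF.bind_apply, PMF.bind_apply]
  refine tsum_congr fun a => ?_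
  by_cases ha : p a = 0
  · simp [ha]
  · rw [h a ((PMF.mem_support_iff p a).2 ha)]

theorem map_congr_of_support {α β : Type*} {p : PMF α} {f g : α → β}
    (h : ∀ a ∈ p.support, f a = g a) : p.map f = p.map g := by
  rw [← PMF.bind_pure_comp, ← PMF.bind_pure_comp]
  exact bind_congr_of_support fun a ha => by simp [h a ha]

theorem map_eq_pure_of_support {α β : Type*} {p : PMF α} {f : α → β} {b : β}
    (h : ∀ a ∈ p.support, f a = b) : p.map f = PMF.pure b := by
  rw [map_congr_of_support (g := Function.const α b) h, PMF.map_const]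

theorem map_bind_eq {α β γ : Type*} (p : PMF α) (f : α → PMF β) (g : β → γ) :
    (p.bind f).map g = p.bind fun a => (f a).map g := PMF.map_bind p f g

theorem bind_map_eq {α β γ : Type*} (p : PMF α) (f : α → β) (g : β → PMF γ) :
    (p.map f).bind g = p.bind fun a => g (f a) := PMF.bind_map p f g

theorem map_as_bind {α β : Type*} (p : PMF α) (f : α → β) :
    p.map f = p.bind fun a => PMF.pure (f a) := (PMF.bind_pure_comp f p).symm

theorem indep_bind {β γ : Type} : ∀ (k : ℕ) (f : Fin k → PMF β) (g : Fin k → β → PMF γ),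
    (indep k fun i => (f i).bind (g i)) = (indep k f).bind fun x => indep k fun i => g i (x i)
  | 0, f, g => by simp [indep]
  | k + 1, f, g => by
      simp only [indep, PMF.bind_bind, bind_map_eq, indep_bind k, map_bind_eq]
      refine congrArg _ (funext fun a => ?_)
      -- The second-stage draw of the first coordinate is moved past the first-stage draws of the
      -- others.
      rw [PMF.bind_comm]
      simp

theorem indep_pure {β : Type} : ∀ (k : ℕ) (x : Fin k → β),
    (indep k fun i => PMF.pure (x i)) = PMF.pure x
  | 0, x => by
      rw [indep]
      congr 1
      exact Subsingleton.elim _ _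
  | k + 1, x => by
      rw [indep, PMF.pure_bind, indep_pure k, PMF.pure_map]
      congr 1
      exact Fin.cons_self_tail x

theorem indep_map {β γ : Type} (k : ℕ) (f : Fin k → PMF β) (g : Fin k → β → γ) :
    (indep k fun i => (f i).map (g i)) = (indep k f).map fun x i => g i (x i) := by
  simp only [map_as_bind]
  rw [indep_bind]
  exact congrArg _ (funext fun x => indep_pure k _)

theorem indep_marginal {β : Type} : ∀ (k : ℕ) (f : Fin k → PMF β) (j : Fin k),
    (indep k f).map (fun x => x j) = f j
  | 0, _, j => j.elim0
  | k + 1, f, j => by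
      rw [indep, map_bind_eq]
      simp only [PMF.map_comp, Function.comp_def]
      refine Fin.cases ?_ (fun i => ?_) j
      · simp only [Fin.cons_zero]
        have : ∀ a : β, (indep k fun i => f i.succ).map (fun _ => a) = PMF.pure a :=
          fun a => PMF.map_const _ a
        simp [this]
      · simp only [Fin.cons_succ]
        rw [indep_marginal k (fun i => f i.succ) i, PMF.bind_const]

/-- Transposition of a table of independent draws, by induction on the rows: a new row becomes the
head of all columns. -/
theorem indep_swap {β : Type} (N : ℕ) : ∀ (q : ℕ) (f : Fin q → Fin N → PMF β),
    (indep q fun i => indep N (f i)).map (fun o a i => o i a)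
      = indep N fun a => indep q fun i => f i a
  | 0, f => by
      simp only [indep, PMF.pure_map]
      rw [indep_pure N (fun _ => Fin.elim0)]
      congr 1
      funext a
      exact Subsingleton.elim _ _
  | q + 1, f => by
      simp only [indep]
      rw [indep_bind, map_bind_eq]
      refine congrArg _ (funext fun r => ?_)
      rw [indep_map N _ (fun a z => (Fin.cons (r a) z : Fin (q + 1) → β)),
        ← indep_swap N q fun i => f i.succ, PMF.map_comp, PMF.map_comp]
      congr 1
      funext o a i
      refine Fin.cases ?_ (fun i => ?_) i <;> simp

/-- Drawing a whole table and using one row per column is drawing the columns independently. -/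
theorem indep_reindex {β : Type} {q N : ℕ} (f : Fin q → Fin N → PMF β) (h : Fin N → Fin q) :
    (indep q fun i => indep N (f i)).map (fun o a => o (h a) a) = indep N fun a => f (h a) a := by
  have h1 : (fun (o : Fin q → Fin N → β) a => o (h a) a)
      = (fun (z : Fin N → Fin q → β) a => z a (h a)) ∘ (fun o a i => o i a) := rfl
  rw [h1, ← PMF.map_comp, indep_swap]
  refine (indep_map N _ (fun a (z : Fin q → β) => z (h a))).symm.trans ?_
  exact congrArg _ (funext fun a => indep_marginal q _ (h a))

theorem mem_support_indep {β : Type} {k : ℕ} {f : Fin k → PMF β} {x : Fin k → β} :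
    x ∈ (indep k f).support ↔ ∀ i, x i ∈ (f i).support := by
  simp [PMF.mem_support_iff, indep_apply, Finset.prod_eq_zero_iff]

/-! ## Composable program fragments -/

/-- A description of the memories of all machines for a global state: `read` extracts the relevant
content of a memory and `val` says what this content is. -/
structure View (p : ℕ) (Γ : Type) where
  /-- the type of contents -/
  κ : Type
  /-- the content of a memory -/
  read : List ℕ → κ
  /-- the content of the memory of a machine in a given state -/
  val : Γ → Fin p → κ

/-- Some program of `T` rounds turns memories described by `A` into memories described by `B`, the
global state changing according to `g`. -/
def Impl {p : ℕ} (cap W T : ℕ) {Γ Γ' : Type} (A : View p Γ) (B : View p Γ')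
    (g : Γ → PMF Γ') : Prop :=
  ∃ P : Program p, P.rounds = T ∧ ∀ γ c, Fits cap W c → (∀ i, A.read (c i) = A.val γ i) →
    (runRounds P cap W c T).map (Option.map fun d i => B.read (d i))
      = (g γ).map fun γ' => some (B.val γ')

section Impl

variable {p cap W : ℕ} {Γ Γ' Γ'' : Type}

/-- `Impl` only speaks of memories that fit, so the second of two fragments needs this about the
result of the first. -/
theorem fits_of_mem_runRounds (P : Program p) (c : Memories p) : ∀ (t : ℕ) (d : Memories p),
    some d ∈ (runRounds P cap W c t).support → Fits cap W d
  | 0, d, h => by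
      classical
      rw [runRounds, PMF.support_pure, Set.mem_singleton_iff] at h
      by_cases hc : Fits cap W c
      · rw [if_pos hc] at h
        exact (Option.some_inj.1 h) ▸ hc
      · rw [if_neg hc] at h
        cases h
  | t + 1, d, h => by
      classical
      rw [runRounds, PMF.mem_support_bind_iff] at h
      obtain ⟨o, -, h⟩ := h
      cases o with
      | none => simp at h
      | some e =>
        simp only [runRound, PMF.mem_support_map_iff] at h
        obtain ⟨r, -, h⟩ := h
        split_ifs at h with hf
        exact (Option.some_inj.1 h) ▸ hf.2

theorem runRounds_append (P Q R : Program p) (T : ℕ) (hP : ∀ t < T, R.step t = P.step t)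
    (hQ : ∀ t, R.step (T + t) = Q.step t) (c : Memories p) (t : ℕ) :
    runRounds R cap W c (T + t) = (runRounds P cap W c T).bind fun o =>
      match o with
      | none => PMF.pure none
      | some d => runRounds Q cap W d t := by
  classical
  have h1 : ∀ s ≤ T, runRounds R cap W c s = runRounds P cap W c s := by
    intro s
    induction s with
    | zero => intro _; rfl
    | succ s ih =>
      intro hs
      rw [runRounds, runRounds, ih (by omega)]
      simp only [runRound, hP s (by omega)]
  induction t with
  | zero =>
    rw [Nat.add_zero, h1 T le_rfl]
    conv_lhs => rw [← PMF.bind_pure (runRounds P cap W c T)]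
    refine bind_congr_of_support fun o ho => ?_
    cases o with
    | none => rfl
    | some d => simp [runRounds, fits_of_mem_runRounds P c T d ho]
  | succ t ih =>
    rw [← Nat.add_assoc, runRounds, ih, PMF.bind_bind]
    refine congrArg _ (funext fun o => ?_)
    cases o with
    | none => simp
    | some d => simp only [runRounds, runRound, hQ]

/-- The memories between the two fragments determine only a description, and several states may
share it. This is harmless: the law of the final description is that of the run of the second
program on these memories, hence the same for all such states. -/
theorem Impl.comp {T T' : ℕ} {A : View p Γ} {B : View p Γ'} {C : View p Γ''} {g : Γ → PMF Γ'}
    {g' : Γ' → PMF Γ''} (h : Impl cap W T A B g) (h' : Impl cap W T' B C g') :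
    Impl cap W (T + T') A C fun γ => (g γ).bind g' := by
  classical
  obtain ⟨P, hPT, hP⟩ := h
  obtain ⟨Q, hQT, hQ⟩ := h'
  let R : Program p :=
    ⟨T + T', fun t => if t < T then P.step t else Q.step (t - T)⟩
  refine ⟨R, rfl, fun γ c hc hγ => ?_⟩
  have hR := runRounds_append (cap := cap) (W := W) P Q R T (fun t ht => by simp [R, ht])
    (fun t => by simp [R]) c T'
  have key := hP γ c hc hγ
  -- The law of the final contents as a function of the intermediate contents. Any state with this
  -- description will do; `hΦ` shows that the choice does not matter.
  let Φ : Option (Fin p → B.κ) → PMF (Option (Fin p → C.κ)) := fun o =>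
    match o with
    | none => PMF.pure none
    | some x => if h : ∃ γ', B.val γ' = x then (g' h.choose).map fun s => some (C.val s)
        else PMF.pure none
  have hΦ : ∀ γ' d, Fits cap W d → (∀ i, B.read (d i) = B.val γ' i) →
      Φ (some (B.val γ')) = (g' γ').map fun s => some (C.val s) := by
    intro γ' d hd hdγ
    have hex : ∃ γ₁, B.val γ₁ = B.val γ' := ⟨γ', rfl⟩
    have e1 := hQ γ' d hd hdγ
    have e2 := hQ hex.choose d hd fun i => by rw [hdγ i, hex.choose_spec]
    simp only [Φ, dif_pos hex]
    rw [← e1, ← e2]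
  rw [hR, map_bind_eq]
  have e1 : ((runRounds P cap W c T).bind fun o =>
        PMF.map (Option.map fun (d : Memories p) i => C.read (d i))
        (match o with
          | none => PMF.pure none
          | some d => runRounds Q cap W d T'))
      = ((runRounds P cap W c T).map (Option.map fun d i => B.read (d i))).bind Φ := by
    rw [bind_map_eq]
    refine bind_congr_of_support fun o ho => ?_
    cases o with
    | none => simp [Φ, PMF.pure_map]
    | some d =>
      have hmem : some (fun i => B.read (d i)) ∈ ((g γ).map fun γ' => some (B.val γ')).support := by
        rw [← key]
        exact (PMF.mem_support_map_iff _ _ _).2 ⟨some d, ho, rfl⟩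
      obtain ⟨γ', -, hγ'⟩ := (PMF.mem_support_map_iff _ _ _).1 hmem
      have hv : B.val γ' = fun i => B.read (d i) := Option.some_inj.1 hγ'
      have hd := fits_of_mem_runRounds P c T d ho
      simp only [Option.map_some]
      rw [← hv, hΦ γ' d hd fun i => (congrFun hv i).symm]
      exact hQ γ' d hd fun i => (congrFun hv i).symm
  rw [e1, key, bind_map_eq, map_bind_eq]
  refine bind_congr_of_support fun γ' hγ' => ?_
  -- `hΦ` asks for actual memories described by `γ'`. They exist because `γ'` has positive
  -- probability and the descriptions have the law of the run.
  have hmem : some (B.val γ') ∈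
      ((runRounds P cap W c T).map (Option.map fun d i => B.read (d i))).support := by
    rw [key]
    exact (PMF.mem_support_map_iff _ _ _).2 ⟨γ', hγ', rfl⟩
  obtain ⟨o, ho, hoe⟩ := (PMF.mem_support_map_iff _ _ _).1 hmem
  cases o with
  | none => cases hoe
  | some d =>
    exact hΦ γ' d (fits_of_mem_runRounds P c T d ho) fun i => congrFun (Option.some_inj.1 hoe) i

theorem Impl.comp_pure {T T' : ℕ} {A B : View p Γ} {C : View p Γ'} {g : Γ → PMF Γ'}
    (h : Impl cap W T A B PMF.pure) (h' : Impl cap W T' B C g) : Impl cap W (T + T') A C g := by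
  simpa using h.comp h'

theorem Impl.zero (A : View p Γ) : Impl cap W 0 A A PMF.pure := by
  classical
  refine ⟨⟨0, fun _ _ _ => PMF.pure ([], [])⟩, rfl, fun γ c hc hγ => ?_⟩
  simp only [runRounds, if_pos hc, PMF.pure_map, Option.map_some]
  congr 2
  exact funext hγ

/-- Only the law of the described memories matters. -/
theorem Impl.congr_law {T : ℕ} {A : View p Γ} {κ : Type} {read : List ℕ → κ}
    {b : Γ' → Fin p → κ} {b' : Γ'' → Fin p → κ} {g : Γ → PMF Γ'} {g' : Γ → PMF Γ''}
    (h : Impl cap W T A ⟨κ, read, b⟩ g) (hg : ∀ γ, (g γ).map b = (g' γ).map b') :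
    Impl cap W T A ⟨κ, read, b'⟩ g' := by
  obtain ⟨P, hPT, hP⟩ := h
  refine ⟨P, hPT, fun γ c hc hγ => (hP γ c hc hγ).trans ?_⟩
  have := congrArg (PMF.map some) (hg γ)
  rwa [PMF.map_comp, PMF.map_comp] at this

/-- A single round, given by the law of the output of every machine. -/
theorem Impl.of_round {A : View p Γ} {B : View p Γ'} {g : Γ → PMF Γ'}
    (loc : Γ → Fin p → PMF (List ℕ × List (Fin p × ℕ)))
    (hloc : ∀ γ γ' i, A.val γ i = A.val γ' i → loc γ i = loc γ' i)
    (hfit : ∀ γ r, (∀ i, r i ∈ (loc γ i).support) →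
      Fits cap W (fun i => (r i).1 ++ (r i).2.map Prod.snd) ∧ Fits cap W (exchange r))
    (hlaw : ∀ γ, ((indep p (loc γ)).map fun r i => B.read (exchange r i)) = (g γ).map B.val) :
    Impl cap W 1 A B g := by
  classical
  -- A machine picks any state compatible with its own memory; by `hloc` all compatible states make
  -- it act alike. The default for incompatible memories is arbitrary.
  refine ⟨⟨1, fun _ i mem => if h : ∃ γ, A.val γ i = A.read mem then loc h.choose i
    else PMF.pure ([], [])⟩, rfl, fun γ c hc hγ => ?_⟩
  simp only [runRounds, if_pos hc, PMF.pure_bind, runRound]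
  have hstep : (fun i => if h : ∃ γ, A.val γ i = A.read (c i) then loc h.choose i
      else PMF.pure ([], [])) = loc γ := by
    funext i
    have hex : ∃ γ, A.val γ i = A.read (c i) := ⟨γ, (hγ i).symm⟩
    rw [dif_pos hex]
    exact hloc _ _ _ (hex.choose_spec.trans (hγ i))
  rw [hstep, PMF.map_comp]
  have := congrArg (PMF.map some) (hlaw γ)
  rw [PMF.map_comp, PMF.map_comp] at this
  refine Eq.trans (map_congr_of_support fun r hr => ?_) this
  simp only [Function.comp_apply]
  rw [if_pos (hfit γ r (mem_support_indep.1 hr))]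
  rfl

end Impl

/-! ## Memories that hold a set of facts -/

/-- A fact is a short list of numbers; it is stored in a single word. -/
abbrev Fact : Type := List ℕ

/-- The word that stores a fact. -/
def enc (w : Fact) : ℕ := Encodable.encode w

theorem enc_injective : Function.Injective enc := Encodable.encode_injective

/-- At most `M` numbers, all of them less than `N`. -/
def Small (M N : ℕ) (w : Fact) : Prop := w.length ≤ M ∧ ∀ x ∈ w, x < N

/-- The exponent in the bound for the code of a fact of length `M`. -/
def encExp : ℕ → ℕ
  | 0 => 1
  | M + 1 => 2 * encExp M + 1

theorem one_le_encExp : ∀ M, 1 ≤ encExp M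
  | 0 => le_rfl
  | M + 1 => by simp [encExp]

/-- A cons is coded by a pairing plus one. Pairing squares the bound, and one more factor `N` pays
for the added one; for facts of bounded length the code stays polynomial in `N`. -/
theorem enc_lt {N : ℕ} (hN : 2 ≤ N) : ∀ {M : ℕ} {w : Fact}, Small M N w → enc w < N ^ encExp M
  | M, [], _ => by
      have : enc [] = 0 := rfl
      rw [this]
      positivity
  | 0, a :: w, h => by simp [Small] at h
  | M + 1, a :: w, h => by
      have h1 : enc w < N ^ encExp M :=
        enc_lt hN ⟨by simpa using h.1, fun x hx => h.2 x (List.mem_cons_of_mem _ hx)⟩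
      have h2 : a < N ^ encExp M :=
        lt_of_lt_of_le (h.2 a (by simp)) (Nat.le_self_pow (by have := one_le_encExp M; omega) N)
      have h3 : enc (a :: w) = Nat.pair a (enc w) + 1 := rfl
      have h4 : Nat.pair a (enc w) < (N ^ encExp M) ^ 2 :=
        lt_of_lt_of_le (Nat.pair_lt_max_add_one_sq _ _)
          (Nat.pow_le_pow_left (by simpa using ⟨h2, h1⟩) 2)
      rw [h3, encExp, pow_succ, mul_comm 2, pow_mul]
      nlinarith

/-- The memories hold the sets of facts `m`. -/
abbrev factsView (p : ℕ) {Γ : Type} (m : Γ → ℕ → Finset Fact) : View p Γ :=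
  ⟨Finset ℕ, List.toFinset, fun γ i => (m γ i).image enc⟩

theorem flatMap_ite_eq {α β : Type*} [DecidableEq α] (f : α → List β) (j : α) :
    ∀ l : List α, l.Nodup → j ∈ l → (l.flatMap fun i => if i = j then f i else []) = f j
  | [], _, h => by simp at h
  | a :: l, hn, h => by
      rw [List.nodup_cons] at hn
      rw [List.flatMap_cons]
      by_cases ha : a = j
      · subst ha
        rw [if_pos rfl]
        have : (l.flatMap fun i => if i = a then f i else []) = [] := by
          rw [List.flatMap_eq_nil_iff]
          intro x hx
          rw [if_neg]
          rintro rfl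
          exact hn.1 hx
        rw [this, List.append_nil]
      · rw [if_neg ha, List.nil_append]
        exact flatMap_ite_eq f j l hn.2 ((List.mem_cons.1 h).resolve_left fun e => ha e.symm)

/-- The message list that sends the facts `s j` to every machine `j`. -/
def sendFacts {p : ℕ} (s : Fin p → Finset Fact) : List ℕ × List (Fin p × ℕ) :=
  ([], (List.finRange p).flatMap fun j => (s j).toList.map fun w => (j, enc w))

theorem received_sendFacts {p : ℕ} (s : Fin p → Fin p → Finset Fact) (j : Fin p) :
    received (fun i => sendFacts (s i)) j
      = (List.finRange p).flatMap fun i => (s i j).toList.map enc := by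
  unfold received sendFacts
  congr 1
  funext i
  rw [List.filter_flatMap]
  have : (fun j' => List.filter (fun x : Fin p × ℕ => decide (x.1 = j))
      ((s i j').toList.map fun w => (j', enc w)))
      = fun j' => if j' = j then (s i j').toList.map (fun w => (j', enc w)) else [] := by
    funext j'
    split_ifs with h
    · rw [List.filter_eq_self]
      intro x hx
      obtain ⟨w, -, rfl⟩ := List.mem_map.1 hx
      simpa using h
    · rw [List.filter_eq_nil_iff]
      intro x hx
      obtain ⟨w, -, rfl⟩ := List.mem_map.1 hx
      simpa using h
  rw [this, flatMap_ite_eq _ j _ (List.nodup_finRange p) (List.mem_finRange j)]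
  simp

section Facts

variable {p cap W : ℕ} {Γ Γ' : Type}

/-- A round in which the machines exchange facts, given by the law of what every machine sends. -/
theorem Impl.of_facts {m : Γ → ℕ → Finset Fact} {m' : Γ' → ℕ → Finset Fact} {g : Γ → PMF Γ'}
    (loc : Γ → Fin p → PMF (Fin p → Finset Fact))
    (hloc : ∀ γ γ' (i : Fin p), m γ i = m γ' i → loc γ i = loc γ' i)
    (hfit : ∀ γ (s : Fin p → Fin p → Finset Fact), (∀ i, s i ∈ (loc γ i).support) →
      (∀ i, ∑ j, (s i j).card ≤ cap) ∧ (∀ j, ∑ i, (s i j).card ≤ cap) ∧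
      ∀ i j, ∀ w ∈ s i j, enc w < W)
    (hlaw : ∀ γ, ((indep p (loc γ)).map fun s j => Finset.univ.biUnion fun i => s i j)
      = (g γ).map fun γ' (j : Fin p) => m' γ' j) :
    Impl cap W 1 (factsView p m) (factsView p m') g := by
  classical
  refine Impl.of_round (fun γ i => (loc γ i).map sendFacts) ?_ ?_ ?_
  · intro γ γ' i h
    rw [hloc γ γ' i (Finset.image_injective enc_injective h)]
  · intro γ r hr
    simp only [PMF.mem_support_map_iff] at hr
    choose s hs hsr using hr
    obtain rfl : (fun i => sendFacts (s i)) = r := funext hsr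
    obtain ⟨h1, h2, h3⟩ := hfit γ s hs
    constructor
    · intro i
      constructor
      · simpa [sendFacts, List.length_flatMap, Fin.sum_univ_def, Function.comp_def] using h1 i
      · intro w hw
        simp only [sendFacts, List.nil_append, List.mem_map, List.mem_flatMap] at hw
        obtain ⟨_, ⟨j, -, v, hv, rfl⟩, rfl⟩ := hw
        exact h3 i j v (by simpa using hv)
    · intro j
      have he : exchange (fun i => sendFacts (s i)) j
          = (List.finRange p).flatMap fun i => (s i j).toList.map enc := by
        rw [← received_sendFacts]
        rfl
      rw [he]
      constructor
      · simpa [List.length_flatMap, Fin.sum_univ_def, Function.comp_def] using h2 j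
      · intro w hw
        simp only [List.mem_map, List.mem_flatMap] at hw
        obtain ⟨i, -, v, hv, rfl⟩ := hw
        exact h3 i j v (by simpa using hv)
  · intro γ
    have key := congrArg (PMF.map fun (x : Fin p → Finset Fact) j => (x j).image enc) (hlaw γ)
    rw [PMF.map_comp, PMF.map_comp] at key
    rw [indep_map p (loc γ) fun _ => sendFacts, PMF.map_comp]
    refine Eq.trans ?_ key
    congr 1
    funext s j
    have he : exchange (fun i => sendFacts (s i)) j
        = (List.finRange p).flatMap fun i => (s i j).toList.map enc := by
      rw [← received_sendFacts]
      rfl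
    simp only [Function.comp_apply, he]
    ext w
    simp only [List.mem_toFinset, List.mem_flatMap, List.mem_map, Finset.mem_image,
      Finset.mem_biUnion, Finset.mem_univ, Finset.mem_toList, List.mem_finRange, true_and]
    constructor
    · rintro ⟨i, v, hv, rfl⟩
      exact ⟨v, ⟨i, hv⟩, rfl⟩
    · rintro ⟨v, ⟨i, hv⟩, rfl⟩
      exact ⟨i, v, hv, rfl⟩

/-- One deterministic round takes the memories `m` to the memories `m'`, every machine sending and
receiving at most `cap` facts. -/
def Deliver (p M N cap : ℕ) (m m' : Γ → ℕ → Finset Fact) : Prop :=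
  ∃ send : Γ → ℕ → ℕ → Finset Fact,
    (∀ γ γ' i, i < p → m γ i = m γ' i → send γ i = send γ' i) ∧
    (∀ γ j w, j < p → (w ∈ m' γ j ↔ ∃ i < p, w ∈ send γ i j)) ∧
    (∀ γ i, i < p → ∑ j ∈ Finset.range p, (send γ i j).card ≤ cap) ∧
    (∀ γ j, j < p → ∑ i ∈ Finset.range p, (send γ i j).card ≤ cap) ∧
    ∀ γ i j, i < p → j < p → ∀ w ∈ send γ i j, Small M N w

variable {M N c c' : ℕ} {m m₁ m₂ : Γ → ℕ → Finset Fact}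

theorem Deliver.impl (h : Deliver p M N cap m m₁) (hN : 2 ≤ N) (hW : N ^ encExp M ≤ W) :
    Impl cap W 1 (factsView p m) (factsView p m₁) PMF.pure := by
  obtain ⟨send, h1, h2, h3, h4, h5⟩ := h
  refine Impl.of_facts (fun γ i => PMF.pure fun j => send γ i j) ?_ ?_ ?_
  · intro γ γ' i hi
    rw [h1 γ γ' i i.2 hi]
  · intro γ s hs
    have hs' : s = fun (i j : Fin p) => send γ i j := by
      funext i
      simpa using hs i
    subst hs'
    refine ⟨fun i => ?_, fun j => ?_, fun i j w hw =>
      lt_of_lt_of_le (enc_lt hN (h5 γ i j i.2 j.2 w hw)) hW⟩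
    · simpa [Finset.sum_range] using h3 γ i i.2
    · simpa [Finset.sum_range] using h4 γ j j.2
  · intro γ
    rw [indep_pure, PMF.pure_map, PMF.pure_map]
    congr 1
    funext j
    ext w
    rw [h2 γ j w j.2]
    simp [Fin.exists_iff]

theorem Deliver.mono (h : Deliver p M N c m m₁) (hc : c ≤ c') : Deliver p M N c' m m₁ := by
  obtain ⟨send, h1, h2, h3, h4, h5⟩ := h
  exact ⟨send, h1, h2, fun γ i hi => (h3 γ i hi).trans hc, fun γ i hi => (h4 γ i hi).trans hc, h5⟩

/-- Two deliveries share one round at the price of adding their loads. -/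
theorem Deliver.union (h : Deliver p M N c m m₁) (h' : Deliver p M N c' m m₂) :
    Deliver p M N (c + c') m fun γ j => m₁ γ j ∪ m₂ γ j := by
  obtain ⟨s, h1, h2, h3, h4, h5⟩ := h
  obtain ⟨s', h1', h2', h3', h4', h5'⟩ := h'
  refine ⟨fun γ i j => s γ i j ∪ s' γ i j, ?_, ?_, ?_, ?_, ?_⟩
  · intro γ γ' i hi hm
    simp only [h1 γ γ' i hi hm, h1' γ γ' i hi hm]
  · intro γ j w hj
    rw [Finset.mem_union, h2 γ j w hj, h2' γ j w hj]
    simp only [Finset.mem_union, ← exists_or, ← and_or_left]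
  · intro γ i hi
    refine (Finset.sum_le_sum fun j _ => Finset.card_union_le _ _).trans ?_
    rw [Finset.sum_add_distrib]
    exact add_le_add (h3 γ i hi) (h3' γ i hi)
  · intro γ i hi
    refine (Finset.sum_le_sum fun j _ => Finset.card_union_le _ _).trans ?_
    rw [Finset.sum_add_distrib]
    exact add_le_add (h4 γ i hi) (h4' γ i hi)
  · intro γ i j hi hj w hw
    rcases Finset.mem_union.1 hw with hw | hw
    · exact h5 γ i j hi hj w hw
    · exact h5' γ i j hi hj w hw

/-- Every machine keeps, or computes, facts from its own memory. -/
theorem Deliver.keep (hl : ∀ γ γ' i, i < p → m γ i = m γ' i → m₁ γ i = m₁ γ' i)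
    (hc : ∀ γ i, i < p → (m₁ γ i).card ≤ c)
    (hs : ∀ γ i, i < p → ∀ w ∈ m₁ γ i, Small M N w) : Deliver p M N c m m₁ := by
  classical
  refine ⟨fun γ i j => if i = j then m₁ γ i else ∅, ?_, ?_, ?_, ?_, ?_⟩
  · intro γ γ' i hi h
    funext j
    simp only [hl γ γ' i hi h]
  · intro γ j w hj
    constructor
    · exact fun hw => ⟨j, hj, by simpa using hw⟩
    · rintro ⟨i, -, hw⟩
      simp only at hw
      split_ifs at hw with h
      · exact h ▸ hw
      · simp at hw
  · intro γ i hi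
    rw [Finset.sum_eq_single i]
    · simpa using hc γ i hi
    · intro j _ hj
      simp [hj.symm]
    · intro h
      simp [hi] at h
  · intro γ i hi
    rw [Finset.sum_eq_single i]
    · simpa using hc γ i hi
    · intro j _ hj
      simp [hj]
    · intro h
      simp [hi] at h
  · intro γ i j hi hj w hw
    simp only at hw
    split_ifs at hw with h
    · exact hs γ i hi w hw
    · simp at hw

/-- Every element `x` of `X` is stored on the machine `loc x` in the form `code x`. -/
def placed {ι : Type} (X : Γ → Finset ι) (loc : Γ → ι → ℕ) (code : Γ → ι → Fact) (γ : Γ) (j : ℕ) :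
    Finset Fact :=
  open Classical in ((X γ).filter fun x => loc γ x = j).image (code γ)

theorem mem_placed {ι : Type} {X : Γ → Finset ι} {loc : Γ → ι → ℕ} {code : Γ → ι → Fact} {γ : Γ}
    {j : ℕ} {w : Fact} : w ∈ placed X loc code γ j ↔ ∃ x ∈ X γ, loc γ x = j ∧ code γ x = w := by
  simp [placed, and_assoc]

theorem card_placed_le {ι : Type} {X : Γ → Finset ι} {loc : Γ → ι → ℕ} {code : Γ → ι → Fact}
    {γ : Γ} {j : ℕ} : (placed X loc code γ j).card ≤ ((X γ).filter fun x => loc γ x = j).card := by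
  classical
  unfold placed
  refine Finset.card_image_le.trans (le_of_eq ?_)
  congr!

/-- Every `x` is sent from the machine `src x`, which knows it, to the machine `dst x`. -/
theorem Deliver.route {ι : Type} (X : Γ → Finset ι) (src dst : Γ → ι → ℕ) (code : Γ → ι → Fact)
    (hk : ∀ γ γ' i x, m γ i = m γ' i → x ∈ X γ → src γ x = i →
      x ∈ X γ' ∧ src γ' x = i ∧ dst γ' x = dst γ x ∧ code γ' x = code γ x)
    (hsrc : ∀ γ, ∀ x ∈ X γ, src γ x < p)
    (hcs : ∀ γ i, ((X γ).filter fun x => src γ x = i).card ≤ c)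
    (hcd : ∀ γ j, ((X γ).filter fun x => dst γ x = j).card ≤ c)
    (hs : ∀ γ, ∀ x ∈ X γ, Small M N (code γ x)) : Deliver p M N c m (placed X dst code) := by
  classical
  refine ⟨fun γ i j => ((X γ).filter fun x => src γ x = i ∧ dst γ x = j).image (code γ),
    ?_, ?_, ?_, ?_, ?_⟩
  · intro γ γ' i hi h
    funext j
    ext w
    simp only [Finset.mem_image, Finset.mem_filter]
    constructor
    · rintro ⟨x, ⟨hx, h1, h2⟩, rfl⟩
      obtain ⟨a, b, d, e⟩ := hk γ γ' i x h hx h1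
      exact ⟨x, ⟨a, b, d.trans h2⟩, e⟩
    · rintro ⟨x, ⟨hx, h1, h2⟩, rfl⟩
      obtain ⟨a, b, d, e⟩ := hk γ' γ i x h.symm hx h1
      exact ⟨x, ⟨a, b, d.trans h2⟩, e⟩
  · intro γ j w hj
    rw [mem_placed]
    simp only [Finset.mem_image, Finset.mem_filter]
    constructor
    · rintro ⟨x, hx, h1, h2⟩
      exact ⟨src γ x, hsrc γ x hx, x, ⟨hx, rfl, h1⟩, h2⟩
    · rintro ⟨i, -, x, ⟨hx, -, h1⟩, h2⟩
      exact ⟨x, hx, h1, h2⟩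
  · intro γ i hi
    refine (Finset.sum_le_sum fun j _ => Finset.card_image_le).trans ?_
    simp only [← Finset.filter_filter]
    rw [Finset.sum_card_fiberwise_eq_card_filter]
    exact (Finset.card_le_card (Finset.filter_subset _ _)).trans (hcs γ i)
  · intro γ j hj
    refine (Finset.sum_le_sum fun i _ => Finset.card_image_le).trans ?_
    simp only [and_comm (a := src γ _ = _)]
    simp only [← Finset.filter_filter]
    rw [Finset.sum_card_fiberwise_eq_card_filter]
    exact (Finset.card_le_card (Finset.filter_subset _ _)).trans (hcd γ j)
  · intro γ i j hi hj w hw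
    obtain ⟨x, hx, rfl⟩ := Finset.mem_image.1 hw
    exact hs γ x (Finset.mem_filter.1 hx).1

end Facts

/-! ## Prefix sums over the machines -/

/-- Pairs of a group and a sum; of two pairs with different groups, addition keeps the one with the
larger group. -/
@[ext] structure MaxSum where
  /-- the group -/
  g : ℕ
  /-- the sum over the elements of the group -/
  s : ℕ

instance : Zero MaxSum := ⟨⟨0, 0⟩⟩

instance : Add MaxSum :=
  ⟨fun a b => if a.g < b.g then b else if b.g < a.g then a else ⟨a.g, a.s + b.s⟩⟩

theorem MaxSum.add_def (a b : MaxSum) :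
    a + b = if a.g < b.g then b else if b.g < a.g then a else ⟨a.g, a.s + b.s⟩ := rfl

@[simp] theorem MaxSum.zero_g : (0 : MaxSum).g = 0 := rfl

@[simp] theorem MaxSum.zero_s : (0 : MaxSum).s = 0 := rfl

/-- Keeping the larger group is associative and commutative, so segmented sums become ordinary
`Finset` sums and can be evaluated along a tree. -/
instance : AddCommMonoid MaxSum where
  add_assoc a b c := by
    obtain ⟨a, s⟩ := a
    obtain ⟨b, t⟩ := b
    obtain ⟨c, u⟩ := c
    simp only [MaxSum.add_def]
    grind
  zero_add a := by
    obtain ⟨a, s⟩ := a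
    simp only [MaxSum.add_def, MaxSum.zero_g, MaxSum.zero_s]
    grind
  add_zero a := by
    obtain ⟨a, s⟩ := a
    simp only [MaxSum.add_def, MaxSum.zero_g, MaxSum.zero_s]
    grind
  add_comm a b := by
    obtain ⟨a, s⟩ := a
    obtain ⟨b, t⟩ := b
    simp only [MaxSum.add_def]
    grind
  nsmul := nsmulRec

section TreeScan

variable {Γ : Type} {p q B L w M N K cap W : ℕ}

/-- The sum over the machines below the node `b` on level `ℓ` of a tree with branching `B`. -/
def nodeSum (q B : ℕ) (x : Γ → ℕ → ℕ → MaxSum) (γ : Γ) (ℓ b d : ℕ) : MaxSum :=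
  ∑ i ∈ (Finset.range q).filter (fun i => i / B ^ ℓ = b), x γ i d

/-- The sum over the machines to the left of the node `b` on level `ℓ`. -/
def nodePrefix (q B : ℕ) (x : Γ → ℕ → ℕ → MaxSum) (γ : Γ) (ℓ b d : ℕ) : MaxSum :=
  ∑ i ∈ (Finset.range q).filter (fun i => i / B ^ ℓ < b), x γ i d

/-- A machine below a node lies below exactly one of its children; this is the upward recursion. -/
theorem nodeSum_succ (x : Γ → ℕ → ℕ → MaxSum) (γ : Γ) (ℓ b d : ℕ) :
    nodeSum q B x γ (ℓ + 1) b d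
      = ∑ c ∈ (Finset.range q).filter (fun c => c / B = b), nodeSum q B x γ ℓ c d := by
  unfold nodeSum
  rw [← Finset.sum_fiberwise_of_maps_to (g := fun i => i / B ^ ℓ)
    (t := (Finset.range q).filter (fun c => c / B = b))]
  · refine Finset.sum_congr rfl fun c hc => ?_
    rw [Finset.filter_filter]
    refine Finset.sum_congr (Finset.filter_congr fun i _ => ?_) fun _ _ => rfl
    have hcb := (Finset.mem_filter.1 hc).2
    rw [pow_succ, ← Nat.div_div_eq_div_mul]
    constructor
    · exact fun h => h.2
    · rintro rfl
      exact ⟨hcb, rfl⟩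
  · intro i hi
    rw [Finset.mem_filter, Finset.mem_range] at hi ⊢
    rw [pow_succ, ← Nat.div_div_eq_div_mul] at hi
    exact ⟨lt_of_le_of_lt (Nat.div_le_self _ _) hi.1, hi.2⟩

/-- The machines to the left of a node are to the left of its parent or below an earlier sibling.
This is the downward recursion: a parent that knows its own prefix and the sums of its children can
serve all of them. -/
theorem nodePrefix_eq (x : Γ → ℕ → ℕ → MaxSum) (γ : Γ) (ℓ b d : ℕ) :
    nodePrefix q B x γ ℓ b d = nodePrefix q B x γ (ℓ + 1) (b / B) d
      + ∑ c ∈ (Finset.range q).filter (fun c => c / B = b / B ∧ c < b),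
          nodeSum q B x γ ℓ c d := by
  have h1 : ∑ c ∈ (Finset.range q).filter (fun c => c / B = b / B ∧ c < b), nodeSum q B x γ ℓ c d
      = ∑ i ∈ (Finset.range q).filter (fun i => i / B ^ ℓ / B = b / B ∧ i / B ^ ℓ < b),
          x γ i d := by
    unfold nodeSum
    symm
    rw [← Finset.sum_fiberwise_of_maps_to (g := fun i => i / B ^ ℓ)
      (t := (Finset.range q).filter (fun c => c / B = b / B ∧ c < b))]
    · refine Finset.sum_congr rfl fun c hc => ?_
      rw [Finset.filter_filter]
      refine Finset.sum_congr (Finset.filter_congr fun i _ => ?_) fun _ _ => rfl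
      have hcb := (Finset.mem_filter.1 hc).2
      constructor
      · exact fun h => h.2
      · rintro rfl
        exact ⟨hcb, rfl⟩
    · intro i hi
      rw [Finset.mem_filter, Finset.mem_range] at hi ⊢
      exact ⟨lt_of_le_of_lt (Nat.div_le_self _ _) hi.1, hi.2⟩
  rw [h1, nodePrefix, nodePrefix, ← Finset.sum_union]
  · refine Finset.sum_congr ?_ fun _ _ => rfl
    ext i
    simp only [Finset.mem_filter, Finset.mem_union, ← and_or_left, pow_succ,
      ← Nat.div_div_eq_div_mul]
    refine and_congr_right fun _ => ⟨fun h => ?_, ?_⟩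
    · rcases lt_or_eq_of_le (Nat.div_le_div_right (c := B) h.le) with h' | h'
      · exact Or.inl h'
      · exact Or.inr ⟨h', h⟩
    · rintro (h | h)
      · by_contra hc
        exact absurd (Nat.div_le_div_right (c := B) (not_lt.1 hc)) (not_le.2 h)
      · exact h.2
  · rw [Finset.disjoint_filter]
    intro i _ h
    rw [pow_succ, ← Nat.div_div_eq_div_mul] at h
    omega

/-- The sums of the nodes of level `ℓ`, stored at their parents. -/
def childFacts (q B w : ℕ) (x : Γ → ℕ → ℕ → MaxSum) (ℓ : ℕ) : Γ → ℕ → Finset Fact :=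
  placed (fun _ => Finset.range q ×ˢ Finset.range w) (fun _ b => b.1 / B)
    fun γ b => [1, ℓ, b.1, b.2, (nodeSum q B x γ ℓ b.1 b.2).g, (nodeSum q B x γ ℓ b.1 b.2).s]

/-- The prefix sums and the total, stored at the nodes of level `ℓ`. -/
def prefixFacts (q B L w : ℕ) (x : Γ → ℕ → ℕ → MaxSum) (ℓ : ℕ) : Γ → ℕ → Finset Fact :=
  placed (fun _ => (Finset.range q).filter (fun b => b * B ^ ℓ < q) ×ˢ Finset.range w)
    (fun _ b => b.1)
    fun γ b => [2, b.2, (nodePrefix q B x γ ℓ b.1 b.2).g, (nodePrefix q B x γ ℓ b.1 b.2).s,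
      (nodeSum q B x γ L 0 b.2).g, (nodeSum q B x γ L 0 b.2).s]

/-- The memories during the computation of prefix sums. -/
def treeMem (q B w : ℕ) (m : Γ → ℕ → Finset Fact) (x : Γ → ℕ → ℕ → MaxSum) (k : ℕ)
    (y : Γ → ℕ → Finset Fact) (γ : Γ) (j : ℕ) : Finset Fact :=
  ((m γ j).image (List.cons 0) ∪ (Finset.range k).biUnion fun ℓ => childFacts q B w x ℓ γ j) ∪ y γ j

variable {m : Γ → ℕ → Finset Fact} {x : Γ → ℕ → ℕ → MaxSum}

/-- The first number of a fact is a tag: `0` for the original memory, `1` for sums of children, `2`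
for prefixes. The tags keep the kinds apart, so equal memories have equal components. -/
theorem cons_zero_mem_treeMem {k : ℕ} {y : Γ → ℕ → Finset Fact}
    (hy : ∀ γ j, ∀ v ∈ y γ j, v.head? = some 2) {γ : Γ} {j : ℕ} {v : Fact} :
    0 :: v ∈ treeMem q B w m x k y γ j ↔ v ∈ m γ j := by
  have : 0 :: v ∉ y γ j := fun h => by simpa using hy γ j _ h
  simp [treeMem, childFacts, mem_placed, this]

theorem child_mem_treeMem {k : ℕ} {y : Γ → ℕ → Finset Fact}
    (hy : ∀ γ j, ∀ v ∈ y γ j, v.head? = some 2) {γ : Γ} {j ℓ c d a b : ℕ} :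
    [1, ℓ, c, d, a, b] ∈ treeMem q B w m x k y γ j ↔ ℓ < k ∧ c < q ∧ d < w ∧ c / B = j ∧
      (nodeSum q B x γ ℓ c d).g = a ∧ (nodeSum q B x γ ℓ c d).s = b := by
  have : [1, ℓ, c, d, a, b] ∉ y γ j := fun h => by simpa using hy γ j _ h
  simp only [treeMem, childFacts, Finset.mem_union, Finset.mem_image, Finset.mem_biUnion,
    Finset.mem_range, mem_placed, this, or_false, Finset.mem_product]
  constructor
  · rintro (⟨v, -, h⟩ | ⟨ℓ', h1, ⟨b', d'⟩, ⟨h2, h3⟩, h4, h5⟩)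
    · simp at h
    · simp only [List.cons.injEq, true_and, and_true] at h5
      obtain ⟨rfl, rfl, rfl, h6, h7⟩ := h5
      exact ⟨h1, h2, h3, h4, h6, h7⟩
  · rintro ⟨h1, h2, h3, h4, rfl, rfl⟩
    exact Or.inr ⟨ℓ, h1, (c, d), ⟨h2, h3⟩, h4, rfl⟩

theorem prefix_mem_treeMem {k : ℕ} {y : Γ → ℕ → Finset Fact} {γ : Γ} {j : ℕ} {v : Fact} :
    2 :: v ∈ treeMem q B w m x k y γ j ↔ 2 :: v ∈ y γ j := by
  simp [treeMem, childFacts, mem_placed]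

theorem base_eq_of_treeMem_eq {k : ℕ} {y : Γ → ℕ → Finset Fact}
    (hy : ∀ γ j, ∀ v ∈ y γ j, v.head? = some 2) {γ γ' : Γ} {j : ℕ}
    (h : treeMem q B w m x k y γ j = treeMem q B w m x k y γ' j) : m γ j = m γ' j := by
  ext v
  rw [← cons_zero_mem_treeMem hy (v := v), h, cons_zero_mem_treeMem hy]

theorem nodeSum_eq_of_treeMem_eq {k : ℕ} {y : Γ → ℕ → Finset Fact}
    (hy : ∀ γ j, ∀ v ∈ y γ j, v.head? = some 2) {γ γ' : Γ} {j ℓ c d : ℕ}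
    (h : treeMem q B w m x k y γ j = treeMem q B w m x k y γ' j) (hℓ : ℓ < k) (hc : c < q)
    (hd : d < w) (hj : c / B = j) : nodeSum q B x γ ℓ c d = nodeSum q B x γ' ℓ c d := by
  have := (child_mem_treeMem (m := m) (x := x) hy (γ := γ)).2 ⟨hℓ, hc, hd, hj, rfl, rfl⟩
  rw [h, child_mem_treeMem hy] at this
  exact MaxSum.ext this.2.2.2.2.1.symm this.2.2.2.2.2.symm

/-- On level `0` a node is a single machine, whose value comes from its original memory; on higher
levels the sum is computed from the stored sums of the children. -/
theorem own_nodeSum_eq_of_treeMem_eq {y : Γ → ℕ → Finset Fact}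
    (hx : ∀ γ γ' i d, m γ i = m γ' i → i < q → d < w → x γ i d = x γ' i d)
    (hy : ∀ γ j, ∀ v ∈ y γ j, v.head? = some 2) {γ γ' : Γ} {j k d : ℕ}
    (h : treeMem q B w m x k y γ j = treeMem q B w m x k y γ' j) (hj : j < q) (hd : d < w) :
    nodeSum q B x γ k j d = nodeSum q B x γ' k j d := by
  cases k with
  | zero =>
    have : (Finset.range q).filter (fun i => i / B ^ 0 = j) = {j} := by
      ext i
      simp only [pow_zero, Nat.div_one, Finset.mem_filter, Finset.mem_range, Finset.mem_singleton]
      omega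
    rw [nodeSum, nodeSum, this, Finset.sum_singleton, Finset.sum_singleton]
    exact hx γ γ' j d (base_eq_of_treeMem_eq hy h) hj hd
  | succ k =>
    rw [nodeSum_succ, nodeSum_succ]
    refine Finset.sum_congr rfl fun c hc => ?_
    rw [Finset.mem_filter, Finset.mem_range] at hc
    exact nodeSum_eq_of_treeMem_eq hy h (Nat.lt_succ_self k) hc.1 hd hc.2

theorem card_filter_div_le (hB : 0 < B) (j : ℕ) :
    ((Finset.range q ×ˢ Finset.range w).filter fun b => b.1 / B = j).card ≤ B * w := by
  calc ((Finset.range q ×ˢ Finset.range w).filter fun b => b.1 / B = j).card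
      ≤ (Finset.Ico (j * B) (j * B + B) ×ˢ Finset.range w).card := by
        refine Finset.card_le_card fun b hb => ?_
        simp only [Finset.mem_filter, Finset.mem_product, Finset.mem_Ico, Finset.mem_range] at hb ⊢
        obtain ⟨⟨-, h2⟩, rfl⟩ := hb
        refine ⟨⟨Nat.div_mul_le_self _ _, ?_⟩, h2⟩
        have := Nat.div_add_mod b.1 B
        have := Nat.mod_lt b.1 hB
        nlinarith
    _ = B * w := by simp

theorem card_filter_fst_le (X : Finset ℕ) (j : ℕ) :
    ((X ×ˢ Finset.range w).filter fun b => b.1 = j).card ≤ w := by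
  calc ((X ×ˢ Finset.range w).filter fun b => b.1 = j).card
      ≤ (({j} : Finset ℕ) ×ˢ Finset.range w).card := by
        refine Finset.card_le_card fun b hb => ?_
        simp only [Finset.mem_filter, Finset.mem_product, Finset.mem_singleton] at hb ⊢
        exact ⟨hb.2, hb.1.2⟩
    _ = w := by simp

/-- In a constant number of rounds, every machine `i` learns the sums of `x` over the machines
before it and over all machines. -/
theorem exists_impl_prefix_sums (hqp : q ≤ p) (hqB : q ≤ B ^ L) (hB : 0 < B) (hM : 5 ≤ M)
    (hN : 3 ≤ N) (hqN : q ≤ N) (hwN : w ≤ N) (hLN : L ≤ N) (hW : N ^ encExp (M + 1) ≤ W)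
    (hcap : K + (L + 1) * (B * w) ≤ cap)
    (hmc : ∀ γ j, (m γ j).card ≤ K) (hms : ∀ γ j, ∀ v ∈ m γ j, Small M N v)
    (hx : ∀ γ γ' i d, m γ i = m γ' i → i < q → d < w → x γ i d = x γ' i d)
    (hxN : ∀ γ d, ∀ T ⊆ Finset.range q, d < w →
      (∑ i ∈ T, x γ i d).g < N ∧ (∑ i ∈ T, x γ i d).s < N) :
    ∃ m' : Γ → ℕ → Finset Fact,
      Impl cap W (2 * L + 2) (factsView p m) (factsView p m') PMF.pure ∧
      ∀ γ γ' i, m' γ i = m' γ' i → m γ i = m γ' i ∧ (i < q → ∀ d < w,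
        ∑ j ∈ Finset.range i, x γ j d = ∑ j ∈ Finset.range i, x γ' j d ∧
        ∑ j ∈ Finset.range q, x γ j d = ∑ j ∈ Finset.range q, x γ' j d) := by
  classical
  let none' : Γ → ℕ → Finset Fact := fun _ _ => ∅
  have hnone : ∀ γ j, ∀ v ∈ none' γ j, v.head? = some 2 := by simp [none']
  have hpre : ∀ ℓ γ j, ∀ v ∈ prefixFacts q B L w x ℓ γ j, v.head? = some 2 := by
    intro ℓ γ j v hv
    obtain ⟨b, -, -, rfl⟩ := mem_placed.1 hv
    rfl
  have hbase : ∀ γ j, ∀ v ∈ (m γ j).image (List.cons 0), Small (M + 1) N v := by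
    intro γ j v hv
    obtain ⟨u, hu, rfl⟩ := Finset.mem_image.1 hv
    obtain ⟨h1, h2⟩ := hms γ j u hu
    refine ⟨by simpa using h1, fun y hy => ?_⟩
    rcases List.mem_cons.1 hy with rfl | hy
    · omega
    · exact h2 y hy
  have hchildS : ∀ ℓ γ, ℓ < L → ∀ b ∈ Finset.range q ×ˢ Finset.range w,
      Small (M + 1) N [1, ℓ, b.1, b.2, (nodeSum q B x γ ℓ b.1 b.2).g,
        (nodeSum q B x γ ℓ b.1 b.2).s] := by
    intro ℓ γ hℓ b hb
    rw [Finset.mem_product, Finset.mem_range, Finset.mem_range] at hb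
    have := hxN γ b.2 _ (Finset.filter_subset (fun i => i / B ^ ℓ = b.1) _) hb.2
    refine ⟨by simp; omega, ?_⟩
    simp only [List.forall_mem_cons, List.not_mem_nil, false_imp_iff, implies_true, and_true]
    exact ⟨by omega, by omega, by omega, by omega, this.1, this.2⟩
  have hprefS : ∀ ℓ γ, ∀ b ∈ (Finset.range q).filter (fun b => b * B ^ ℓ < q) ×ˢ Finset.range w,
      Small (M + 1) N [2, b.2, (nodePrefix q B x γ ℓ b.1 b.2).g,
        (nodePrefix q B x γ ℓ b.1 b.2).s, (nodeSum q B x γ L 0 b.2).g,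
        (nodeSum q B x γ L 0 b.2).s] := by
    intro ℓ γ b hb
    rw [Finset.mem_product, Finset.mem_range] at hb
    have h1 := hxN γ b.2 _ (Finset.filter_subset (fun i => i / B ^ ℓ < b.1) _) hb.2
    have h2 := hxN γ b.2 _ (Finset.filter_subset (fun i => i / B ^ L = 0) _) hb.2
    refine ⟨by simp; omega, ?_⟩
    simp only [List.forall_mem_cons, List.not_mem_nil, false_imp_iff, implies_true, and_true]
    exact ⟨by omega, by omega, h1.1, h1.2, h2.1, h2.2⟩
  have hcardUp : ∀ k γ j, k ≤ L → ((m γ j).image (List.cons 0) ∪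
      (Finset.range k).biUnion fun ℓ => childFacts q B w x ℓ γ j).card ≤ K + L * (B * w) := by
    intro k γ j hk
    refine (Finset.card_union_le _ _).trans (add_le_add
      (Finset.card_image_le.trans (hmc γ j)) ?_)
    refine (Finset.card_biUnion_le_card_mul _ _ (B * w) fun ℓ _ => ?_).trans ?_
    · exact card_placed_le.trans (card_filter_div_le hB j)
    · rw [Finset.card_range]
      exact Nat.mul_le_mul_right _ hk
  have hsmallUp : ∀ k γ j, k ≤ L → ∀ v ∈ (m γ j).image (List.cons 0) ∪
      (Finset.range k).biUnion (fun ℓ => childFacts q B w x ℓ γ j), Small (M + 1) N v := by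
    intro k γ j hk v hv
    rcases Finset.mem_union.1 hv with hv | hv
    · exact hbase γ j v hv
    · obtain ⟨ℓ, hℓ, hv⟩ := Finset.mem_biUnion.1 hv
      obtain ⟨b, hb, -, rfl⟩ := mem_placed.1 hv
      exact hchildS ℓ γ (lt_of_lt_of_le (Finset.mem_range.1 hℓ) hk) b hb
  -- In every round a machine carries over its original memory and the child sums received so far.
  -- The prefixes `y` of the previous level are dropped, so the load stays bounded.
  have keep : ∀ k y, k ≤ L → (∀ γ j, ∀ v ∈ y γ j, v.head? = some 2) →
      Deliver p (M + 1) N (K + L * (B * w)) (treeMem q B w m x k y) fun γ j =>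
        (m γ j).image (List.cons 0) ∪
          (Finset.range k).biUnion fun ℓ => childFacts q B w x ℓ γ j := by
    intro k y hk hy
    refine Deliver.keep ?_ (fun γ i _ => hcardUp k γ i hk) fun γ i _ => hsmallUp k γ i hk
    intro γ γ' i _ h
    rw [base_eq_of_treeMem_eq hy h]
    congr 1
    refine Finset.biUnion_congr rfl fun ℓ hℓ => ?_
    ext v
    simp only [childFacts, mem_placed, Finset.mem_product, Finset.mem_range]
    refine exists_congr fun b => and_congr_right fun hb => and_congr_right fun hi => ?_
    rw [nodeSum_eq_of_treeMem_eq hy h (Finset.mem_range.1 hℓ) hb.1 hb.2 hi]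
  have hN2 : 2 ≤ N := by omega
  have hBw : w ≤ B * w := Nat.le_mul_of_pos_left w hB
  have start : Impl cap W 1 (factsView p m) (factsView p (treeMem q B w m x 0 none')) PMF.pure := by
    refine Deliver.impl (Deliver.mono (c := K) ?_ (by omega)) hN2 hW
    refine Deliver.keep ?_ (fun γ i _ => ?_) fun γ i _ v hv => ?_
    · intro γ γ' i _ h
      simp [treeMem, none', h]
    · simpa [treeMem, none'] using Finset.card_image_le.trans (hmc γ i)
    · exact hbase γ i v (by simpa [treeMem, none'] using hv)
  -- Upward pass: node `b` of level `k` is played by machine `b`, which reports its sum to machine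
  -- `b / B`, the player of its parent.
  have up : ∀ k, k < L → Impl cap W 1 (factsView p (treeMem q B w m x k none'))
      (factsView p (treeMem q B w m x (k + 1) none')) PMF.pure := by
    intro k hk
    have h1 := keep k none' hk.le hnone
    have h2 : Deliver p (M + 1) N (B * w) (treeMem q B w m x k none') (childFacts q B w x k) := by
      refine Deliver.route _ (fun _ b => b.1) _ _ ?_ ?_ ?_ ?_ ?_
      · intro γ γ' i b h hb hi
        refine ⟨hb, hi, rfl, ?_⟩
        rw [Finset.mem_product, Finset.mem_range, Finset.mem_range] at hb
        rw [← hi] at h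
        rw [own_nodeSum_eq_of_treeMem_eq hx hnone h.symm hb.1 hb.2]
      · intro γ b hb
        rw [Finset.mem_product, Finset.mem_range] at hb
        omega
      · exact fun γ i => (card_filter_fst_le _ i).trans hBw
      · exact fun γ j => card_filter_div_le hB j
      · exact fun γ b hb => hchildS k γ hk b hb
    refine Deliver.impl (Deliver.mono (c := K + L * (B * w) + B * w) ?_ ?_) hN2 hW
    · convert h1.union h2 using 3 with γ j
      simp only [treeMem, none', Finset.union_empty, Finset.range_add_one, Finset.biUnion_insert]
      rw [Finset.union_assoc]
      congr 1
      exact Finset.union_comm _ _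
    · rw [add_mul, one_mul] at hcap
      omega
  have ups : ∀ k, k ≤ L → Impl cap W (1 + k) (factsView p m)
      (factsView p (treeMem q B w m x k none')) PMF.pure := by
    intro k
    induction k with
    | zero => exact fun _ => start
    | succ k ih => exact fun hk => (ih (by omega)).comp_pure (up k (by omega))
  have top : Impl cap W 1 (factsView p (treeMem q B w m x L none'))
      (factsView p (treeMem q B w m x L (prefixFacts q B L w x L))) PMF.pure := by
    have h1 := keep L none' le_rfl hnone
    have h2 : Deliver p (M + 1) N w (treeMem q B w m x L none') (prefixFacts q B L w x L) := by
      refine Deliver.route _ (fun _ b => b.1) _ _ ?_ ?_ ?_ ?_ ?_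
      · intro γ γ' i b h hb hi
        refine ⟨hb, hi, rfl, ?_⟩
        rw [Finset.mem_product, Finset.mem_filter, Finset.mem_range, Finset.mem_range] at hb
        -- Since `q ≤ B ^ L`, the root is the only node of level `L` with a machine below it.
        -- Nothing lies to its left, and its sum is the total.
        have hb0 : b.1 = 0 := by
          by_contra hne
          have : 1 * B ^ L ≤ b.1 * B ^ L := Nat.mul_le_mul_right _ (by omega)
          omega
        have hP : ∀ γ, nodePrefix q B x γ L b.1 b.2 = 0 := by
          intro γ
          rw [hb0, nodePrefix]
          simp
        rw [hP, hP]
        rw [hb0] at hb hi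
        rw [← hi] at h
        rw [own_nodeSum_eq_of_treeMem_eq hx hnone h.symm hb.1.1 hb.2]
      · intro γ b hb
        rw [Finset.mem_product, Finset.mem_filter, Finset.mem_range] at hb
        omega
      · exact fun γ i => card_filter_fst_le _ i
      · exact fun γ j => card_filter_fst_le _ j
      · exact fun γ b hb => hprefS L γ b hb
    refine Deliver.impl (Deliver.mono (c := K + L * (B * w) + w) (h1.union h2) ?_) hN2 hW
    rw [add_mul, one_mul] at hcap
    omega
  -- Downward pass: the parent computes the prefixes of its children by `nodePrefix_eq` and hands
  -- the total on unchanged.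
  have down : ∀ ℓ, ℓ < L → Impl cap W 1
      (factsView p (treeMem q B w m x L (prefixFacts q B L w x (ℓ + 1))))
      (factsView p (treeMem q B w m x L (prefixFacts q B L w x ℓ))) PMF.pure := by
    intro ℓ hℓ
    have h1 := keep L _ le_rfl (hpre (ℓ + 1))
    have h2 : Deliver p (M + 1) N (B * w)
        (treeMem q B w m x L (prefixFacts q B L w x (ℓ + 1))) (prefixFacts q B L w x ℓ) := by
      refine Deliver.route _ (fun _ b => b.1 / B) _ _ ?_ ?_ ?_ ?_ ?_
      · intro γ γ' i b h hb hi
        refine ⟨hb, hi, rfl, ?_⟩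
        rw [Finset.mem_product, Finset.mem_filter, Finset.mem_range, Finset.mem_range] at hb
        -- The parent of a node with machines below it also has machines below it, so it does hold a
        -- prefix.
        have hpar : (b.1 / B, b.2) ∈
            (Finset.range q).filter (fun b => b * B ^ (ℓ + 1) < q) ×ˢ Finset.range w := by
          rw [Finset.mem_product, Finset.mem_filter, Finset.mem_range, Finset.mem_range]
          refine ⟨⟨lt_of_le_of_lt (Nat.div_le_self _ _) hb.1.1, ?_⟩, hb.2⟩
          refine lt_of_le_of_lt ?_ hb.1.2
          rw [pow_succ, mul_comm (B ^ ℓ), ← mul_assoc]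
          exact Nat.mul_le_mul_right _ (Nat.div_mul_le_self _ _)
        have hmem := prefix_mem_treeMem (q := q) (B := B) (w := w) (m := m) (x := x) (k := L)
          (y := prefixFacts q B L w x (ℓ + 1)) |>.2 (mem_placed.2 ⟨_, hpar, hi, rfl⟩ :
            2 :: _ ∈ prefixFacts q B L w x (ℓ + 1) γ i)
        rw [h, prefix_mem_treeMem] at hmem
        obtain ⟨⟨b', d'⟩, hb', hi', he⟩ := mem_placed.1 hmem
        simp only at hi' he
        subst hi'
        simp only [List.cons.injEq, true_and, and_true] at he
        obtain ⟨rfl, e1, e2, e3, e4⟩ := he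
        rw [← hi] at e1 e2
        have e5 : nodePrefix q B x γ' (ℓ + 1) (b.1 / B) b.2
          = nodePrefix q B x γ (ℓ + 1) (b.1 / B) b.2 := MaxSum.ext e1 e2
        have e6 : nodePrefix q B x γ' ℓ b.1 b.2 = nodePrefix q B x γ ℓ b.1 b.2 := by
          rw [nodePrefix_eq, nodePrefix_eq x γ, e5]
          congr 1
          refine Finset.sum_congr rfl fun c hc => ?_
          rw [Finset.mem_filter, Finset.mem_range] at hc
          exact (nodeSum_eq_of_treeMem_eq (hpre (ℓ + 1)) h hℓ hc.1 hb.2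
            (hc.2.1.trans hi)).symm
        rw [e6, e3, e4]
      · intro γ b hb
        rw [Finset.mem_product, Finset.mem_filter, Finset.mem_range] at hb
        have := Nat.div_le_self b.1 B
        omega
      · intro γ i
        refine (Finset.card_le_card ?_).trans (card_filter_div_le (q := q) (w := w) hB i)
        exact Finset.filter_subset_filter _
          (Finset.product_subset_product_left (Finset.filter_subset _ _))
      · exact fun γ j => (card_filter_fst_le _ j).trans hBw
      · exact fun γ b hb => hprefS ℓ γ b hb
    refine Deliver.impl (Deliver.mono (c := K + L * (B * w) + B * w) (h1.union h2) ?_) hN2 hW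
    rw [add_mul, one_mul] at hcap
    omega
  have downs : ∀ k, k ≤ L → Impl cap W (1 + L + 1 + k) (factsView p m)
      (factsView p (treeMem q B w m x L (prefixFacts q B L w x (L - k)))) PMF.pure := by
    intro k
    induction k with
    | zero => exact fun _ => (ups L le_rfl).comp_pure top
    | succ k ih =>
      intro hk
      have := down (L - (k + 1)) (by omega)
      rw [show L - (k + 1) + 1 = L - k by omega] at this
      exact (ih (by omega)).comp_pure this
  refine ⟨treeMem q B w m x L (prefixFacts q B L w x 0), ?_, ?_⟩
  · have := downs L le_rfl
    rw [Nat.sub_self] at this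
    rwa [show 2 * L + 2 = 1 + L + 1 + L by ring]
  · intro γ γ' i h
    refine ⟨base_eq_of_treeMem_eq (hpre 0) h, fun hi d hd => ?_⟩
    have hP : ∀ γ, nodePrefix q B x γ 0 i d = ∑ j ∈ Finset.range i, x γ j d := by
      intro γ
      rw [nodePrefix]
      refine Finset.sum_congr ?_ fun _ _ => rfl
      ext j
      simp only [pow_zero, Nat.div_one, Finset.mem_filter, Finset.mem_range]
      omega
    have hT : ∀ γ, nodeSum q B x γ L 0 d = ∑ j ∈ Finset.range q, x γ j d := by
      intro γ
      rw [nodeSum]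
      refine Finset.sum_congr (Finset.filter_true_of_mem fun j hj => ?_) fun _ _ => rfl
      exact Nat.div_eq_of_lt (lt_of_lt_of_le (Finset.mem_range.1 hj) hqB)
    have hpar : (i, d) ∈ (Finset.range q).filter (fun b => b * B ^ 0 < q) ×ˢ Finset.range w := by
      simp [hi, hd]
    have hmem := prefix_mem_treeMem (q := q) (B := B) (w := w) (m := m) (x := x) (k := L)
      (y := prefixFacts q B L w x 0) |>.2 (mem_placed.2 ⟨_, hpar, rfl, rfl⟩ :
        2 :: _ ∈ prefixFacts q B L w x 0 γ i)
    rw [h, prefix_mem_treeMem] at hmem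
    obtain ⟨⟨b', d'⟩, hb', hi', he⟩ := mem_placed.1 hmem
    simp only at hi' he
    subst hi'
    simp only [List.cons.injEq, true_and, and_true] at he
    obtain ⟨rfl, e1, e2, e3, e4⟩ := he
    rw [← hP, ← hP, ← hT, ← hT]
    exact ⟨(MaxSum.ext e1 e2).symm, (MaxSum.ext e3 e4).symm⟩

end TreeScan

/-! ## Sorting -/

/-- The number of elements of `A` with a smaller value of `f`. -/
def rankOf {ι α : Type*} [LinearOrder α] (A : Finset ι) (f : ι → α) (a : ι) : ℕ :=
  (A.filter fun b => f b < f a).card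

theorem rankOf_lt_rankOf {ι α : Type*} [LinearOrder α] {A : Finset ι} {f : ι → α} {a b : ι}
    (ha : a ∈ A) : rankOf A f a < rankOf A f b ↔ f a < f b := by
  have mono : ∀ {a b : ι}, f a ≤ f b → rankOf A f a ≤ rankOf A f b := fun h =>
    Finset.card_le_card fun c hc => by
      rw [Finset.mem_filter] at hc ⊢
      exact ⟨hc.1, hc.2.trans_le h⟩
  constructor
  · intro h
    by_contra hc
    exact absurd (mono (not_lt.1 hc)) (not_le.2 h)
  · intro h
    refine Finset.card_lt_card ⟨fun c hc => ?_, fun hc => ?_⟩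
    · rw [Finset.mem_filter] at hc ⊢
      exact ⟨hc.1, hc.2.trans h⟩
    · have := hc (Finset.mem_filter.2 ⟨ha, h⟩)
      exact lt_irrefl _ (Finset.mem_filter.1 this).2

theorem rankOf_lt_card {ι α : Type*} [LinearOrder α] {A : Finset ι} {f : ι → α} {a : ι}
    (ha : a ∈ A) : rankOf A f a < A.card := by
  refine Finset.card_lt_card ⟨Finset.filter_subset _ _, fun h => ?_⟩
  exact lt_irrefl _ (Finset.mem_filter.1 (h ha)).2

theorem rankOf_injOn {ι α : Type*} [LinearOrder α] {A : Finset ι} {f : ι → α}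
    (hf : Set.InjOn f A) : Set.InjOn (rankOf A f) A := by
  intro a ha b hb h
  refine hf ha hb (le_antisymm ?_ ?_)
  · rw [← not_lt, ← rankOf_lt_rankOf hb, h]
    exact lt_irrefl _
  · rw [← not_lt, ← rankOf_lt_rankOf ha, h]
    exact lt_irrefl _

theorem card_filter_div_eq_le {ι : Type*} {A : Finset ι} {f : ι → ℕ} (hf : Set.InjOn f A) {K : ℕ}
    (hK : 0 < K) (j : ℕ) : (A.filter fun a => f a / K = j).card ≤ K := by
  calc (A.filter fun a => f a / K = j).card ≤ (Finset.Ico (j * K) (j * K + K)).card := by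
        refine Finset.card_le_card_of_injOn f (fun a ha => ?_) (hf.mono fun a ha => ?_)
        · rw [Finset.mem_coe, Finset.mem_filter] at ha
          rw [Finset.mem_coe, Finset.mem_Ico]
          obtain ⟨-, rfl⟩ := ha
          have := Nat.div_add_mod (f a) K
          have := Nat.mod_lt (f a) hK
          exact ⟨Nat.div_mul_le_self _ _, by nlinarith⟩
        · exact (Finset.mem_filter.1 ha).1
    _ = K := by simp

theorem sum_mk_zero {α : Type*} (T : Finset α) (s : α → ℕ) :
    ∑ i ∈ T, (⟨0, s i⟩ : MaxSum) = ⟨0, ∑ i ∈ T, s i⟩ := by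
  classical
  induction T using Finset.induction_on with
  | empty => rfl
  | insert a T ha ih =>
    rw [Finset.sum_insert ha, Finset.sum_insert ha, ih]
    simp [MaxSum.add_def]

/-- The parameters of a computation: `q` of the `p` machines are used, in a tree of depth `L` with
branching `B`; a machine is the home of at most `K` items, the names of which are less than `I`;
there are `G` groups of items, of which at most `Kg` items are gathered on a machine; sort keys have
`D + 1` digits in base `B`, and all numbers are less than `N`. -/
structure Params where
  (p q B L D N K Kg I G cap W : ℕ)
  q_le_p : q ≤ p
  q_le_pow : q ≤ B ^ L
  B_pos : 0 < B
  K_pos : 0 < K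
  three_le_N : 3 ≤ N
  G_pos : 0 < G
  q_le_N : q ≤ N
  B_le_N : B ≤ N
  L_le_N : L ≤ N
  I_le_N : I ≤ N
  mul_le_N : q * K ≤ N
  G_le_N : G ≤ N
  G_mul_le_N : G * I ≤ N
  G_mul_le_pow : G * I ≤ B ^ (D + 1)
  pow_le_W : N ^ encExp 32 ≤ W
  le_cap : 3 * K + Kg + (L + 1) * (B * B) ≤ cap

/-- Items and their home machines. -/
structure Layout (P : Params) (ι : Type) where
  /-- the items -/
  A : Finset ι
  /-- the home machine of an item -/
  home : ι → ℕ
  home_lt : ∀ a ∈ A, home a < P.q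
  load : ∀ i, (A.filter fun a => home a = i).card ≤ P.K
  card_le : A.card ≤ P.q * P.K
  card_lt : A.card < P.N

theorem Small.mono {M M' N : ℕ} {v : Fact} (h : Small M N v) (hM : M ≤ M') : Small M' N v :=
  ⟨h.1.trans hM, h.2⟩

theorem small_cons {M N a : ℕ} {v : Fact} : Small (M + 1) N (a :: v) ↔ a < N ∧ Small M N v := by
  simp only [Small, List.length_cons, add_le_add_iff_right, List.forall_mem_cons]
  tauto

theorem small_append {M M' N : ℕ} {v w : Fact} (h : Small M N v) (h' : Small M' N w) :
    Small (M + M') N (v ++ w) := by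
  refine ⟨by simpa using add_le_add h.1 h'.1, fun x hx => ?_⟩
  rcases List.mem_append.1 hx with hx | hx
  · exact h.2 x hx
  · exact h'.2 x hx

theorem placed_know {Γ ι : Type} {X : Γ → Finset ι} {loc : Γ → ι → ℕ} {code : Γ → ι → Fact}
    (hcode : ∀ γ γ' a b, code γ a = code γ' b → a = b) {γ γ' : Γ} {i : ℕ} {a : ι}
    (h : placed X loc code γ i = placed X loc code γ' i) (ha : a ∈ X γ) (hi : loc γ a = i) :
    a ∈ X γ' ∧ loc γ' a = i ∧ code γ' a = code γ a := by
  have hmem : code γ a ∈ placed X loc code γ i := mem_placed.2 ⟨a, ha, hi, rfl⟩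
  rw [h] at hmem
  obtain ⟨b, hb, hbi, hbc⟩ := mem_placed.1 hmem
  obtain rfl := hcode _ _ _ _ hbc
  exact ⟨hb, hbi, hbc⟩

section Sorting

variable {P : Params} {Γ ι : Type} (idn : ι → ℕ) (lay : Γ → Layout P ι)

/-- Every item is at home, with the fields `F`. -/
def homeMem (F : Γ → ι → List ℕ) : Γ → ℕ → Finset Fact :=
  placed (fun γ => (lay γ).A) (fun γ => (lay γ).home) fun γ a => idn a :: F γ a

/-- The initial position of an item. -/
def startPos (γ : Γ) (a : ι) : ℕ :=
  (lay γ).home a * P.K +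
    ((lay γ).A.filter fun b => (lay γ).home b = (lay γ).home a ∧ idn b < idn a).card

/-- What the items are sorted by in the first `t` passes. -/
def passKey (κ : Γ → ι → ℕ) (t : ℕ) (γ : Γ) (a : ι) : ℕ ×ₗ ℕ :=
  toLex (κ γ a % P.B ^ t, startPos idn lay γ a)

/-- The position of an item after `t` passes. -/
def passPos (κ : Γ → ι → ℕ) : ℕ → Γ → ι → ℕ
  | 0, γ, a => startPos idn lay γ a
  | t + 1, γ, a => rankOf (lay γ).A (passKey idn lay κ (t + 1) γ) a

/-- The memories after `t` passes. -/
def passMem (κ : Γ → ι → ℕ) (F : Γ → ι → List ℕ) (t : ℕ) : Γ → ℕ → Finset Fact :=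
  placed (fun γ => (lay γ).A) (fun γ a => passPos idn lay κ t γ a / P.K)
    fun γ a => idn a :: passPos idn lay κ t γ a :: κ γ a :: (lay γ).home a :: F γ a

/-- The rank of an item. -/
def rk (κ : Γ → ι → ℕ) (γ : Γ) (a : ι) : ℕ := rankOf (lay γ).A (κ γ) a

/-- The memories after sorting. -/
def sortedMem (κ : Γ → ι → ℕ) (F : Γ → ι → List ℕ) : Γ → ℕ → Finset Fact :=
  placed (fun γ => (lay γ).A) (fun γ a => rk lay κ γ a / P.K)
    fun γ a => idn a :: rk lay κ γ a :: κ γ a :: (lay γ).home a :: F γ a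

/-- `f` is determined by the fields `F`. -/
def FieldLocal {β : Type} (F : Γ → ι → List ℕ) (f : Γ → ι → β) : Prop :=
  ∀ γ γ' a, a ∈ (lay γ).A → a ∈ (lay γ').A → F γ a = F γ' a → f γ a = f γ' a

variable {idn lay}

/-- At most `K` items share a home, so the rank within the home is less than `K`. Positions come in
blocks of length `K`, one per machine. -/
theorem startPos_div {γ : Γ} {a : ι} (ha : a ∈ (lay γ).A) :
    startPos idn lay γ a / P.K = (lay γ).home a := by
  have : ((lay γ).A.filter fun b => (lay γ).home b = (lay γ).home a ∧ idn b < idn a).card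
      < P.K := by
    refine lt_of_lt_of_le (Finset.card_lt_card ?_) ((lay γ).load ((lay γ).home a))
    refine ⟨fun b hb => ?_, fun h => ?_⟩
    · rw [Finset.mem_filter] at hb ⊢
      exact ⟨hb.1, hb.2.1⟩
    · have := h (Finset.mem_filter.2 ⟨ha, rfl⟩)
      exact lt_irrefl _ (Finset.mem_filter.1 this).2.2
  rw [startPos, mul_comm, Nat.mul_add_div P.K_pos, Nat.div_eq_of_lt this, add_zero]

theorem startPos_injOn (hid : Function.Injective idn) (γ : Γ) :
    Set.InjOn (startPos idn lay γ) (lay γ).A := by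
  intro a ha b hb h
  have hh : (lay γ).home a = (lay γ).home b := by
    rw [← startPos_div ha, h, startPos_div hb]
  have h2 : rankOf ((lay γ).A.filter fun c => (lay γ).home c = (lay γ).home a) idn a
      = rankOf ((lay γ).A.filter fun c => (lay γ).home c = (lay γ).home a) idn b := by
    rw [startPos, startPos, ← hh] at h
    simpa [rankOf, Finset.filter_filter] using h
  exact rankOf_injOn (A := (lay γ).A.filter fun c => (lay γ).home c = (lay γ).home a) hid.injOn
    (Finset.mem_coe.2 (Finset.mem_filter.2 ⟨ha, rfl⟩))
    (Finset.mem_coe.2 (Finset.mem_filter.2 ⟨hb, hh.symm⟩)) h2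

/-- The invariant of radix sort. For `t = 0` the positions may have gaps, but they are the tie-break
itself and every key is `0` modulo `B ^ 0`. -/
theorem passPos_lt_iff {κ : Γ → ι → ℕ} {t : ℕ} {γ : Γ} {a b : ι} (ha : a ∈ (lay γ).A) :
    passPos idn lay κ t γ a < passPos idn lay κ t γ b
      ↔ passKey idn lay κ t γ a < passKey idn lay κ t γ b := by
  cases t with
  | zero => simp [passPos, passKey, Prod.Lex.toLex_lt_toLex, Nat.mod_one]
  | succ t => exact rankOf_lt_rankOf ha

theorem passPos_injOn (hid : Function.Injective idn) (κ : Γ → ι → ℕ) (t : ℕ) (γ : Γ) :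
    Set.InjOn (passPos idn lay κ t γ) (lay γ).A := by
  cases t with
  | zero => exact startPos_injOn hid γ
  | succ t =>
    refine rankOf_injOn fun a ha b hb h => startPos_injOn hid γ ha hb ?_
    exact (Prod.ext_iff.1 (toLex.injective h)).2

theorem passPos_div_lt {κ : Γ → ι → ℕ} {t : ℕ} {γ : Γ} {a : ι}
    (ha : a ∈ (lay γ).A) : passPos idn lay κ t γ a / P.K < P.q := by
  cases t with
  | zero =>
    rw [passPos, startPos_div ha]
    exact (lay γ).home_lt a ha
  | succ t =>
    rw [Nat.div_lt_iff_lt_mul P.K_pos]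
    exact lt_of_lt_of_le (rankOf_lt_card ha) (lay γ).card_le

theorem passPos_lt {κ : Γ → ι → ℕ} {t : ℕ} {γ : Γ} {a : ι}
    (ha : a ∈ (lay γ).A) : passPos idn lay κ t γ a < P.N :=
  lt_of_lt_of_le ((Nat.div_lt_iff_lt_mul P.K_pos).1 (passPos_div_lt ha)) P.mul_le_N

/-- Modulo `B ^ (t + 1)` the digit `t` decides first and the lower digits afterwards, so a stable
pass by digit `t` refines the previous order correctly. -/
theorem passKey_succ_lt_iff {κ : Γ → ι → ℕ} {t : ℕ} {γ : Γ} {a b : ι} :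
    passKey idn lay κ (t + 1) γ b < passKey idn lay κ (t + 1) γ a ↔
      κ γ b / P.B ^ t % P.B < κ γ a / P.B ^ t % P.B ∨
      (κ γ b / P.B ^ t % P.B = κ γ a / P.B ^ t % P.B ∧
        passKey idn lay κ t γ b < passKey idn lay κ t γ a) := by
  have hB : 0 < P.B ^ t := pow_pos P.B_pos t
  have h1 := Nat.mod_lt (κ γ a) hB
  have h2 := Nat.mod_lt (κ γ b) hB
  simp only [passKey, Prod.Lex.toLex_lt_toLex, Nat.mod_pow_succ]
  generalize κ γ a % P.B ^ t = x at *
  generalize κ γ b % P.B ^ t = y at *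
  generalize κ γ a / P.B ^ t % P.B = d
  generalize κ γ b / P.B ^ t % P.B = e
  rcases lt_trichotomy e d with h | rfl | h
  · have : P.B ^ t * (e + 1) ≤ P.B ^ t * d := Nat.mul_le_mul_left _ h
    simp only [h, true_or, iff_true]
    left
    nlinarith
  · simp
  · have : P.B ^ t * (d + 1) ≤ P.B ^ t * e := Nat.mul_le_mul_left _ h
    simp only [not_lt.2 h.le, h.ne', false_or, false_and, iff_false]
    rintro (h' | h')
    · nlinarith
    · nlinarith [h'.1]

/-- The items in front are those with a smaller digit, those with the same digit on earlier
machines, and those with the same digit earlier on the same machine. The first two counts are totals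
and prefix sums of digit counts; the third is local. -/
theorem passPos_succ {κ : Γ → ι → ℕ} {t : ℕ} {γ : Γ} {a : ι} :
    passPos idn lay κ (t + 1) γ a =
      ∑ d ∈ Finset.range (κ γ a / P.B ^ t % P.B), ∑ i ∈ Finset.range P.q,
        ((lay γ).A.filter fun b => passPos idn lay κ t γ b / P.K = i ∧
          κ γ b / P.B ^ t % P.B = d).card
      + ∑ i ∈ Finset.range (passPos idn lay κ t γ a / P.K),
        ((lay γ).A.filter fun b => passPos idn lay κ t γ b / P.K = i ∧
          κ γ b / P.B ^ t % P.B = κ γ a / P.B ^ t % P.B).card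
      + ((lay γ).A.filter fun b => passPos idn lay κ t γ b / P.K = passPos idn lay κ t γ a / P.K ∧
          κ γ b / P.B ^ t % P.B = κ γ a / P.B ^ t % P.B ∧
          passPos idn lay κ t γ b < passPos idn lay κ t γ a).card := by
  classical
  have e1 : ∀ d, ∑ i ∈ Finset.range P.q, ((lay γ).A.filter fun b =>
      passPos idn lay κ t γ b / P.K = i ∧ κ γ b / P.B ^ t % P.B = d).card
      = ((lay γ).A.filter fun b => κ γ b / P.B ^ t % P.B = d).card := by
    intro d
    simp only [and_comm (b := κ γ _ / P.B ^ t % P.B = d)]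
    simp only [← Finset.filter_filter]
    rw [Finset.sum_card_fiberwise_eq_card_filter]
    congr 1
    refine Finset.filter_true_of_mem fun b hb => ?_
    rw [Finset.mem_range]
    exact passPos_div_lt (Finset.mem_filter.1 hb).1
  have e2 : ∑ i ∈ Finset.range (passPos idn lay κ t γ a / P.K),
        ((lay γ).A.filter fun b => passPos idn lay κ t γ b / P.K = i ∧
          κ γ b / P.B ^ t % P.B = κ γ a / P.B ^ t % P.B).card
      = ((lay γ).A.filter fun b => κ γ b / P.B ^ t % P.B = κ γ a / P.B ^ t % P.B ∧
          passPos idn lay κ t γ b / P.K < passPos idn lay κ t γ a / P.K).card := by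
    simp only [and_comm (b := κ γ _ / P.B ^ t % P.B = κ γ a / P.B ^ t % P.B)]
    simp only [← Finset.filter_filter]
    rw [Finset.sum_card_fiberwise_eq_card_filter]
    simp only [Finset.mem_range]
  simp only [e1]
  rw [e2, Finset.sum_card_fiberwise_eq_card_filter, ← Finset.card_union_of_disjoint,
    ← Finset.card_union_of_disjoint, passPos, rankOf]
  · congr 1
    ext b
    simp only [Finset.mem_filter, Finset.mem_union, Finset.mem_range, ← and_or_left]
    refine and_congr_right fun hb => ?_
    rw [passKey_succ_lt_iff, ← passPos_lt_iff hb]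
    constructor
    · rintro (h | ⟨h1, h2⟩)
      · exact Or.inl (Or.inl h)
      · rcases lt_or_eq_of_le (Nat.div_le_div_right (c := P.K) h2.le) with h | h
        · exact Or.inl (Or.inr ⟨h1, h⟩)
        · exact Or.inr ⟨h, h1, h2⟩
    · rintro ((h | ⟨h1, h2⟩) | ⟨h1, h2, h3⟩)
      · exact Or.inl h
      · refine Or.inr ⟨h1, ?_⟩
        by_contra hc
        exact absurd (Nat.div_le_div_right (c := P.K) (not_lt.1 hc)) (not_le.2 h2)
      · exact Or.inr ⟨h2, h3⟩
  · rw [Finset.disjoint_left]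
    intro b hb hb'
    simp only [Finset.mem_filter, Finset.mem_union, Finset.mem_range] at hb hb'
    omega
  · rw [Finset.disjoint_left]
    intro b hb hb'
    simp only [Finset.mem_filter, Finset.mem_range] at hb hb'
    omega

theorem card_homeMem_le (F : Γ → ι → List ℕ) (γ : Γ) (j : ℕ) :
    (homeMem idn lay F γ j).card ≤ P.K :=
  card_placed_le.trans ((lay γ).load j)

theorem homeMem_know (hid : Function.Injective idn) {F : Γ → ι → List ℕ} {γ γ' : Γ} {i : ℕ} {a : ι}
    (h : homeMem idn lay F γ i = homeMem idn lay F γ' i) (ha : a ∈ (lay γ).A)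
    (hi : (lay γ).home a = i) :
    a ∈ (lay γ').A ∧ (lay γ').home a = i ∧ F γ' a = F γ a := by
  obtain ⟨h1, h2, h3⟩ := placed_know (fun γ γ' a b hab => hid (List.cons.inj hab).1) h ha hi
  exact ⟨h1, h2, (List.cons.inj h3).2⟩

theorem passMem_know (hid : Function.Injective idn) {κ : Γ → ι → ℕ} {F : Γ → ι → List ℕ} {t : ℕ}
    {γ γ' : Γ} {i : ℕ} {a : ι}
    (h : passMem idn lay κ F t γ i = passMem idn lay κ F t γ' i) (ha : a ∈ (lay γ).A)
    (hi : passPos idn lay κ t γ a / P.K = i) :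
    a ∈ (lay γ').A ∧ passPos idn lay κ t γ' a = passPos idn lay κ t γ a ∧ κ γ' a = κ γ a ∧
      (lay γ').home a = (lay γ).home a ∧ F γ' a = F γ a := by
  obtain ⟨h1, h2, h3⟩ := placed_know (fun γ γ' a b hab => hid (List.cons.inj hab).1) h ha hi
  simp only [List.cons.injEq, true_and] at h3
  exact ⟨h1, h3.1, h3.2.1, h3.2.2.1, h3.2.2.2⟩

theorem filter_congr_of_passMem (hid : Function.Injective idn) {κ : Γ → ι → ℕ}
    {F : Γ → ι → List ℕ} {t : ℕ} {γ γ' : Γ} {i : ℕ}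
    (h : passMem idn lay κ F t γ i = passMem idn lay κ F t γ' i) (Q : ℕ → ℕ → Prop)
    [∀ a b, Decidable (Q a b)] :
    ((lay γ).A.filter fun b => passPos idn lay κ t γ b / P.K = i ∧
        Q (κ γ b) (passPos idn lay κ t γ b))
      = (lay γ').A.filter fun b => passPos idn lay κ t γ' b / P.K = i ∧
        Q (κ γ' b) (passPos idn lay κ t γ' b) := by
  ext b
  simp only [Finset.mem_filter]
  constructor
  · rintro ⟨hb, hi, hQ⟩
    obtain ⟨h1, h2, h3, -⟩ := passMem_know hid h hb hi
    exact ⟨h1, by rw [h2]; exact hi, by rw [h2, h3]; exact hQ⟩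
  · rintro ⟨hb, hi, hQ⟩
    obtain ⟨h1, h2, h3, -⟩ := passMem_know hid h.symm hb hi
    exact ⟨h1, by rw [h2]; exact hi, by rw [h2, h3]; exact hQ⟩

theorem small_passMem (hI : ∀ a, idn a < P.I) {κ : Γ → ι → ℕ}
    {F : Γ → ι → List ℕ} {t : ℕ} (hκN : ∀ γ, ∀ a ∈ (lay γ).A, κ γ a < P.N)
    (hF : ∀ γ, ∀ a ∈ (lay γ).A, Small 24 P.N (F γ a)) (γ : Γ) (a : ι) (ha : a ∈ (lay γ).A) :
    Small 31 P.N (idn a :: passPos idn lay κ t γ a :: κ γ a :: (lay γ).home a :: F γ a) := by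
  refine Small.mono (M := 28) ?_ (by norm_num)
  simp only [small_cons]
  exact ⟨lt_of_lt_of_le (hI a) P.I_le_N, passPos_lt ha, hκN γ a ha,
    lt_of_lt_of_le ((lay γ).home_lt a ha) P.q_le_N, hF γ a ha⟩

/-- One pass: the `B` digit counts of all machines are summed at once, with one coordinate per
digit, and one further round moves the items. -/
theorem impl_pass (hid : Function.Injective idn) (hI : ∀ a, idn a < P.I) {κ : Γ → ι → ℕ}
    {F : Γ → ι → List ℕ} (hκN : ∀ γ, ∀ a ∈ (lay γ).A, κ γ a < P.N)
    (hF : ∀ γ, ∀ a ∈ (lay γ).A, Small 24 P.N (F γ a)) (t : ℕ) :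
    Impl P.cap P.W (2 * P.L + 3) (factsView P.p (passMem idn lay κ F t))
      (factsView P.p (passMem idn lay κ F (t + 1))) PMF.pure := by
  classical
  let dig : Γ → ι → ℕ := fun γ b => κ γ b / P.B ^ t % P.B
  let cnt : Γ → ℕ → ℕ → ℕ := fun γ i d =>
    ((lay γ).A.filter fun b => passPos idn lay κ t γ b / P.K = i ∧ dig γ b = d).card
  have hsm := fun t => small_passMem (t := t) hI hκN hF
  obtain ⟨m', himpl, hm'⟩ := exists_impl_prefix_sums (p := P.p) (q := P.q) (B := P.B) (L := P.L)
    (w := P.B) (M := 31) (N := P.N) (K := P.K) (cap := P.cap) (W := P.W)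
    (m := passMem idn lay κ F t) (x := fun γ i d => ⟨0, cnt γ i d⟩)
    P.q_le_p P.q_le_pow P.B_pos (by norm_num) P.three_le_N P.q_le_N P.B_le_N P.L_le_N P.pow_le_W
    (by have := P.le_cap; omega)
    (fun γ j => card_placed_le.trans
      (card_filter_div_eq_le (passPos_injOn hid κ t γ) P.K_pos j))
    (fun γ j v hv => by
      obtain ⟨a, ha, -, rfl⟩ := mem_placed.1 hv
      exact hsm t γ a ha)
    (fun γ γ' i d h _ _ => by
      simp only [MaxSum.mk.injEq, true_and, cnt]
      exact congrArg _ (filter_congr_of_passMem hid h fun k _ => k / P.B ^ t % P.B = d))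
    (fun γ d T _ _ => by
      rw [sum_mk_zero]
      refine ⟨by have := P.three_le_N; simp only; omega, ?_⟩
      simp only [cnt, and_comm (b := dig γ _ = d)]
      simp only [← Finset.filter_filter]
      rw [Finset.sum_card_fiberwise_eq_card_filter]
      exact lt_of_le_of_lt (Finset.card_le_card ((Finset.filter_subset _ _).trans
        (Finset.filter_subset _ _))) (lay γ).card_lt)
  have hroute : Deliver P.p 32 P.N P.K m' (passMem idn lay κ F (t + 1)) := by
    refine Deliver.route _ (fun γ a => passPos idn lay κ t γ a / P.K) _ _ ?_ ?_ ?_ ?_ ?_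
    · intro γ γ' i a h ha hi
      obtain ⟨h1, h2⟩ := hm' γ γ' i h
      obtain ⟨k1, k2, k3, k4, k5⟩ := passMem_know hid h1 ha hi
      have hiq : i < P.q := hi ▸ passPos_div_lt ha
      have h2 := h2 hiq
      simp only [sum_mk_zero, MaxSum.mk.injEq, true_and] at h2
      -- The three terms of `passPos_succ` are read off from the totals, the prefixes at machine
      -- `i`, and the memory of machine `i`.
      have hpos : passPos idn lay κ (t + 1) γ' a = passPos idn lay κ (t + 1) γ a := by
        rw [passPos_succ, passPos_succ (γ := γ), k2, k3, hi]
        congr 1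
        · congr 1
          · refine Finset.sum_congr rfl fun d hd => ?_
            rw [Finset.mem_range] at hd
            exact (h2 d (hd.trans (Nat.mod_lt _ P.B_pos))).2.symm
          · exact (h2 _ (Nat.mod_lt _ P.B_pos)).1.symm
        · exact congrArg _ (filter_congr_of_passMem hid h1 fun k s =>
            k / P.B ^ t % P.B = κ γ a / P.B ^ t % P.B ∧ s < passPos idn lay κ t γ a).symm
      exact ⟨k1, by rw [k2]; exact hi, by rw [hpos], by rw [hpos, k3, k4, k5]⟩
    · exact fun γ a ha => (passPos_div_lt ha).trans_le P.q_le_p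
    · exact fun γ i => card_filter_div_eq_le (passPos_injOn hid κ t γ) P.K_pos i
    · exact fun γ i => card_filter_div_eq_le (passPos_injOn hid κ (t + 1) γ) P.K_pos i
    · exact fun γ a ha => (hsm (t + 1) γ a ha).mono (by norm_num)
  exact himpl.comp_pure (Deliver.impl (hroute.mono (by have := P.le_cap; omega))
    (by have := P.three_le_N; omega) P.pow_le_W)

/-- In a constant number of rounds, the items are sorted by `κ`. -/
theorem impl_sort (hid : Function.Injective idn) (hI : ∀ a, idn a < P.I) {κ : Γ → ι → ℕ}
    {F : Γ → ι → List ℕ} (hκ : FieldLocal lay F κ) (hκi : ∀ γ, Set.InjOn (κ γ) (lay γ).A)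
    (hκN : ∀ γ, ∀ a ∈ (lay γ).A, κ γ a < P.N)
    (hκD : ∀ γ, ∀ a ∈ (lay γ).A, κ γ a < P.B ^ (P.D + 1))
    (hF : ∀ γ, ∀ a ∈ (lay γ).A, Small 24 P.N (F γ a)) :
    Impl P.cap P.W (1 + (P.D + 1) * (2 * P.L + 3)) (factsView P.p (homeMem idn lay F))
      (factsView P.p (sortedMem idn lay κ F)) PMF.pure := by
  classical
  have hsm := fun t => small_passMem (t := t) hI hκN hF
  -- The first positions need no communication, since a rank among the items of the same home is
  -- known there.
  have hstart : Deliver P.p 32 P.N P.K (homeMem idn lay F) (passMem idn lay κ F 0) := by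
    refine Deliver.keep ?_ ?_ ?_
    · have key : ∀ γ γ' i, homeMem idn lay F γ i = homeMem idn lay F γ' i →
          passMem idn lay κ F 0 γ i ⊆ passMem idn lay κ F 0 γ' i := by
        intro γ γ' i h w hw
        obtain ⟨a, ha, hi, rfl⟩ := mem_placed.1 hw
        rw [passPos, startPos_div ha] at hi
        obtain ⟨h1, h2, h3⟩ := homeMem_know hid h ha hi
        have hsp : startPos idn lay γ' a = startPos idn lay γ a := by
          rw [startPos, startPos, h2, hi]
          congr 2
          ext b
          simp only [Finset.mem_filter]
          constructor
          · rintro ⟨hb, hbi, hba⟩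
            obtain ⟨k1, k2, -⟩ := homeMem_know hid h.symm hb hbi
            exact ⟨k1, k2, hba⟩
          · rintro ⟨hb, hbi, hba⟩
            obtain ⟨k1, k2, -⟩ := homeMem_know hid h hb hbi
            exact ⟨k1, k2, hba⟩
        refine mem_placed.2 ⟨a, h1, ?_, ?_⟩
        · rw [passPos, startPos_div h1, h2]
        · simp only [passPos]
          rw [hsp, h3, h2, hi, hκ γ γ' a ha h1 h3.symm]
      exact fun γ γ' i _ h => (key γ γ' i h).antisymm (key γ' γ i h.symm)
    · exact fun γ j _ => card_placed_le.trans
        (card_filter_div_eq_le (passPos_injOn hid κ 0 γ) P.K_pos j)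
    · intro γ j _ w hw
      obtain ⟨a, ha, -, rfl⟩ := mem_placed.1 hw
      exact (hsm 0 γ a ha).mono (by norm_num)
  have hall : ∀ t, Impl P.cap P.W (1 + t * (2 * P.L + 3)) (factsView P.p (homeMem idn lay F))
      (factsView P.p (passMem idn lay κ F t)) PMF.pure := by
    intro t
    induction t with
    | zero =>
      simpa using Deliver.impl (hstart.mono (by have := P.le_cap; omega))
        (by have := P.three_le_N; omega) P.pow_le_W
    | succ t ih =>
      rw [add_mul, one_mul, ← add_assoc]
      exact ih.comp_pure (impl_pass hid hI hκN hF t)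
  -- With `D + 1` digits the whole key is compared, and injectivity of `κ` on the items makes the
  -- tie-break irrelevant.
  have hlast : passMem idn lay κ F (P.D + 1) = sortedMem idn lay κ F := by
    have hr : ∀ γ, ∀ a ∈ (lay γ).A, passPos idn lay κ (P.D + 1) γ a = rk lay κ γ a := by
      intro γ a ha
      rw [passPos, rk, rankOf, rankOf]
      congr 1
      refine Finset.filter_congr fun b hb => ?_
      rw [passKey, passKey, Prod.Lex.toLex_lt_toLex, Nat.mod_eq_of_lt (hκD γ a ha),
        Nat.mod_eq_of_lt (hκD γ b hb)]
      constructor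
      · rintro (h | ⟨h1, h2⟩)
        · exact h
        · rw [hκi γ hb ha h1] at h2
          exact absurd h2 (lt_irrefl _)
      · exact Or.inl
    funext γ j
    ext w
    rw [passMem, sortedMem, mem_placed, mem_placed]
    refine exists_congr fun a => and_congr_right fun ha => ?_
    rw [hr γ a ha]
  rw [← hlast]
  exact hall _

end Sorting

/-! ## Sums over groups of items -/

theorem MaxSum.sum_g_le {ι : Type*} (Y : Finset ι) (grp val : ι → ℕ) (g : ℕ)
    (h : ∀ b ∈ Y, grp b ≤ g) : (∑ b ∈ Y, (⟨grp b, val b⟩ : MaxSum)).g ≤ g := by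
  classical
  induction Y using Finset.induction_on with
  | empty => simp
  | insert a Y ha ih =>
    rw [Finset.sum_insert ha]
    have h1 := ih fun b hb => h b (Finset.mem_insert_of_mem hb)
    have h2 := h a (Finset.mem_insert_self _ _)
    rw [MaxSum.add_def]
    split_ifs <;> (try dsimp only) <;> omega

theorem MaxSum.sum_s_le {ι : Type*} (Y : Finset ι) (grp val : ι → ℕ) :
    (∑ b ∈ Y, (⟨grp b, val b⟩ : MaxSum)).s ≤ ∑ b ∈ Y, val b := by
  classical
  induction Y using Finset.induction_on with
  | empty => simp
  | insert a Y ha ih =>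
    rw [Finset.sum_insert ha, Finset.sum_insert ha, MaxSum.add_def]
    split_ifs <;> (try dsimp only) <;> omega

/-- Reading off the sum over a group that is at least as large as all groups that occur. -/
theorem MaxSum.read_sum {ι : Type*} (Y : Finset ι) (grp val : ι → ℕ) (g : ℕ)
    (h : ∀ b ∈ Y, grp b ≤ g) :
    (if (∑ b ∈ Y, (⟨grp b, val b⟩ : MaxSum)).g = g then (∑ b ∈ Y, (⟨grp b, val b⟩ : MaxSum)).s
      else 0) = ∑ b ∈ Y.filter (fun b => grp b = g), val b := by
  classical
  induction Y using Finset.induction_on with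
  | empty =>
    rw [Finset.filter_empty, Finset.sum_empty]
    split_ifs <;> rfl
  | insert a Y ha ih =>
    have h0 : ∀ b ∈ Y, grp b ≤ g := fun b hb => h b (Finset.mem_insert_of_mem hb)
    have h1 := ih h0
    have h2 := h a (Finset.mem_insert_self _ _)
    have h3 := MaxSum.sum_g_le Y grp val g h0
    rw [Finset.sum_insert ha, Finset.filter_insert, MaxSum.add_def]
    by_cases hg : grp a = g
    · rw [if_pos hg, Finset.sum_insert (by simp [ha]), ← h1]
      simp only
      split_ifs <;> simp_all <;> omega
    · rw [if_neg hg, ← h1]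
      simp only
      split_ifs <;> simp_all <;> omega

section Scan

variable {P : Params} {Γ ι : Type} {idn : ι → ℕ} {lay : Γ → Layout P ι}

/-- The fields are short lists of small numbers. -/
def FieldsSmall (lay : Γ → Layout P ι) (k : ℕ) (F : Γ → ι → List ℕ) : Prop :=
  ∀ γ, ∀ a ∈ (lay γ).A, Small k P.N (F γ a)

theorem two_le_N (P : Params) : 2 ≤ P.N := by
  have := P.three_le_N
  omega

/-- New fields are computed from the present ones. -/
theorem impl_local (hid : Function.Injective idn) (hI : ∀ a, idn a < P.I) {F F' : Γ → ι → List ℕ}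
    (hl : FieldLocal lay F F') (hF' : FieldsSmall lay 24 F') :
    Impl P.cap P.W 1 (factsView P.p (homeMem idn lay F)) (factsView P.p (homeMem idn lay F'))
      PMF.pure := by
  refine Deliver.impl (M := 32) (N := P.N) (Deliver.keep ?_ (fun γ i _ => ?_) ?_) (two_le_N P)
    P.pow_le_W
  · have key : ∀ γ γ' i, homeMem idn lay F γ i = homeMem idn lay F γ' i →
        homeMem idn lay F' γ i ⊆ homeMem idn lay F' γ' i := by
      intro γ γ' i h w hw
      obtain ⟨a, ha, hi, rfl⟩ := mem_placed.1 hw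
      obtain ⟨h1, h2, h3⟩ := homeMem_know hid h ha hi
      exact mem_placed.2 ⟨a, h1, h2, by rw [hl γ γ' a ha h1 h3.symm]⟩
    exact fun γ γ' i _ h => (key γ γ' i h).antisymm (key γ' γ i h.symm)
  · exact (card_homeMem_le F' γ i).trans (by have := P.le_cap; omega)
  · intro γ i _ w hw
    obtain ⟨a, ha, -, rfl⟩ := mem_placed.1 hw
    refine Small.mono (M := 25) ?_ (by norm_num)
    exact small_cons.2 ⟨(hI a).trans_le P.I_le_N, hF' γ a ha⟩

/-- The key by which items are sorted to be grouped. -/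
def grpKey (P : Params) (grp : Γ → ι → ℕ) (o : ι → ℕ) (γ : Γ) (a : ι) : ℕ := grp γ a * P.I + o a

theorem grpKey_lt {grp : Γ → ι → ℕ} {o : ι → ℕ} (ho : ∀ a, o a < P.I) {γ : Γ} {a : ι}
    (hg : grp γ a < P.G) : grpKey P grp o γ a < P.G * P.I := by
  have := ho a
  have : (grp γ a + 1) * P.I ≤ P.G * P.I := Nat.mul_le_mul_right _ hg
  unfold grpKey
  nlinarith

theorem grpKey_lt_iff {grp : Γ → ι → ℕ} {o : ι → ℕ} (ho : ∀ a, o a < P.I) {γ : Γ} {a b : ι} :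
    grpKey P grp o γ a < grpKey P grp o γ b ↔
      grp γ a < grp γ b ∨ (grp γ a = grp γ b ∧ o a < o b) := by
  have h1 := ho a
  have h2 := ho b
  unfold grpKey
  rcases lt_trichotomy (grp γ a) (grp γ b) with h | h | h
  · have : (grp γ a + 1) * P.I ≤ grp γ b * P.I := Nat.mul_le_mul_right _ h
    simp only [h, true_or, iff_true]
    nlinarith
  · simp [h]
  · have : (grp γ b + 1) * P.I ≤ grp γ a * P.I := Nat.mul_le_mul_right _ h
    simp only [not_lt.2 h.le, h.ne', false_or, false_and, iff_false]
    nlinarith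

theorem grpKey_injective {grp : Γ → ι → ℕ} {o : ι → ℕ} (ho : ∀ a, o a < P.I)
    (hoi : Function.Injective o) (γ : Γ) : Function.Injective (grpKey P grp o γ) := by
  intro a b h
  by_contra hab
  have hab' : o a ≠ o b := fun e => hab (hoi e)
  have h1 := mt (grpKey_lt_iff (grp := grp) ho (γ := γ) (a := a) (b := b)).2 (by omega)
  have h2 := mt (grpKey_lt_iff (grp := grp) ho (γ := γ) (a := b) (b := a)).2 (by omega)
  omega

theorem rk_div_lt {κ : Γ → ι → ℕ} {γ : Γ} {a : ι} (ha : a ∈ (lay γ).A) :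
    rk lay κ γ a / P.K < P.q := by
  rw [Nat.div_lt_iff_lt_mul P.K_pos]
  exact lt_of_lt_of_le (rankOf_lt_card ha) (lay γ).card_le

theorem rk_lt {κ : Γ → ι → ℕ} {γ : Γ} {a : ι} (ha : a ∈ (lay γ).A) : rk lay κ γ a < P.N :=
  (rankOf_lt_card ha).trans (lay γ).card_lt

theorem small_sortedMem (hI : ∀ a, idn a < P.I) {κ : Γ → ι → ℕ} {F : Γ → ι → List ℕ}
    (hκN : ∀ γ, ∀ a ∈ (lay γ).A, κ γ a < P.N) (hF : FieldsSmall lay 24 F) (γ : Γ) (a : ι)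
    (ha : a ∈ (lay γ).A) :
    Small 31 P.N (idn a :: rk lay κ γ a :: κ γ a :: (lay γ).home a :: F γ a) := by
  refine Small.mono (M := 28) ?_ (by norm_num)
  simp only [small_cons]
  exact ⟨lt_of_lt_of_le (hI a) P.I_le_N, rk_lt ha, hκN γ a ha,
    lt_of_lt_of_le ((lay γ).home_lt a ha) P.q_le_N, hF γ a ha⟩

theorem sortedMem_know (hid : Function.Injective idn) {κ : Γ → ι → ℕ} {F : Γ → ι → List ℕ}
    {γ γ' : Γ} {i : ℕ} {a : ι}
    (h : sortedMem idn lay κ F γ i = sortedMem idn lay κ F γ' i) (ha : a ∈ (lay γ).A)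
    (hi : rk lay κ γ a / P.K = i) :
    a ∈ (lay γ').A ∧ rk lay κ γ' a = rk lay κ γ a ∧
      (lay γ').home a = (lay γ).home a ∧ F γ' a = F γ a := by
  obtain ⟨h1, h2, h3⟩ := placed_know (fun γ γ' a b hab => hid (List.cons.inj hab).1) h ha hi
  simp only [List.cons.injEq, true_and] at h3
  exact ⟨h1, h3.1, h3.2.2.1, h3.2.2.2⟩

/-- The sum over the items of the same group that come before an item. -/
def groupPrefix (lay : Γ → Layout P ι) (grp val : Γ → ι → ℕ) (o : ι → ℕ) (γ : Γ) (a : ι) : ℕ :=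
  ∑ b ∈ (lay γ).A.filter (fun b => grp γ b = grp γ a ∧ o b < o a), val γ b

/-- The sum over the group of an item. -/
def groupTotal (lay : Γ → Layout P ι) (grp val : Γ → ι → ℕ) (γ : Γ) (a : ι) : ℕ :=
  ∑ b ∈ (lay γ).A.filter (fun b => grp γ b = grp γ a), val γ b

/-- The rounds needed for sorting. -/
def Params.sortRounds (P : Params) : ℕ := 1 + (P.D + 1) * (2 * P.L + 3)

/-- The rounds needed for the prefix sums in groups. -/
def Params.scanRounds (P : Params) : ℕ := P.sortRounds + (2 * P.L + 3)

theorem groupPrefix_le {grp val : Γ → ι → ℕ} {o : ι → ℕ} {γ : Γ} {a : ι} :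
    groupPrefix lay grp val o γ a ≤ ∑ b ∈ (lay γ).A, val γ b :=
  Finset.sum_le_sum_of_subset (Finset.filter_subset _ _)

theorem groupTotal_le {grp val : Γ → ι → ℕ} {γ : Γ} {a : ι} :
    groupTotal lay grp val γ a ≤ ∑ b ∈ (lay γ).A, val γ b :=
  Finset.sum_le_sum_of_subset (Finset.filter_subset _ _)

/-- After sorting, earlier machines hold only groups up to that of `a`, and all their items of this
very group precede `a`. Hence the `MaxSum` of the earlier machines either carries the group of `a`,
with the right sum, or has nothing to contribute. The rest is on the same machine. -/
theorem groupPrefix_eq {grp val : Γ → ι → ℕ} {o : ι → ℕ} (ho : ∀ a, o a < P.I) {γ : Γ} {a : ι} :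
    groupPrefix lay grp val o γ a =
      (if (∑ i ∈ Finset.range (rk lay (grpKey P grp o) γ a / P.K),
          ∑ b ∈ (lay γ).A.filter (fun b => rk lay (grpKey P grp o) γ b / P.K = i),
            (⟨grp γ b, val γ b⟩ : MaxSum)).g = grp γ a then
        (∑ i ∈ Finset.range (rk lay (grpKey P grp o) γ a / P.K),
          ∑ b ∈ (lay γ).A.filter (fun b => rk lay (grpKey P grp o) γ b / P.K = i),
            (⟨grp γ b, val γ b⟩ : MaxSum)).s else 0)
      + ∑ b ∈ (lay γ).A.filter (fun b => rk lay (grpKey P grp o) γ b / P.K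
          = rk lay (grpKey P grp o) γ a / P.K ∧ grp γ b = grp γ a ∧ o b < o a), val γ b := by
  classical
  have lt_of : ∀ b ∈ (lay γ).A, rk lay (grpKey P grp o) γ b / P.K
      < rk lay (grpKey P grp o) γ a / P.K →
      grp γ b < grp γ a ∨ (grp γ b = grp γ a ∧ o b < o a) := by
    intro b hb h
    have : rk lay (grpKey P grp o) γ b < rk lay (grpKey P grp o) γ a := by
      by_contra hc
      exact absurd (Nat.div_le_div_right (c := P.K) (not_lt.1 hc)) (not_le.2 h)
    rw [rk, rk, rankOf_lt_rankOf hb] at this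
    exact (grpKey_lt_iff ho).1 this
  rw [Finset.sum_fiberwise_eq_sum_filter, MaxSum.read_sum, groupPrefix, Finset.filter_filter,
    ← Finset.sum_union]
  · refine Finset.sum_congr ?_ fun _ _ => rfl
    ext b
    simp only [Finset.mem_filter, Finset.mem_union, Finset.mem_range, ← and_or_left]
    refine and_congr_right fun hb => ?_
    constructor
    · rintro ⟨h1, h2⟩
      have h3 : grpKey P grp o γ b < grpKey P grp o γ a := (grpKey_lt_iff ho).2 (Or.inr ⟨h1, h2⟩)
      have h4 : rk lay (grpKey P grp o) γ b < rk lay (grpKey P grp o) γ a :=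
        (rankOf_lt_rankOf hb).2 h3
      rcases lt_or_eq_of_le (Nat.div_le_div_right (c := P.K) h4.le) with h | h
      · exact Or.inl ⟨h, h1⟩
      · exact Or.inr ⟨h, h1, h2⟩
    · rintro (⟨h1, h2⟩ | ⟨-, h1, h2⟩)
      · rcases lt_of b hb h1 with h | h
        · exact absurd h2 h.ne
        · exact h
      · exact ⟨h1, h2⟩
  · rw [Finset.disjoint_left]
    intro b hb hb'
    simp only [Finset.mem_filter, Finset.mem_range] at hb hb'
    omega
  · intro b hb
    rw [Finset.mem_filter, Finset.mem_range] at hb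
    rcases lt_of b hb.1 hb.2 with h | h <;> omega

/-- In a constant number of rounds, every item learns the sum over the preceding items of its
group. -/
theorem impl_scan (hid : Function.Injective idn) (hI : ∀ a, idn a < P.I) {o : ι → ℕ}
    (ho : ∀ a, o a < P.I) (hoi : Function.Injective o) {F : Γ → ι → List ℕ} {k : ℕ} (hk : k ≤ 23)
    (hF : FieldsSmall lay k F) {grp val : Γ → ι → ℕ} (hgl : FieldLocal lay F grp)
    (hvl : FieldLocal lay F val) (hg : ∀ γ, ∀ a ∈ (lay γ).A, grp γ a < P.G)
    (hv : ∀ γ, ∑ a ∈ (lay γ).A, val γ a < P.N) :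
    Impl P.cap P.W P.scanRounds (factsView P.p (homeMem idn lay F))
      (factsView P.p (homeMem idn lay fun γ a => F γ a ++ [groupPrefix lay grp val o γ a]))
      PMF.pure := by
  classical
  have hF24 : FieldsSmall lay 24 F := fun γ a ha => (hF γ a ha).mono (by omega)
  have hκi := fun γ => (grpKey_injective (P := P) (grp := grp) ho hoi γ).injOn (s := (lay γ).A)
  have hκN : ∀ γ, ∀ a ∈ (lay γ).A, grpKey P grp o γ a < P.N := fun γ a ha =>
    (grpKey_lt ho (hg γ a ha)).trans_le P.G_mul_le_N
  have hsort := impl_sort hid hI (κ := grpKey P grp o) (F := F)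
    (fun γ γ' a ha ha' h => by rw [grpKey, grpKey, hgl γ γ' a ha ha' h]) hκi hκN
    (fun γ a ha => (grpKey_lt ho (hg γ a ha)).trans_le P.G_mul_le_pow) hF24
  have hsum : ∀ γ (T : Finset ℕ), ∑ i ∈ T,
      ∑ b ∈ (lay γ).A.filter (fun b => rk lay (grpKey P grp o) γ b / P.K = i),
        (⟨grp γ b, val γ b⟩ : MaxSum) = ∑ b ∈ (lay γ).A.filter
          (fun b => rk lay (grpKey P grp o) γ b / P.K ∈ T), ⟨grp γ b, val γ b⟩ :=
    fun γ T => Finset.sum_fiberwise_eq_sum_filter _ _ _ _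
  obtain ⟨m', himpl, hm'⟩ := exists_impl_prefix_sums (p := P.p) (q := P.q) (B := P.B) (L := P.L)
    (w := 1) (M := 31) (N := P.N) (K := P.K) (cap := P.cap) (W := P.W)
    (m := sortedMem idn lay (grpKey P grp o) F)
    (x := fun γ i _ => ∑ b ∈ (lay γ).A.filter
      (fun b => rk lay (grpKey P grp o) γ b / P.K = i), ⟨grp γ b, val γ b⟩)
    P.q_le_p P.q_le_pow P.B_pos (by norm_num) P.three_le_N P.q_le_N
    (by have := P.three_le_N; omega) P.L_le_N P.pow_le_W
    (by
      have := P.le_cap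
      have h2 : (P.L + 1) * (P.B * 1) ≤ (P.L + 1) * (P.B * P.B) :=
        Nat.mul_le_mul_left _ (Nat.mul_le_mul_left _ P.B_pos)
      omega)
    (fun γ j => card_placed_le.trans
      (card_filter_div_eq_le (rankOf_injOn (hκi γ)) P.K_pos j))
    (fun γ j v hv => by
      obtain ⟨a, ha, -, rfl⟩ := mem_placed.1 hv
      exact small_sortedMem hI hκN hF24 γ a ha)
    (fun γ γ' i d h _ _ => by
      have hset : (lay γ).A.filter (fun b => rk lay (grpKey P grp o) γ b / P.K = i)
          = (lay γ').A.filter (fun b => rk lay (grpKey P grp o) γ' b / P.K = i) := by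
        ext b
        simp only [Finset.mem_filter]
        constructor
        · rintro ⟨hb, hi⟩
          obtain ⟨h1, h2, -⟩ := sortedMem_know hid h hb hi
          exact ⟨h1, h2 ▸ hi⟩
        · rintro ⟨hb, hi⟩
          obtain ⟨h1, h2, -⟩ := sortedMem_know hid h.symm hb hi
          exact ⟨h1, h2 ▸ hi⟩
      rw [← hset]
      refine Finset.sum_congr rfl fun b hb => ?_
      rw [Finset.mem_filter] at hb
      obtain ⟨h1, -, -, h4⟩ := sortedMem_know hid h hb.1 hb.2
      rw [hgl γ γ' b hb.1 h1 h4.symm, hvl γ γ' b hb.1 h1 h4.symm])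
    (fun γ d T _ _ => by
      rw [hsum]
      constructor
      · have h1 := MaxSum.sum_g_le ((lay γ).A.filter
          (fun b => rk lay (grpKey P grp o) γ b / P.K ∈ T)) (grp γ) (val γ) (P.G - 1)
          fun b hb => by
            have := hg γ b (Finset.mem_filter.1 hb).1
            omega
        have := P.G_pos
        have := P.G_le_N
        omega
      · refine lt_of_le_of_lt (MaxSum.sum_s_le _ _ _) (lt_of_le_of_lt ?_ (hv γ))
        exact Finset.sum_le_sum_of_subset (Finset.filter_subset _ _))
  -- The sorted items carry the number of their home, so they can be sent back together with the
  -- result.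
  have hroute : Deliver P.p 32 P.N P.K m'
      (homeMem idn lay fun γ a => F γ a ++ [groupPrefix lay grp val o γ a]) := by
    refine Deliver.route _ (fun γ a => rk lay (grpKey P grp o) γ a / P.K) _ _ ?_ ?_ ?_ ?_ ?_
    · intro γ γ' i a h ha hi
      obtain ⟨h1, h2⟩ := hm' γ γ' i h
      obtain ⟨k1, k2, k3, k4⟩ := sortedMem_know hid h1 ha hi
      have hiq : i < P.q := hi ▸ rk_div_lt ha
      have hgr := hgl γ γ' a ha k1 k4.symm
      refine ⟨k1, by rw [k2]; exact hi, k3, ?_⟩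
      have h5 := (h2 hiq 0 one_pos).1
      have : groupPrefix lay grp val o γ' a = groupPrefix lay grp val o γ a := by
        rw [groupPrefix_eq ho, groupPrefix_eq ho (γ := γ), k2, hi, ← h5, hgr]
        congr 1
        have hset : (lay γ').A.filter (fun b => rk lay (grpKey P grp o) γ' b / P.K = i ∧
              grp γ' b = grp γ' a ∧ o b < o a)
            = (lay γ).A.filter (fun b => rk lay (grpKey P grp o) γ b / P.K = i ∧
              grp γ b = grp γ' a ∧ o b < o a) := by
          ext b
          simp only [Finset.mem_filter]
          constructor
          · rintro ⟨hb, hbi, hba⟩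
            obtain ⟨l1, l2, -, l4⟩ := sortedMem_know hid h1.symm hb hbi
            exact ⟨l1, l2 ▸ hbi, by rw [hgl γ γ' b l1 hb l4]; exact hba.1, hba.2⟩
          · rintro ⟨hb, hbi, hba⟩
            obtain ⟨l1, l2, -, l4⟩ := sortedMem_know hid h1 hb hbi
            exact ⟨l1, l2 ▸ hbi, by rw [hgl γ' γ b l1 hb l4]; exact hba.1, hba.2⟩
        rw [hset]
        refine Finset.sum_congr rfl fun b hb => ?_
        rw [Finset.mem_filter] at hb
        obtain ⟨l1, -, -, l4⟩ := sortedMem_know hid h1 hb.1 hb.2.1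
        exact hvl γ' γ b l1 hb.1 l4
      simp only [this, k4]
    · exact fun γ a ha => (rk_div_lt ha).trans_le P.q_le_p
    · exact fun γ i => card_filter_div_eq_le (rankOf_injOn (hκi γ)) P.K_pos i
    · exact fun γ i => (lay γ).load i
    · intro γ a ha
      refine Small.mono (M := 24 + 1) ?_ (by norm_num)
      refine small_cons.2 ⟨(hI a).trans_le P.I_le_N, Small.mono (small_append (hF γ a ha) ?_)
        (show k + 1 ≤ 24 by omega)⟩
      exact small_cons.2 ⟨groupPrefix_le.trans_lt (hv γ), by simp [Small]⟩
  refine (hsort.comp_pure (himpl.comp_pure (Deliver.impl (hroute.mono ?_) (two_le_N P)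
    P.pow_le_W)))
  have := P.le_cap
  omega

end Scan

/-! ### Group totals, independent random draws, and gathering groups on machines. -/

section Ops

variable {P : Params} {Γ ι : Type} {idn : ι → ℕ} {lay : Γ → Layout P ι}

/-- The rounds needed for the sums over groups. -/
def Params.totalRounds (P : Params) : ℕ := P.scanRounds + (P.scanRounds + 1)

/-- In a constant number of rounds, every item learns the sum over its group. -/
theorem impl_total (hid : Function.Injective idn) (hI : ∀ a, idn a < P.I) {F : Γ → ι → List ℕ}
    {k : ℕ} (hk : k ≤ 22) (hF : FieldsSmall lay k F) {grp val : Γ → ι → ℕ}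
    (hgl : FieldLocal lay F grp) (hvl : FieldLocal lay F val)
    (hg : ∀ γ, ∀ a ∈ (lay γ).A, grp γ a < P.G) (hv : ∀ γ, ∑ a ∈ (lay γ).A, val γ a < P.N) :
    Impl P.cap P.W P.totalRounds (factsView P.p (homeMem idn lay F))
      (factsView P.p (homeMem idn lay fun γ a => F γ a ++ [groupTotal lay grp val γ a]))
      PMF.pure := by
  classical
  -- The reversed order of names. A second scan in this order supplies the later items of the group;
  -- the total is the two prefixes and the own value.
  let o : ι → ℕ := fun a => P.I - 1 - idn a
  have ho : ∀ a, o a < P.I := fun a => by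
    have := hI a
    simp only [o]
    omega
  have hlt : ∀ a b, o b < o a ↔ idn a < idn b := fun a b => by
    have := hI a
    have := hI b
    simp only [o]
    omega
  have hoi : Function.Injective o := fun a b h => hid (by
    have := hI a
    have := hI b
    simp only [o] at h
    omega)
  let F₁ : Γ → ι → List ℕ := fun γ a => F γ a ++ [groupPrefix lay grp val idn γ a]
  have hF₁ : FieldsSmall lay (k + 1) F₁ := fun γ a ha => small_append (hF γ a ha)
    (small_cons.2 ⟨groupPrefix_le.trans_lt (hv γ), by simp [Small]⟩)
  have ext₁ : ∀ {β : Type} (f : Γ → ι → β), FieldLocal lay F f → FieldLocal lay F₁ f :=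
    fun f hf γ γ' a ha ha' h => hf γ γ' a ha ha' (List.append_inj h (by
      have := congrArg List.length h
      simpa [F₁] using this)).1
  have h1 := impl_scan hid hI hI hid (by omega) hF hgl hvl hg hv
  have h2 := impl_scan hid hI ho hoi (by omega) hF₁ (ext₁ _ hgl) (ext₁ _ hvl) hg hv
  have hsum : ∀ γ, ∀ a ∈ (lay γ).A, groupTotal lay grp val γ a
      = groupPrefix lay grp val idn γ a + val γ a + groupPrefix lay grp val o γ a := by
    intro γ a ha
    rw [groupTotal, groupPrefix, groupPrefix, ← Finset.sum_singleton (val γ) a,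
      ← Finset.sum_union, ← Finset.sum_union]
    · refine Finset.sum_congr ?_ fun _ _ => rfl
      ext b
      simp only [Finset.mem_filter, Finset.mem_union, Finset.mem_singleton, hlt]
      constructor
      · rintro ⟨h1, h2⟩
        rcases lt_trichotomy (idn b) (idn a) with h | h | h
        · exact Or.inl (Or.inl ⟨h1, h2, h⟩)
        · exact Or.inl (Or.inr (hid h))
        · exact Or.inr ⟨h1, h2, h⟩
      · rintro ((⟨h1, h2, -⟩ | rfl) | ⟨h1, h2, -⟩)
        · exact ⟨h1, h2⟩
        · exact ⟨ha, rfl⟩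
        · exact ⟨h1, h2⟩
    · rw [Finset.disjoint_left]
      intro b hb hb'
      simp only [Finset.mem_filter, Finset.mem_union, Finset.mem_singleton, hlt] at hb hb'
      rcases hb with h | rfl
      · omega
      · omega
    · rw [Finset.disjoint_left]
      intro b hb hb'
      simp only [Finset.mem_filter, Finset.mem_singleton] at hb hb'
      subst hb'
      omega
  refine h1.comp_pure (h2.comp_pure (impl_local hid hI ?_ ?_))
  · intro γ γ' a ha ha' h
    have hlen : (F₁ γ a).length = (F₁ γ' a).length := by
      have := congrArg List.length h
      simpa using this
    have h3 := List.append_inj h hlen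
    have h4 := List.append_inj h3.1 (by simpa [F₁] using hlen)
    simp only
    rw [hsum γ a ha, hsum γ' a ha', h4.1, (List.cons.inj h3.2).1, (List.cons.inj h4.2).1,
      hvl γ γ' a ha ha' h4.1]
  · intro γ a ha
    exact Small.mono (small_append (hF γ a ha)
      (small_cons.2 ⟨groupTotal_le.trans_lt (hv γ), by simp [Small]⟩ : Small (0 + 1) P.N _))
      (by omega)

theorem pmf_eq_of_subsingleton {α : Type*} [Subsingleton α] (x y : PMF α) : x = y := by
  obtain ⟨a, -⟩ := x.support_nonempty
  have h : ∀ z : PMF α, z = PMF.pure a := fun z => by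
    have := map_eq_pure_of_support (p := z) (f := id) (b := a) fun _ _ => Subsingleton.elim _ _
    rwa [PMF.map_id] at this
  rw [h x, h y]

/-- A round without communication, in which the machines make independent random draws. The draw `s`
is made by the machine that holds the items with slot `s`. -/
theorem impl_random {O : Type} {ns : ℕ} (D : Γ → Fin ns → PMF O) (o₀ : O)
    (slot : Γ → ι → Option (Fin ns)) {loc : Γ → ι → ℕ} {code : Γ → ι → Fact}
    {code' : Γ × (Fin ns → O) → ι → Fact}
    (hcode : ∀ γ γ' i, placed (fun γ => (lay γ).A) loc code γ i
        = placed (fun γ => (lay γ).A) loc code γ' i → ∀ a ∈ (lay γ).A, loc γ a = i →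
      a ∈ (lay γ').A ∧ loc γ' a = i ∧ slot γ' a = slot γ a ∧
      (∀ s, slot γ a = some s → D γ' s = D γ s) ∧
      ∀ o o', (∀ s, slot γ a = some s → o s = o' s) → code' (γ, o) a = code' (γ', o') a)
    (hcol : ∀ γ s, ∀ a ∈ (lay γ).A, ∀ b ∈ (lay γ).A, slot γ a = some s → slot γ b = some s →
      loc γ a = loc γ b)
    (hnone : ∀ γ s, (∀ a ∈ (lay γ).A, slot γ a ≠ some s) → D γ s = PMF.pure o₀)
    (hlt : ∀ γ, ∀ a ∈ (lay γ).A, loc γ a < P.q)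
    (hcard : ∀ γ j, ((lay γ).A.filter fun a => loc γ a = j).card ≤ P.cap)
    (hsmall : ∀ γ o, ∀ a ∈ (lay γ).A, Small 32 P.N (code' (γ, o) a)) :
    Impl P.cap P.W 1 (factsView P.p (placed (fun γ => (lay γ).A) loc code))
      (factsView P.p (placed (fun γ : Γ × (Fin ns → O) => (lay γ.1).A) (fun γ => loc γ.1) code'))
      fun γ => (indep ns (D γ)).map fun o => (γ, o) := by
  classical
  -- Every machine fills a whole row of slots, but only the slots of items that it holds receive a
  -- genuine draw; the others receive `o₀`.
  let f : Γ → ℕ → Fin ns → PMF O := fun γ i s =>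
    if ∃ a ∈ (lay γ).A, loc γ a = i ∧ slot γ a = some s then D γ s else PMF.pure o₀
  let out : Γ → ℕ → (Fin ns → O) → Finset Fact := fun γ i o =>
    placed (fun γ : Γ × (Fin ns → O) => (lay γ.1).A) (fun γ => loc γ.1) code' (γ, o) i
  have hout : ∀ γ i o, (out γ i o).card ≤ P.cap := fun γ i o => card_placed_le.trans (hcard γ i)
  refine Impl.of_facts (fun γ i => (indep ns (f γ i)).map fun o (j : Fin P.p) =>
    if i = j then out γ i o else ∅) ?_ ?_ ?_
  · intro γ γ' i h
    have hf : f γ i = f γ' i := by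
      funext s
      simp only [f]
      by_cases hex : ∃ a ∈ (lay γ).A, loc γ a = i ∧ slot γ a = some s
      · obtain ⟨a, ha, hi, hs⟩ := hex
        obtain ⟨h1, h2, h3, h4, -⟩ := hcode γ γ' i h a ha hi
        rw [if_pos ⟨a, ha, hi, hs⟩, if_pos ⟨a, h1, h2, h3.trans hs⟩, h4 s hs]
      · rw [if_neg hex, if_neg]
        rintro ⟨a, ha, hi, hs⟩
        obtain ⟨h1, h2, h3, h4, -⟩ := hcode γ' γ i h.symm a ha hi
        exact hex ⟨a, h1, h2, h3.trans hs⟩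
    have ho : out γ i = out γ' i := by
      have key : ∀ γ γ', placed (fun γ => (lay γ).A) loc code γ i
          = placed (fun γ => (lay γ).A) loc code γ' i → ∀ o, out γ i o ⊆ out γ' i o := by
        intro γ γ' h o w hw
        obtain ⟨a, ha, hi, rfl⟩ := mem_placed.1 hw
        obtain ⟨h1, h2, -, -, h5⟩ := hcode γ γ' i h a ha hi
        exact mem_placed.2 ⟨a, h1, h2, (h5 o o fun _ _ => rfl).symm⟩
      funext o
      exact (key γ γ' h o).antisymm (key γ' γ h.symm o)
    rw [hf, ho]
  · intro γ s hs
    simp only [PMF.mem_support_map_iff] at hs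
    choose o ho hos using hs
    obtain rfl : (fun i (j : Fin P.p) => if i = j then out γ i (o i) else ∅) = s := funext hos
    refine ⟨fun i => ?_, fun j => ?_, fun i j w hw => ?_⟩
    · rw [Finset.sum_eq_single i]
      · simpa using hout γ i (o i)
      · intro j _ hj
        simp [hj.symm]
      · simp
    · rw [Finset.sum_eq_single j]
      · simpa using hout γ j (o j)
      · intro i _ hi
        simp [hi]
      · simp
    · simp only at hw
      split_ifs at hw
      · obtain ⟨a, ha, -, rfl⟩ := mem_placed.1 hw
        exact (enc_lt (two_le_N P) (hsmall γ _ a ha)).trans_le P.pow_le_W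
      · simp at hw
  · intro γ
    -- Slots without items will be assigned to machine `0`, which has to exist.
    rcases Nat.eq_zero_or_pos P.p with hp | hp
    · have : Subsingleton (Fin P.p → Finset Fact) := by
        rw [hp]
        infer_instance
      exact pmf_eq_of_subsingleton _ _
    -- By `hcol` the items with slot `s` are all on one machine. A slot without items is a point
    -- mass by `hnone`, so it does not matter which machine is named for it.
    · let h : Fin ns → Fin P.p := fun s =>
        if hs : ∃ a ∈ (lay γ).A, slot γ a = some s then
          ⟨loc γ hs.choose, (hlt γ _ hs.choose_spec.1).trans_le P.q_le_p⟩ else ⟨0, hp⟩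
      have hh : ∀ a ∈ (lay γ).A, ∀ s, slot γ a = some s → (h s : ℕ) = loc γ a := by
        intro a ha s hs
        have hex : ∃ a ∈ (lay γ).A, slot γ a = some s := ⟨a, ha, hs⟩
        simp only [h, dif_pos hex]
        exact hcol γ s _ hex.choose_spec.1 a ha hex.choose_spec.2 hs
      have hD : ∀ s, f γ (h s) s = D γ s := by
        intro s
        by_cases hex : ∃ a ∈ (lay γ).A, slot γ a = some s
        · obtain ⟨a, ha, hs⟩ := hex
          simp only [f]
          rw [if_pos ⟨a, ha, (hh a ha s hs).symm, hs⟩]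
        · rw [hnone γ s fun a ha hs => hex ⟨a, ha, hs⟩]
          simp only [f]
          rw [if_neg]
          rintro ⟨a, ha, -, hs⟩
          exact hex ⟨a, ha, hs⟩
      -- Reading slot `s` in the row of its machine turns the table of all draws into independent
      -- draws from `D γ`.
      have e1 := indep_reindex (fun (i : Fin P.p) s => f γ i s) h
      simp only [hD] at e1
      rw [← e1, PMF.map_comp, PMF.map_comp,
        indep_map P.p (fun i : Fin P.p => indep ns (f γ i)) fun i o (j : Fin P.p) =>
          if i = j then out γ i o else ∅, PMF.map_comp]
      congr 1
      funext O j
      simp only [Function.comp_apply]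
      have e2 : (Finset.univ.biUnion fun i : Fin P.p =>
          (if i = j then out γ i (O i) else ∅)) = out γ j (O j) := by
        ext w
        simp only [Finset.mem_biUnion, Finset.mem_univ, true_and]
        constructor
        · rintro ⟨i, hi⟩
          split_ifs at hi with hij
          · exact hij ▸ hi
          · simp at hi
        · exact fun hw => ⟨j, by simpa using hw⟩
      rw [e2]
      ext w
      simp only [out, mem_placed]
      refine exists_congr fun a => and_congr_right fun ha => and_congr_right fun hj => ?_
      rw [(hcode γ γ j rfl a ha hj).2.2.2.2 (O j) (fun s => O (h s) s) fun s hs => ?_]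
      have := hh a ha s hs
      rw [hj] at this
      rw [Fin.ext this]

/-- A draw made by the home machine of an item. -/
theorem impl_draw (hid : Function.Injective idn) (hI : ∀ a, idn a < P.I) {O : Type} {ns : ℕ}
    (D : Γ → Fin ns → PMF O) (o₀ : O) (slot : Γ → ι → Option (Fin ns)) {F : Γ → ι → List ℕ}
    {F' : Γ × (Fin ns → O) → ι → List ℕ} (hslot : FieldLocal lay F slot)
    (huniq : ∀ γ s, ∀ a ∈ (lay γ).A, ∀ b ∈ (lay γ).A, slot γ a = some s → slot γ b = some s →
      a = b)
    (hD : ∀ γ γ' a s, a ∈ (lay γ).A → a ∈ (lay γ').A → F γ a = F γ' a → slot γ a = some s →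
      D γ s = D γ' s)
    (hnone : ∀ γ s, (∀ a ∈ (lay γ).A, slot γ a ≠ some s) → D γ s = PMF.pure o₀)
    (hF'l : ∀ γ γ' a o o', a ∈ (lay γ).A → a ∈ (lay γ').A → F γ a = F γ' a →
      (∀ s, slot γ a = some s → o s = o' s) → F' (γ, o) a = F' (γ', o') a)
    (hF' : FieldsSmall (fun γ : Γ × (Fin ns → O) => lay γ.1) 24 F') :
    Impl P.cap P.W 1 (factsView P.p (homeMem idn lay F))
      (factsView P.p (homeMem idn (fun γ : Γ × (Fin ns → O) => lay γ.1) F'))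
      fun γ => (indep ns (D γ)).map fun o => (γ, o) := by
  refine impl_random D o₀ slot ?_ ?_ hnone (fun γ => (lay γ).home_lt)
    (fun γ j => ((lay γ).load j).trans (by have := P.le_cap; omega)) ?_
  · intro γ γ' i h a ha hi
    obtain ⟨h1, h2, h3⟩ := homeMem_know hid h ha hi
    exact ⟨h1, h2, (hslot γ γ' a ha h1 h3.symm).symm,
      fun s hs => (hD γ γ' a s ha h1 h3.symm hs).symm,
      fun o o' hoo => by rw [hF'l γ γ' a o o' ha h1 h3.symm hoo]⟩
  · intro γ s a ha b hb h1 h2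
    rw [huniq γ s a ha b hb h1 h2]
  · intro γ o a ha
    exact Small.mono (M := 25) (small_cons.2 ⟨(hI a).trans_le P.I_le_N, hF' (γ, o) a ha⟩)
      (by norm_num)

/-- The number of items in smaller groups. -/
def groupStart (lay : Γ → Layout P ι) (grp : Γ → ι → ℕ) (γ : Γ) (g : ℕ) : ℕ :=
  ((lay γ).A.filter fun b => grp γ b < g).card

/-- The number of items of its group that come before an item. -/
def groupIndex (idn : ι → ℕ) (lay : Γ → Layout P ι) (grp : Γ → ι → ℕ) (γ : Γ) (a : ι) : ℕ :=
  ((lay γ).A.filter fun b => grp γ b = grp γ a ∧ idn b < idn a).card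

/-- An item that knows its index in its group can therefore recover from its rank where the group
starts, and so the place where the group meets. -/
theorem rk_grpKey (hI : ∀ a, idn a < P.I) (grp : Γ → ι → ℕ) (γ : Γ) (a : ι) :
    rk lay (grpKey P grp idn) γ a
      = groupStart lay grp γ (grp γ a) + groupIndex idn lay grp γ a := by
  classical
  rw [rk, rankOf, groupStart, groupIndex, ← Finset.card_union_of_disjoint]
  · congr 1
    ext b
    simp only [Finset.mem_filter, Finset.mem_union, ← and_or_left]
    exact and_congr_right fun _ => grpKey_lt_iff hI
  · rw [Finset.disjoint_left]
    intro b hb hb'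
    simp only [Finset.mem_filter] at hb hb'
    omega

/-- The machine on which an item is gathered; group `0` is not gathered. -/
def gatherLoc (idn : ι → ℕ) (lay : Γ → Layout P ι) (grp : Γ → ι → ℕ) (γ : Γ) (a : ι) : ℕ :=
  if grp γ a = 0 then rk lay (grpKey P grp idn) γ a / P.K
  else groupStart lay grp γ (grp γ a) / P.K

theorem gatherLoc_lt (hI : ∀ a, idn a < P.I) {grp : Γ → ι → ℕ} {γ : Γ} {a : ι}
    (ha : a ∈ (lay γ).A) : gatherLoc idn lay grp γ a < P.q := by
  unfold gatherLoc
  split_ifs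
  · exact rk_div_lt ha
  · refine lt_of_le_of_lt (Nat.div_le_div_right ?_) (rk_div_lt (κ := grpKey P grp idn) ha)
    rw [rk_grpKey hI]
    exact Nat.le_add_right _ _

/-- Besides the at most `K` items whose rank is in block `j`, a machine `j` receives only items of a
group that starts in block `j` and reaches beyond it. There is at most one such group: if another
group starts later in the same block, then the earlier group ends within the block. -/
theorem card_gatherLoc_le (hid : Function.Injective idn) (hI : ∀ a, idn a < P.I)
    {grp : Γ → ι → ℕ}
    (hsize : ∀ γ g, g ≠ 0 → ((lay γ).A.filter fun a => grp γ a = g).card ≤ P.Kg) (γ : Γ) (j : ℕ) :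
    ((lay γ).A.filter fun a => gatherLoc idn lay grp γ a = j).card ≤ P.K + P.Kg := by
  classical
  let r := rk lay (grpKey P grp idn) γ
  have h1 : ((lay γ).A.filter fun a => r a / P.K = j).card ≤ P.K :=
    card_filter_div_eq_le (rankOf_injOn ((grpKey_injective hI hid γ).injOn)) P.K_pos j
  have h2 : ((lay γ).A.filter fun a => gatherLoc idn lay grp γ a = j ∧ r a / P.K ≠ j).card
      ≤ P.Kg := by
    rcases Finset.eq_empty_or_nonempty
      ((lay γ).A.filter fun a => gatherLoc idn lay grp γ a = j ∧ r a / P.K ≠ j) with he | ⟨a, ha⟩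
    · simp [he]
    · have facts : ∀ b ∈ (lay γ).A.filter fun a =>
          gatherLoc idn lay grp γ a = j ∧ r a / P.K ≠ j,
          grp γ b ≠ 0 ∧ groupStart lay grp γ (grp γ b) / P.K = j ∧ j < r b / P.K := by
        intro b hb
        rw [Finset.mem_filter] at hb
        obtain ⟨-, hb1, hb2⟩ := hb
        unfold gatherLoc at hb1
        split_ifs at hb1 with h0
        · exact absurd hb1 hb2
        · refine ⟨h0, hb1, lt_of_le_of_ne ?_ hb2.symm⟩
          rw [← hb1]
          refine Nat.div_le_div_right ?_
          simp only [r]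
          rw [rk_grpKey hI]
          exact Nat.le_add_right _ _
      have hle : ∀ b ∈ (lay γ).A.filter fun a =>
          gatherLoc idn lay grp γ a = j ∧ r a / P.K ≠ j, ∀ c ∈ (lay γ).A.filter fun a =>
          gatherLoc idn lay grp γ a = j ∧ r a / P.K ≠ j, grp γ b ≤ grp γ c := by
        intro b hb c hc
        by_contra hlt
        rw [not_le] at hlt
        obtain ⟨-, k1, -⟩ := facts b hb
        obtain ⟨-, -, k2⟩ := facts c hc
        have : r c ≤ groupStart lay grp γ (grp γ b) := by
          refine Finset.card_le_card fun d hd => ?_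
          rw [Finset.mem_filter] at hd ⊢
          refine ⟨hd.1, ?_⟩
          rcases (grpKey_lt_iff hI).1 hd.2 with h | h <;> omega
        have := Nat.div_le_div_right (c := P.K) this
        omega
      refine le_trans (Finset.card_le_card fun b hb => ?_) (hsize γ (grp γ a) (facts a ha).1)
      rw [Finset.mem_filter]
      exact ⟨(Finset.mem_filter.1 hb).1, (hle b hb a ha).antisymm (hle a ha b hb)⟩
  refine le_trans ?_ (add_le_add h1 h2)
  refine le_trans (Finset.card_le_card fun a ha => ?_) (Finset.card_union_le _ _)
  rw [Finset.mem_filter] at ha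
  rw [Finset.mem_union, Finset.mem_filter, Finset.mem_filter]
  by_cases h : r a / P.K = j
  · exact Or.inl ⟨ha.1, h⟩
  · exact Or.inr ⟨ha.1, ha.2, h⟩

/-- The rounds needed to gather groups, to work on them, and to send the results home. -/
def Params.gatherRounds (P : Params) : ℕ := P.sortRounds + (1 + (1 + 1))

/-- Every group (other than group `0`) is gathered on a machine, which makes a random draw that may
depend on the whole group and returns a number to every item. -/
theorem impl_gather (hid : Function.Injective idn) (hI : ∀ a, idn a < P.I) {O : Type} {ns : ℕ}
    (D : Γ → Fin ns → PMF O) (o₀ : O) (slot : Γ → ι → Option (Fin ns)) {F : Γ → ι → List ℕ}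
    {k : ℕ} (hk : k ≤ 23) (hF : FieldsSmall lay k F) {grp : Γ → ι → ℕ}
    (reply : Γ × (Fin ns → O) → ι → ℕ) (hgl : FieldLocal lay F grp)
    (hg : ∀ γ, ∀ a ∈ (lay γ).A, grp γ a < P.G)
    (hidx : FieldLocal lay F fun γ a => if grp γ a = 0 then 0 else groupIndex idn lay grp γ a)
    (hsize : ∀ γ g, g ≠ 0 → ((lay γ).A.filter fun a => grp γ a = g).card ≤ P.Kg)
    (hslot : FieldLocal lay F slot)
    (hslotg : ∀ γ s, ∀ a ∈ (lay γ).A, slot γ a = some s → grp γ a ≠ 0 ∧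
      ∀ b ∈ (lay γ).A, slot γ b = some s → grp γ b = grp γ a)
    (hD : ∀ γ γ' s, (∃ a ∈ (lay γ).A, slot γ a = some s) →
      (∀ a, a ∈ (lay γ).A ∧ slot γ a = some s ↔ a ∈ (lay γ').A ∧ slot γ' a = some s) →
      (∀ a ∈ (lay γ).A, slot γ a = some s → F γ a = F γ' a) → D γ s = D γ' s)
    (hnone : ∀ γ s, (∀ a ∈ (lay γ).A, slot γ a ≠ some s) → D γ s = PMF.pure o₀)
    (hreply : ∀ γ γ' a o o', a ∈ (lay γ).A → a ∈ (lay γ').A → F γ a = F γ' a →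
      (∀ s, slot γ a = some s → o s = o' s) → reply (γ, o) a = reply (γ', o') a)
    (hreplyN : ∀ γ a, reply γ a < P.N) :
    Impl P.cap P.W P.gatherRounds (factsView P.p (homeMem idn lay F))
      (factsView P.p (homeMem idn (fun γ : Γ × (Fin ns → O) => lay γ.1)
        fun γ a => F γ.1 a ++ [reply γ a]))
      fun γ => (indep ns (D γ)).map fun o => (γ, o) := by
  classical
  have hF24 : FieldsSmall lay 24 F := fun γ a ha => (hF γ a ha).mono (by omega)
  have hκi := fun γ => (grpKey_injective (P := P) (grp := grp) hI hid γ).injOn (s := (lay γ).A)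
  have hκN : ∀ γ, ∀ a ∈ (lay γ).A, grpKey P grp idn γ a < P.N := fun γ a ha =>
    (grpKey_lt hI (hg γ a ha)).trans_le P.G_mul_le_N
  have hcap := P.le_cap
  have hsort := impl_sort hid hI (κ := grpKey P grp idn) (F := F)
    (fun γ γ' a ha ha' h => by rw [grpKey, grpKey, hgl γ γ' a ha ha' h]) hκi hκN
    (fun γ a ha => (grpKey_lt hI (hg γ a ha)).trans_le P.G_mul_le_pow) hF24
  -- The meeting place is a function of the rank and of the index supplied by `hidx`; both are known
  -- to the machine that holds the item after sorting.
  have hloc : ∀ γ a, gatherLoc idn lay grp γ a = (rk lay (grpKey P grp idn) γ a -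
      if grp γ a = 0 then 0 else groupIndex idn lay grp γ a) / P.K := by
    intro γ a
    unfold gatherLoc
    split_ifs
    · rfl
    · rw [rk_grpKey hI, Nat.add_sub_cancel]
  let code : Γ → ι → Fact := fun γ a => idn a :: (lay γ).home a :: F γ a
  let code' : Γ × (Fin ns → O) → ι → Fact := fun γ a =>
    idn a :: (lay γ.1).home a :: (F γ.1 a ++ [reply γ a])
  have hsmall : ∀ γ, ∀ a ∈ (lay γ).A, Small 32 P.N (code γ a) := fun γ a ha =>
    Small.mono (M := 26) (small_cons.2 ⟨(hI a).trans_le P.I_le_N,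
      small_cons.2 ⟨((lay γ).home_lt a ha).trans_le P.q_le_N, hF24 γ a ha⟩⟩) (by norm_num)
  have hsmallF : ∀ γ o, ∀ a ∈ (lay γ).A, Small 24 P.N (F γ a ++ [reply (γ, o) a]) :=
    fun γ o a ha => Small.mono (small_append (hF γ a ha)
      (small_cons.2 ⟨hreplyN _ _, by simp [Small]⟩ : Small (0 + 1) P.N _)) (by omega)
  have hsmall' : ∀ γ o, ∀ a ∈ (lay γ).A, Small 32 P.N (code' (γ, o) a) := fun γ o a ha =>
    Small.mono (M := 26) (small_cons.2 ⟨(hI a).trans_le P.I_le_N,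
      small_cons.2 ⟨((lay γ).home_lt a ha).trans_le P.q_le_N, hsmallF γ o a ha⟩⟩) (by norm_num)
  have hgather : Deliver P.p 32 P.N P.cap (sortedMem idn lay (grpKey P grp idn) F)
      (placed (fun γ => (lay γ).A) (gatherLoc idn lay grp) code) := by
    refine Deliver.route _ (fun γ a => rk lay (grpKey P grp idn) γ a / P.K) _ _ ?_ ?_ ?_ ?_ hsmall
    · intro γ γ' i a h ha hi
      obtain ⟨h1, h2, h3, h4⟩ := sortedMem_know hid h ha hi
      refine ⟨h1, h2 ▸ hi, ?_, ?_⟩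
      · have h5 := hidx γ γ' a ha h1 h4.symm
        simp only at h5
        rw [hloc, hloc, h2, h5]
      · simp only [code, h3, h4]
    · exact fun γ a ha => (rk_div_lt ha).trans_le P.q_le_p
    · exact fun γ i => (card_filter_div_eq_le (rankOf_injOn (hκi γ)) P.K_pos i).trans (by omega)
    · exact fun γ j => (card_gatherLoc_le hid hI hsize γ j).trans (by omega)
  have hrand : Impl P.cap P.W 1
      (factsView P.p (placed (fun γ => (lay γ).A) (gatherLoc idn lay grp) code))
      (factsView P.p (placed (fun γ : Γ × (Fin ns → O) => (lay γ.1).A)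
        (fun γ => gatherLoc idn lay grp γ.1) code'))
      fun γ => (indep ns (D γ)).map fun o => (γ, o) := by
    have hcol : ∀ γ s, ∀ a ∈ (lay γ).A, ∀ b ∈ (lay γ).A, slot γ a = some s →
        slot γ b = some s → gatherLoc idn lay grp γ a = gatherLoc idn lay grp γ b := by
      intro γ s a ha b hb h1 h2
      obtain ⟨h3, h4⟩ := hslotg γ s a ha h1
      rw [gatherLoc, gatherLoc, h4 b hb h2, if_neg h3, if_neg h3]
    have know : ∀ γ γ' i, placed (fun γ => (lay γ).A) (gatherLoc idn lay grp) code γ i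
        = placed (fun γ => (lay γ).A) (gatherLoc idn lay grp) code γ' i →
        ∀ a ∈ (lay γ).A, gatherLoc idn lay grp γ a = i → a ∈ (lay γ').A ∧
          gatherLoc idn lay grp γ' a = i ∧ (lay γ').home a = (lay γ).home a ∧
          F γ' a = F γ a := by
      intro γ γ' i h a ha hi
      obtain ⟨h1, h2, h3⟩ := placed_know (fun γ γ' a b hab => hid (List.cons.inj hab).1) h ha hi
      simp only [List.cons.injEq, true_and] at h3
      exact ⟨h1, h2, h3.1, h3.2⟩
    refine impl_random D o₀ slot ?_ hcol hnone (fun γ a ha => gatherLoc_lt hI ha)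
      (fun γ j => (card_gatherLoc_le hid hI hsize γ j).trans (by omega)) hsmall'
    intro γ γ' i h a ha hi
    obtain ⟨h1, h2, h3, h4⟩ := know γ γ' i h a ha hi
    refine ⟨h1, h2, (hslot γ γ' a ha h1 h4.symm).symm, fun s hs => ?_, fun o o' hoo => ?_⟩
    -- The draw may depend on all items of the slot. By `hcol` they are on the machine of `a`, which
    -- therefore sees the same items in both states.
    · have hs' : slot γ' a = some s := (hslot γ γ' a ha h1 h4.symm).symm.trans hs
      refine (hD γ γ' s ⟨a, ha, hs⟩ (fun b => ⟨?_, ?_⟩) fun b hb hbs => ?_).symm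
      · rintro ⟨hb, hbs⟩
        obtain ⟨l1, -, -, l4⟩ := know γ γ' i h b hb ((hcol γ s b hb a ha hbs hs).trans hi)
        exact ⟨l1, (hslot γ γ' b hb l1 l4.symm).symm.trans hbs⟩
      · rintro ⟨hb, hbs⟩
        obtain ⟨l1, -, -, l4⟩ := know γ' γ i h.symm b hb ((hcol γ' s b hb a h1 hbs hs').trans h2)
        exact ⟨l1, (hslot γ' γ b hb l1 l4.symm).symm.trans hbs⟩
      · exact (know γ γ' i h b hb ((hcol γ s b hb a ha hbs hs).trans hi)).2.2.2.symm
    · simp only [code']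
      rw [hreply γ γ' a o o' ha h1 h4.symm hoo, h3, h4]
  have hhome : Deliver P.p 32 P.N P.cap (placed (fun γ : Γ × (Fin ns → O) => (lay γ.1).A)
        (fun γ => gatherLoc idn lay grp γ.1) code')
      (homeMem idn (fun γ : Γ × (Fin ns → O) => lay γ.1) fun γ a => F γ.1 a ++ [reply γ a]) := by
    refine Deliver.route _ (fun γ => gatherLoc idn lay grp γ.1) _ _ ?_ ?_ ?_ ?_ ?_
    · intro γ γ' i a h ha hi
      obtain ⟨h1, h2, h3⟩ := placed_know (fun γ γ' a b hab => hid (List.cons.inj hab).1) h ha hi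
      simp only [List.cons.injEq, true_and] at h3
      exact ⟨h1, h2, h3.1, by simp only [h3.2]⟩
    · exact fun γ a ha => (gatherLoc_lt hI ha).trans_le P.q_le_p
    · exact fun γ j => (card_gatherLoc_le hid hI hsize γ.1 j).trans (by omega)
    · exact fun γ j => ((lay γ.1).load j).trans (by omega)
    · exact fun γ a ha => Small.mono (M := 25) (small_cons.2 ⟨(hI a).trans_le P.I_le_N,
        hsmallF γ.1 γ.2 a ha⟩) (by norm_num)
  have h1 := hrand.comp (hhome.impl (two_le_N P) P.pow_le_W)
  simp only [PMF.bind_pure] at h1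
  exact hsort.comp_pure ((hgather.impl (two_le_N P) P.pow_le_W).comp_pure h1)

end Ops

/-! ## Operations on the arcs of a graph -/

/-- The number `1` or `0`, according to whether `Q` holds. -/
def bit (Q : Prop) : ℕ := open Classical in if Q then 1 else 0

theorem bit_of {Q : Prop} (h : Q) : bit Q = 1 := if_pos h

theorem bit_not {Q : Prop} (h : ¬ Q) : bit Q = 0 := if_neg h

theorem bit_le_one (Q : Prop) : bit Q ≤ 1 := by
  unfold bit
  split_ifs <;> omega

theorem bit_eq_one {Q : Prop} : bit Q = 1 ↔ Q := by
  unfold bit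
  split_ifs <;> simp [*]

theorem bit_eq_bit {Q R : Prop} : bit Q = bit R ↔ (Q ↔ R) := by
  unfold bit
  split_ifs <;> simp [*]

theorem bit_pos {Q : Prop} : 0 < bit Q ↔ Q := by
  unfold bit
  split_ifs <;> simp [*]

theorem card_filter_eq_sum_bit {ι : Type*} (A : Finset ι) (Q : ι → Prop) [DecidablePred Q] :
    (A.filter Q).card = ∑ a ∈ A, bit (Q a) := by
  rw [Finset.card_filter]
  refine Finset.sum_congr rfl fun a _ => ?_
  unfold bit
  congr

/-- The name of an arc. -/
def arcId {n : ℕ} (a : Fin n × Fin n) : ℕ := a.1 * n + a.2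

theorem arcId_lt_iff {n : ℕ} {a b : Fin n × Fin n} :
    arcId a < arcId b ↔ a.1 < b.1 ∨ (a.1 = b.1 ∧ a.2 < b.2) := by
  obtain ⟨⟨u, hu⟩, ⟨v, hv⟩⟩ := a
  obtain ⟨⟨u', hu'⟩, ⟨v', hv'⟩⟩ := b
  simp only [arcId, Fin.mk_lt_mk, Fin.mk.injEq]
  rcases lt_trichotomy u u' with h | h | h
  · have : (u + 1) * n ≤ u' * n := Nat.mul_le_mul_right _ h
    simp only [h, true_or, iff_true]
    nlinarith
  · simp [h]
  · have : (u' + 1) * n ≤ u * n := Nat.mul_le_mul_right _ h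
    simp only [not_lt.2 h.le, h.ne', false_or, false_and, iff_false]
    nlinarith

theorem arcId_injective {n : ℕ} : Function.Injective (arcId (n := n)) := by
  intro a b h
  have h1 := mt (arcId_lt_iff (a := a) (b := b)).2 (by omega)
  have h2 := mt (arcId_lt_iff (a := b) (b := a)).2 (by omega)
  refine Prod.ext ?_ ?_ <;> omega

theorem arcId_lt {n : ℕ} (a : Fin n × Fin n) : arcId a < n * n := by
  obtain ⟨⟨u, hu⟩, ⟨v, hv⟩⟩ := a
  simp only [arcId]
  have : (u + 1) * n ≤ n * n := Nat.mul_le_mul_right _ hu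
  nlinarith

/-- The parameters are large enough for graphs with `n` vertices. -/
structure LargeFor (P : Params) (n : ℕ) : Prop where
  le_I : n * n ≤ P.I
  lt_G : n * n < P.G
  lt_N : n * n * (4 * n + 4) < P.N

/-- A graph with its arcs distributed over the machines. -/
structure Inst (P : Params) (n : ℕ) where
  /-- the graph -/
  G : SimpleGraph (Fin n)
  /-- the places of the arcs -/
  lay : Layout P (Fin n × Fin n)
  mem_arcs : ∀ a, a ∈ lay.A ↔ G.Adj a.1 a.2

section Arcs

variable {P : Params} {n : ℕ} {Γ : Type} {inst : Γ → Inst P n}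

theorem card_arcs_le (i : Inst P n) : i.lay.A.card ≤ n * n := by
  refine (Finset.card_le_univ _).trans (le_of_eq ?_)
  simp

theorem sum_arcs_lt (hP : LargeFor P n) (i : Inst P n) {val : Fin n × Fin n → ℕ}
    (hv : ∀ a, val a ≤ 4 * n + 4) : ∑ a ∈ i.lay.A, val a < P.N := by
  refine lt_of_le_of_lt (Finset.sum_le_card_nsmul _ _ _ fun a _ => hv a) ?_
  rw [smul_eq_mul]
  exact lt_of_le_of_lt (Nat.mul_le_mul_right _ (card_arcs_le i)) hP.lt_N

theorem arc_lt_I (hP : LargeFor P n) (a : Fin n × Fin n) : arcId a < P.I :=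
  (arcId_lt a).trans_le hP.le_I

/-- The arc only serves to make `n` positive. -/
theorem le_bound (a : Fin n × Fin n) : 4 * n + 4 ≤ n * n * (4 * n + 4) := by
  have := arcId_lt a
  exact Nat.le_mul_of_pos_left _ (by omega)

/-- The sum over the arcs with the same source. -/
def srcSum (inst : Γ → Inst P n) (val : Γ → Fin n × Fin n → ℕ) (γ : Γ) (u : Fin n) : ℕ :=
  ∑ w ∈ nbrs (inst γ).G Finset.univ u, val γ (u, w)

/-- The sum over the arcs with the same source and a smaller target. -/
def srcPrefix (inst : Γ → Inst P n) (val : Γ → Fin n × Fin n → ℕ) (γ : Γ) (a : Fin n × Fin n) :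
    ℕ :=
  ∑ w ∈ (nbrs (inst γ).G Finset.univ a.1).filter (fun w => w < a.2), val γ (a.1, w)

theorem groupTotal_src (val : Γ → Fin n × Fin n → ℕ) (γ : Γ) (a : Fin n × Fin n) :
    groupTotal (fun γ => (inst γ).lay) (fun _ a => (a.1 : ℕ)) val γ a
      = srcSum inst val γ a.1 := by
  classical
  unfold groupTotal srcSum
  refine Finset.sum_bij' (fun b _ => b.2) (fun w _ => (a.1, w)) ?_ ?_ ?_ ?_ ?_
  · intro b hb
    rw [Finset.mem_filter, (inst γ).mem_arcs] at hb
    simpa [nbrs, ← Fin.ext hb.2] using hb.1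
  · intro w hw
    rw [Finset.mem_filter, (inst γ).mem_arcs]
    simpa [nbrs] using hw
  · intro b hb
    rw [Finset.mem_filter] at hb
    exact Prod.ext (Fin.ext hb.2).symm rfl
  · intro w _
    rfl
  · intro b hb
    rw [Finset.mem_filter] at hb
    rw [← Fin.ext hb.2]

theorem groupPrefix_src (val : Γ → Fin n × Fin n → ℕ) (γ : Γ) (a : Fin n × Fin n) :
    groupPrefix (fun γ => (inst γ).lay) (fun _ a => (a.1 : ℕ)) val arcId γ a
      = srcPrefix inst val γ a := by
  classical
  unfold groupPrefix srcPrefix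
  refine Finset.sum_bij' (fun b _ => b.2) (fun w _ => (a.1, w)) ?_ ?_ ?_ ?_ ?_
  · intro b hb
    rw [Finset.mem_filter, (inst γ).mem_arcs, arcId_lt_iff] at hb
    obtain ⟨h1, h2, h3⟩ := hb
    have h2 := Fin.ext h2
    rw [Finset.mem_filter]
    refine ⟨by simpa [nbrs, ← h2] using h1, ?_⟩
    rcases h3 with h3 | h3
    · exact absurd h2 h3.ne
    · exact h3.2
  · intro w hw
    rw [Finset.mem_filter] at hw
    rw [Finset.mem_filter, (inst γ).mem_arcs, arcId_lt_iff]
    exact ⟨by simpa [nbrs] using hw.1, rfl, Or.inr ⟨rfl, hw.2⟩⟩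
  · intro b hb
    rw [Finset.mem_filter] at hb
    exact Prod.ext (Fin.ext hb.2.1).symm rfl
  · intro w _
    rfl
  · intro b hb
    rw [Finset.mem_filter] at hb
    rw [← Fin.ext hb.2.1]

/-- The key that an arc shares with its reverse only. -/
def edgeKey (a : Fin n × Fin n) : ℕ := arcId (min a.1 a.2, max a.1 a.2)

theorem edgeKey_eq_iff {a b : Fin n × Fin n} : edgeKey a = edgeKey b ↔ a = b ∨ a = b.swap := by
  constructor
  · intro h
    have h := arcId_injective h
    obtain ⟨u, v⟩ := a
    obtain ⟨u', v'⟩ := b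
    simp only [Prod.mk.injEq, Prod.swap_prod_mk] at h ⊢
    rcases le_total u v with h1 | h1 <;> rcases le_total u' v' with h2 | h2 <;>
      simp [h1, h2] at h <;> tauto
  · rintro (rfl | rfl)
    · rfl
    · simp [edgeKey, min_comm, max_comm]

/-- The group consists of the arc and its reverse, which are different because there are no loops.
-/
theorem groupTotal_edge (val : Γ → Fin n × Fin n → ℕ) (γ : Γ) (a : Fin n × Fin n)
    (ha : a ∈ (inst γ).lay.A) :
    groupTotal (fun γ => (inst γ).lay) (fun _ => edgeKey) val γ a = val γ a + val γ a.swap := by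
  classical
  have hadj := ((inst γ).mem_arcs a).1 ha
  have hne : a ≠ a.swap := fun h => hadj.ne (Prod.ext_iff.1 h).1
  rw [groupTotal, ← Finset.sum_pair hne]
  refine Finset.sum_congr ?_ fun _ _ => rfl
  ext b
  rw [Finset.mem_filter, edgeKey_eq_iff, Finset.mem_insert, Finset.mem_singleton,
    (inst γ).mem_arcs]
  constructor
  · exact fun h => h.2
  · rintro (rfl | rfl)
    · exact ⟨hadj, Or.inl rfl⟩
    · exact ⟨hadj.symm, Or.inr rfl⟩

variable {F : Γ → Fin n × Fin n → List ℕ} {val : Γ → Fin n × Fin n → ℕ} {k : ℕ}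

/-- The memories that hold the arcs with the fields `F`. -/
abbrev arcView (inst : Γ → Inst P n) (F : Γ → Fin n × Fin n → List ℕ) : View P.p Γ :=
  factsView P.p (homeMem arcId (fun γ => (inst γ).lay) F)

/-- Every arc learns the sum over the arcs with the same source. -/
theorem impl_srcSum (hP : LargeFor P n) (hk : k ≤ 22)
    (hF : FieldsSmall (fun γ => (inst γ).lay) k F)
    (hvl : FieldLocal (fun γ => (inst γ).lay) F val) (hv : ∀ γ a, val γ a ≤ 4 * n + 4) :
    Impl P.cap P.W P.totalRounds (arcView inst F)
      (arcView inst fun γ a => F γ a ++ [srcSum inst val γ a.1]) PMF.pure := by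
  have h := impl_total (lay := fun γ => (inst γ).lay) arcId_injective (arc_lt_I hP) hk hF
    (grp := fun _ a => (a.1 : ℕ)) (fun _ _ _ _ _ _ => rfl) hvl
    (fun γ a _ => (lt_of_lt_of_le a.1.2 (Nat.le_mul_self n)).trans hP.lt_G)
    (fun γ => sum_arcs_lt hP _ (hv γ))
  simpa only [groupTotal_src] using h

/-- Every arc learns the sum over the arcs with the same source and a smaller target. -/
theorem impl_srcPrefix (hP : LargeFor P n) (hk : k ≤ 22)
    (hF : FieldsSmall (fun γ => (inst γ).lay) k F)
    (hvl : FieldLocal (fun γ => (inst γ).lay) F val) (hv : ∀ γ a, val γ a ≤ 4 * n + 4) :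
    Impl P.cap P.W P.scanRounds (arcView inst F)
      (arcView inst fun γ a => F γ a ++ [srcPrefix inst val γ a]) PMF.pure := by
  have h := impl_scan (lay := fun γ => (inst γ).lay) arcId_injective (arc_lt_I hP) (arc_lt_I hP)
    arcId_injective (by omega : k ≤ 23) hF
    (grp := fun _ a => (a.1 : ℕ)) (fun _ _ _ _ _ _ => rfl) hvl
    (fun γ a _ => (lt_of_lt_of_le a.1.2 (Nat.le_mul_self n)).trans hP.lt_G)
    (fun γ => sum_arcs_lt hP _ (hv γ))
  simpa only [groupPrefix_src] using h

theorem homeMem_congr {F F' : Γ → Fin n × Fin n → List ℕ}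
    (h : ∀ γ, ∀ a ∈ (inst γ).lay.A, F γ a = F' γ a) :
    homeMem arcId (fun γ => (inst γ).lay) F = homeMem arcId (fun γ => (inst γ).lay) F' := by
  funext γ j
  ext w
  rw [homeMem, homeMem, mem_placed, mem_placed]
  exact exists_congr fun a => and_congr_right fun ha => by rw [h γ a ha]

/-- Every arc learns the value of its reverse. -/
theorem impl_twin (hP : LargeFor P n) (hk : k ≤ 22)
    (hF : FieldsSmall (fun γ => (inst γ).lay) k F)
    (hvl : FieldLocal (fun γ => (inst γ).lay) F val) (hv : ∀ γ a, val γ a ≤ 4 * n + 4) :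
    Impl P.cap P.W (P.totalRounds + 1) (arcView inst F)
      (arcView inst fun γ a => F γ a ++ [val γ a.swap]) PMF.pure := by
  have h := impl_total (lay := fun γ => (inst γ).lay) arcId_injective (arc_lt_I hP) hk hF
    (grp := fun _ => edgeKey) (fun _ _ _ _ _ _ => rfl) hvl
    (fun γ a _ => (arcId_lt _).trans hP.lt_G) (fun γ => sum_arcs_lt hP _ (hv γ))
  refine h.comp_pure (impl_local arcId_injective (arc_lt_I hP) ?_ ?_)
  · intro γ γ' a ha ha' he
    have hlen : (F γ a).length = (F γ' a).length := by
      have := congrArg List.length he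
      simpa using this
    obtain ⟨h1, h2⟩ := List.append_inj he hlen
    simp only [List.cons.injEq, and_true] at h2
    -- The value of the reverse is the total over the edge minus the own value.
    rw [groupTotal_edge val γ a ha, groupTotal_edge val γ' a ha',
      hvl γ γ' a ha ha' h1, Nat.add_left_cancel_iff] at h2
    simp only [h1, h2]
  · intro γ a ha
    refine Small.mono (small_append (hF γ a ha) (small_cons.2 ⟨?_, by simp [Small]⟩ :
      Small (0 + 1) P.N _)) (by omega)
    exact lt_of_le_of_lt ((hv γ _).trans (le_bound a)) hP.lt_N

theorem fieldsSmall_append (hF : FieldsSmall (fun γ => (inst γ).lay) k F)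
    (hv : ∀ γ, ∀ a ∈ (inst γ).lay.A, val γ a < P.N) :
    FieldsSmall (fun γ => (inst γ).lay) (k + 1) fun γ a => F γ a ++ [val γ a] :=
  fun γ a ha => small_append (hF γ a ha) (small_cons.2 ⟨hv γ a ha, by simp [Small]⟩)

theorem srcSum_lt (hP : LargeFor P n) (hv : ∀ γ a, val γ a ≤ 4 * n + 4) (γ : Γ)
    (a : Fin n × Fin n) : srcSum inst val γ a.1 < P.N := by
  rw [← groupTotal_src]
  exact groupTotal_le.trans_lt (sum_arcs_lt hP _ (hv γ))

theorem srcPrefix_lt (hP : LargeFor P n) (hv : ∀ γ a, val γ a ≤ 4 * n + 4) (γ : Γ)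
    (a : Fin n × Fin n) : srcPrefix inst val γ a < P.N := by
  rw [← groupPrefix_src]
  exact groupPrefix_le.trans_lt (sum_arcs_lt hP _ (hv γ))

theorem val_lt (hP : LargeFor P n) {x : ℕ} (hx : x ≤ 4 * n + 4) (a : Fin n × Fin n) : x < P.N :=
  lt_of_le_of_lt (hx.trans (le_bound a)) hP.lt_N

/-- The position of an arc among the arcs with the same source. -/
def arcIndex (inst : Γ → Inst P n) (γ : Γ) (a : Fin n × Fin n) : ℕ :=
  srcPrefix inst (fun _ _ => 1) γ a

/-- The arc to the smallest neighbour is the one that acts for its source: it makes the random draws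
of the vertex. -/
theorem arcIndex_eq_zero {γ : Γ} {a : Fin n × Fin n} :
    arcIndex inst γ a = 0 ↔ ∀ w, (inst γ).G.Adj a.1 w → a.2 ≤ w := by
  simp [arcIndex, srcPrefix, nbrs, not_lt]

theorem exists_arcIndex_eq_zero {γ : Γ} {u v : Fin n} (h : (inst γ).G.Adj u v) :
    ∃ w, (inst γ).G.Adj u w ∧ arcIndex inst γ (u, w) = 0 := by
  classical
  have hne : (nbrs (inst γ).G Finset.univ u).Nonempty := ⟨v, by simpa [nbrs] using h⟩
  refine ⟨_, by simpa [nbrs] using Finset.min'_mem _ hne, arcIndex_eq_zero.2 fun w hw => ?_⟩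
  exact Finset.min'_le _ _ (by simpa [nbrs] using hw)

theorem eq_of_arcIndex_eq_zero {γ : Γ} {u v w : Fin n} (hv : (inst γ).G.Adj u v)
    (hw : (inst γ).G.Adj u w) (hv0 : arcIndex inst γ (u, v) = 0)
    (hw0 : arcIndex inst γ (u, w) = 0) : v = w :=
  (arcIndex_eq_zero.1 hv0 w hw).antisymm (arcIndex_eq_zero.1 hw0 v hv)

/-- Summing over the arcs of a vertex a value that only the first arc carries. -/
theorem srcSum_first {γ : Γ} {u v : Fin n} (h : (inst γ).G.Adj u v) (x : Γ → Fin n → ℕ) :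
    srcSum inst (fun γ a => if arcIndex inst γ a = 0 then x γ a.1 else 0) γ u = x γ u := by
  classical
  obtain ⟨w, hw, hw0⟩ := exists_arcIndex_eq_zero h
  rw [srcSum, Finset.sum_eq_single w]
  · simp [hw0]
  · intro b hb hbw
    rw [if_neg]
    exact fun hb0 => hbw (eq_of_arcIndex_eq_zero (by simpa [nbrs] using hb) hw hb0 hw0)
  · intro hnot
    exact absurd (by simpa [nbrs] using hw) hnot

/-- A state of the algorithms: the vertices that are left, and the matching found so far. -/
structure Conf (P : Params) (n : ℕ) where
  /-- the graph and the places of its arcs -/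
  inst : Inst P n
  /-- the remaining vertices -/
  V : Finset (Fin n)
  /-- the matching -/
  M : Finset (Sym2 (Fin n))

/-- What an arc knows between the phases. -/
def baseFields (γ : Conf P n) (a : Fin n × Fin n) : List ℕ :=
  [arcIndex Conf.inst γ a, bit (a.1 ∈ γ.V), bit (s(a.1, a.2) ∈ γ.M)]

theorem arcIndex_lt (hP : LargeFor P n) (γ : Γ) (a : Fin n × Fin n) :
    arcIndex inst γ a < P.N := srcPrefix_lt hP (fun _ _ => by omega) γ a

theorem small_baseFields (hP : LargeFor P n) :
    FieldsSmall (fun γ : Conf P n => γ.inst.lay) 3 baseFields := by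
  intro γ a _
  have h : ∀ Q, bit Q < P.N := fun Q => val_lt hP ((bit_le_one Q).trans (by omega)) a
  simp only [baseFields, small_cons (M := 2), small_cons (M := 1), small_cons (M := 0)]
  exact ⟨arcIndex_lt hP γ a, h _, h _, by simp [Small]⟩

end Arcs

/-! ## A phase of `GlobalAlg` as a program -/

theorem coin_of_nonpos {p : ℝ} (h : p ≤ 0) : coin p = PMF.pure false := by
  ext b
  cases b <;> simp [coin, ENNReal.ofReal_eq_zero.2 h, PMF.pure_apply]

theorem uniformOr_of_nonempty {β : Type} {s : Finset β} {d : β} (h : s.Nonempty) :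
    uniformOr s d = PMF.uniformOfFinset s h := dif_pos h

theorem uniformOr_empty {β : Type} {d : β} : uniformOr (∅ : Finset β) d = PMF.pure d :=
  dif_neg Finset.not_nonempty_empty

/-- A uniformly random element can be drawn by its rank. -/
theorem uniformOr_range_map {β : Type} (s : Finset β) (d : β) (r : β → ℕ) (e : ℕ → β)
    (hr : ∀ b ∈ s, r b < s.card) (he : ∀ b ∈ s, e (r b) = b) (hd : s = ∅ → e 0 = d) :
    (uniformOr (Finset.range s.card) 0).map e = uniformOr s d := by
  classical
  rcases s.eq_empty_or_nonempty with h | h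
  · subst h
    rw [Finset.card_empty, Finset.range_zero, uniformOr_empty, uniformOr_empty, PMF.pure_map,
      hd rfl]
  · have hinj : Set.InjOn r s := fun a ha b hb hab => by rw [← he a ha, ← he b hb, hab]
    have himg : Finset.range s.card = s.image r := by
      symm
      refine Finset.eq_of_subset_of_card_le (fun x hx => ?_) ?_
      · obtain ⟨b, hb, rfl⟩ := Finset.mem_image.1 hx
        exact Finset.mem_range.2 (hr b hb)
      · rw [Finset.card_image_of_injOn hinj, Finset.card_range]
    have hne : (Finset.range s.card).Nonempty := by rw [himg]; exact h.image r
    rw [uniformOr_of_nonempty hne, uniformOr_of_nonempty h]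
    ext b
    rw [PMF.map_apply, tsum_eq_sum (s := Finset.range s.card)]
    · rw [Finset.sum_congr rfl fun k hk => by
        rw [PMF.uniformOfFinset_apply_of_mem _ hk], himg, Finset.sum_image hinj,
        Finset.card_image_of_injOn hinj, Finset.sum_congr rfl fun x hx => by rw [he x hx],
        Finset.sum_ite_eq]
      rw [PMF.uniformOfFinset_apply]
    · intro k hk
      rw [PMF.uniformOfFinset_apply_of_notMem _ hk, ite_self]

/-- The selection rule that prefers small vertices. -/
def minPick {n : ℕ} (w : Fin n) (X : Finset (Fin n)) : Fin n :=
  if h : X.Nonempty then X.min' h else w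

theorem isSelectionRule_minPick {n : ℕ} : IsSelectionRule (minPick (n := n)) := by
  intro w X h
  rw [minPick, dif_pos h]
  exact X.min'_mem h

/-! ### A phase of `GlobalAlg` as independent choices at the vertices. -/

section Graph

variable {n : ℕ} (G : SimpleGraph (Fin n)) (H V : Finset (Fin n)) (Δ : ℝ)

theorem mem_nbrs {G : SimpleGraph (Fin n)} {H : Finset (Fin n)} {u v : Fin n} :
    v ∈ nbrs G H u ↔ v ∈ H ∧ G.Adj u v := by
  simp [nbrs]

theorem card_nbrs_le {G : SimpleGraph (Fin n)} {H : Finset (Fin n)} {u : Fin n} :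
    (nbrs G H u).card ≤ n := (Finset.card_le_univ _).trans_eq (by simp)

/-- The vertices of high degree. -/
def heavySet : Finset (Fin n) :=
  open Classical in V.filter fun v => Δ / 2 ≤ ((nbrs G V v).card : ℝ)

/-- The number of smaller neighbours in `H`. -/
def nbrRank (a : Fin n × Fin n) : ℕ := ((nbrs G H a.1).filter fun w => w < a.2).card

theorem nbrRank_lt (a : Fin n × Fin n) : nbrRank G H a < n := by
  refine lt_of_le_of_lt (Finset.card_le_card (t := Finset.Iio a.2) fun w hw => ?_) ?_
  · exact Finset.mem_Iio.2 (Finset.mem_filter.1 hw).2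
  · simp

/-- The neighbour of `v` in `H` of rank `k`. -/
def nbrAt (v : Fin n) (k : ℕ) : Fin n :=
  open Classical in if h : ∃ w ∈ nbrs G H v, nbrRank G H (v, w) = k then h.choose else v

variable {G H V Δ}

theorem nbrAt_nbrRank {v w : Fin n} (hw : w ∈ nbrs G H v) :
    nbrAt G H v (nbrRank G H (v, w)) = w := by
  have hex : ∃ x ∈ nbrs G H v, nbrRank G H (v, x) = nbrRank G H (v, w) := ⟨w, hw, rfl⟩
  rw [nbrAt, dif_pos hex]
  exact rankOf_injOn (A := nbrs G H v) (f := id) (Set.injOn_id _) hex.choose_spec.1 hw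
    hex.choose_spec.2

/-- The hypothesis `hvw` excludes the fallback value of `nbrAt`, which is `v` itself. -/
theorem nbrAt_eq_iff {v w : Fin n} (hvw : v ≠ w) (k : ℕ) :
    nbrAt G H v k = w ↔ w ∈ nbrs G H v ∧ nbrRank G H (v, w) = k := by
  constructor
  · intro h
    unfold nbrAt at h
    split_ifs at h with hex
    · rw [← h]
      exact hex.choose_spec
    · exact absurd h hvw
  · rintro ⟨h, rfl⟩
    exact nbrAt_nbrRank h

/-- Drawing a rank rather than a neighbour suits the distributed setting: the drawing arc needs only
the number of heavy neighbours, and every arc can tell from its own rank whether it was hit. -/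
theorem map_nbrAt (v : Fin n) :
    (uniformOr (Finset.range (nbrs G H v).card) 0).map (nbrAt G H v)
      = uniformOr (nbrs G H v) v := by
  refine uniformOr_range_map _ _ (fun w => nbrRank G H (v, w)) _ ?_ ?_ ?_
  · exact fun b hb => rankOf_lt_card hb
  · exact fun b hb => nbrAt_nbrRank hb
  · intro h
    rw [nbrAt, dif_neg]
    rintro ⟨w, hw, -⟩
    simp [h] at hw

/-- The edges selected by `MatchHeavy` for given random choices. -/
def selectedEdges (pick : Fin n → Finset (Fin n) → Fin n) (H F : Finset (Fin n))
    (star : Fin n → Fin n) (red : Fin n → Bool) : Finset (Sym2 (Fin n)) :=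
  open Classical in
  let cand : Fin n → Finset (Fin n) := fun w => F.filter fun v => red v = true ∧ star v = w
  (H.filter fun w => red w = false ∧ (cand w).Nonempty).image fun w => s(pick w (cand w), w)

/-- The colours only matter on `F` and on `H`. -/
theorem selectedEdges_congr {pick : Fin n → Finset (Fin n) → Fin n} {H F : Finset (Fin n)}
    {star : Fin n → Fin n} {red red' : Fin n → Bool} (h : ∀ v, v ∈ H ∨ v ∈ F → red v = red' v) :
    selectedEdges pick H F star red = selectedEdges pick H F star red' := by
  classical
  have hc : ∀ w, (F.filter fun v => red v = true ∧ star v = w)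
      = F.filter fun v => red' v = true ∧ star v = w := fun w =>
    Finset.filter_congr fun v hv => by rw [h v (Or.inr hv)]
  unfold selectedEdges
  simp only [hc]
  congr 1
  exact Finset.filter_congr fun v hv => by rw [h v (Or.inl hv)]

/-- The random choices at a vertex: membership in `F`, the rank of the heavy neighbour, and the
colour. -/
abbrev Choice : Type := Bool × ℕ × Bool

/-- The arc `(v, w)` belongs to `E_⋆`, apart from the colour of `w`. -/
def IsCand (G : SimpleGraph (Fin n)) (H V : Finset (Fin n)) (o : Fin n → Choice)
    (a : Fin n × Fin n) : Prop :=
  (o a.1).1 = true ∧ a.1 ∈ V ∧ (o a.1).2.2 = true ∧ a.2 ∈ H ∧ nbrRank G H a = (o a.1).2.1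

/-- The arc `(w, v)` is selected by its source. -/
def IsSelected (G : SimpleGraph (Fin n)) (H V : Finset (Fin n)) (o : Fin n → Choice)
    (a : Fin n × Fin n) : Prop :=
  a.1 ∈ H ∧ (o a.1).2.2 = false ∧ IsCand G H V o a.swap ∧
    ∀ x, G.Adj a.1 x → IsCand G H V o (x, a.1) → a.2 ≤ x

/-- The edges selected with the choices `o`. -/
def choiceEdges (G : SimpleGraph (Fin n)) (H V : Finset (Fin n)) (o : Fin n → Choice) :
    Finset (Sym2 (Fin n)) :=
  selectedEdges minPick H (V.filter fun v => (o v).1 = true) (fun v => nbrAt G H v (o v).2.1)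
    fun v => (o v).2.2

/-- With `minPick` a blue heavy vertex takes its first arc whose reverse is a candidate. The
fallback of `nbrAt` does no harm: a vertex that is its own heavy neighbour would have to be red and
blue. -/
theorem mem_choiceEdges {o : Fin n → Choice} {e : Sym2 (Fin n)} :
    e ∈ choiceEdges G H V o ↔ ∃ a, G.Adj a.1 a.2 ∧ IsSelected G H V o a ∧ s(a.1, a.2) = e := by
  classical
  have hcand : ∀ w, (o w).2.2 = false → ∀ v, v ∈ (V.filter fun v => (o v).1 = true).filter
      (fun v => (o v).2.2 = true ∧ nbrAt G H v (o v).2.1 = w) ↔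
      G.Adj w v ∧ IsCand G H V o (v, w) := by
    intro w hw v
    simp only [Finset.mem_filter, IsCand]
    by_cases hvw : v = w
    · subst hvw
      simp [hw]
    · rw [nbrAt_eq_iff hvw, mem_nbrs, G.adj_comm w v]
      tauto
  unfold choiceEdges selectedEdges
  simp only [Finset.mem_image, Finset.mem_filter]
  constructor
  · rintro ⟨w, ⟨hwH, hwr, hne⟩, rfl⟩
    have hm := (hcand w hwr _).1 (Finset.min'_mem _ hne)
    rw [minPick, dif_pos hne]
    refine ⟨(w, _), hm.1, ⟨hwH, hwr, hm.2, fun x hx hxc => ?_⟩, Sym2.eq_swap⟩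
    exact Finset.min'_le _ _ ((hcand w hwr x).2 ⟨hx, hxc⟩)
  · rintro ⟨⟨w, v⟩, hadj, ⟨hwH, hwr, hc, hmin⟩, rfl⟩
    have hv := (hcand w hwr v).2 ⟨hadj, hc⟩
    refine ⟨w, ⟨hwH, hwr, ⟨v, hv⟩⟩, ?_⟩
    rw [minPick, dif_pos ⟨v, hv⟩, Sym2.eq_swap]
    congr 2
    refine le_antisymm (Finset.min'_le _ _ hv) (Finset.le_min' _ _ _ fun y hy => ?_)
    obtain ⟨h1, h2⟩ := (hcand w hwr y).1 hy
    exact hmin y h1 h2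

/-- The law of the choices at a vertex. -/
def choiceLaw (G : SimpleGraph (Fin n)) (H : Finset (Fin n)) (Δ : ℝ) (v : Fin n) : PMF Choice :=
  open Classical in
  if ∃ w, G.Adj v w then
    (coin (((nbrs G H v).card : ℝ) / (4 * Δ))).bind fun f =>
    (uniformOr (Finset.range (nbrs G H v).card) 0).bind fun k =>
    (coin (1 / 2)).map fun r => (f, k, r)
  else PMF.pure (false, 0, false)

theorem nbrs_eq_empty {v : Fin n} (h : ¬ ∃ w, G.Adj v w) (U : Finset (Fin n)) :
    nbrs G U v = ∅ := by
  ext w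
  simp only [mem_nbrs, Finset.notMem_empty, iff_false, not_and]
  exact fun _ hw => h ⟨w, hw⟩

/-- All draws of a phase at one vertex can be made together, since their laws depend only on the
heavy set, which is fixed beforehand. This uses `indep_bind` and the drawing of ranks by
`map_nbrAt`. -/
theorem globalPhase_eq (hΔ : 0 < Δ) (M : Finset (Sym2 (Fin n))) :
    globalPhase minPick G (Δ, V, M) = (indep n (choiceLaw G (heavySet G V Δ) Δ)).map fun o =>
      (Δ / 2, V \ (heavySet G V Δ ∪ V.filter fun v => (o v).1 = true),
        M ∪ choiceEdges G (heavySet G V Δ) V o) := by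
  classical
  set H := heavySet G V Δ with hH
  -- No arc represents an isolated vertex, so no machine draws for it; `mask` replaces its colour by
  -- a constant.
  let mask : Fin n → Bool → Bool := fun v b => if ∃ w, G.Adj v w then b else false
  have hlaw : ∀ v, choiceLaw G H Δ v = (coin (((nbrs G H v).card : ℝ) / (4 * Δ))).bind fun f =>
      (uniformOr (Finset.range (nbrs G H v).card) 0).bind fun k =>
      (coin (1 / 2)).map fun r => (f, k, mask v r) := by
    intro v
    unfold choiceLaw
    simp only [mask]
    split_ifs with h
    · rfl
    · rw [nbrs_eq_empty h, Finset.card_empty, coin_of_nonpos (by simp), Finset.range_zero,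
        uniformOr_empty, PMF.pure_bind, PMF.pure_bind]
      exact (PMF.map_const _ _).symm
  rw [funext hlaw]
  unfold globalPhase randomSubset matchHeavy
  simp only [indep_bind, indep_map, map_bind_eq, bind_map_eq, PMF.map_comp, ← map_nbrAt]
  refine bind_congr_of_support fun f hf => ?_
  refine congrArg _ (funext fun k => ?_)
  congr 1
  funext r
  simp only [Function.comp_apply]
  congr 3
  change selectedEdges minPick H (V.filter fun v => f v = true) (fun v => nbrAt G H v (k v)) r
    = selectedEdges minPick H (V.filter fun v => f v = true) (fun v => nbrAt G H v (k v))
      fun v => mask v (r v)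
  refine selectedEdges_congr fun v hv => ?_
  -- The colour matters only on `H`, where the degree is at least `Δ / 2 > 0`, and on `F`, where an
  -- isolated vertex would have been selected with probability zero.
  have hex : ∃ w, G.Adj v w := by
    by_contra hno
    rcases hv with hv | hv
    · rw [hH, heavySet, Finset.mem_filter, nbrs_eq_empty hno] at hv
      simp at hv
      linarith
    · have h1 := mem_support_indep.1 hf v
      rw [nbrs_eq_empty hno, coin_of_nonpos (by simp)] at h1
      rw [PMF.mem_support_pure_iff] at h1
      simp [h1] at hv
  simp only [mask, if_pos hex]

end Graph

/-! ### The phase of `GlobalAlg` carried out by sums over arcs. -/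

section GlobalProgram

variable {P : Params} {n : ℕ} {Γ : Type}

theorem srcSum_mem (inst : Γ → Inst P n) (X : Γ → Finset (Fin n)) (γ : Γ) (u : Fin n) :
    srcSum inst (fun γ a => bit (a.2 ∈ X γ)) γ u = (nbrs (inst γ).G (X γ) u).card := by
  classical
  rw [srcSum, ← card_filter_eq_sum_bit _ fun w => w ∈ X γ]
  congr 1
  ext w
  simp [mem_nbrs, and_comm]

theorem srcPrefix_mem (inst : Γ → Inst P n) (X : Γ → Finset (Fin n)) (γ : Γ)
    (a : Fin n × Fin n) :
    srcPrefix inst (fun γ a => bit (a.2 ∈ X γ)) γ a = nbrRank (inst γ).G (X γ) a := by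
  classical
  rw [srcPrefix, ← card_filter_eq_sum_bit _ fun w => w ∈ X γ, nbrRank]
  congr 1
  ext w
  simp [mem_nbrs, and_comm, and_left_comm]

/-- The choices at a vertex as a word. -/
def choiceCode (n : ℕ) (o : Choice) : ℕ :=
  4 * min o.2.1 n + 2 * bit (o.1 = true) + bit (o.2.2 = true)

theorem choiceCode_le (o : Choice) : choiceCode n o ≤ 4 * n + 4 := by
  have := bit_le_one (o.1 = true)
  have := bit_le_one (o.2.2 = true)
  unfold choiceCode
  omega

/-- The code clamps the rank at `n` to bound the word for arbitrary choices. Comparisons with ranks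
`x < n` survive this, and every `nbrRank` is such a rank. -/
theorem choiceCode_eq {o o' : Choice} (h : choiceCode n o = choiceCode n o') :
    o.1 = o'.1 ∧ o.2.2 = o'.2.2 ∧ ∀ x < n, x = o.2.1 ↔ x = o'.2.1 := by
  have h1 := bit_le_one (o.1 = true)
  have h2 := bit_le_one (o.2.2 = true)
  have h3 := bit_le_one (o'.1 = true)
  have h4 := bit_le_one (o'.2.2 = true)
  unfold choiceCode at h
  have h5 : bit (o.1 = true) = bit (o'.1 = true) := by omega
  have h6 : bit (o.2.2 = true) = bit (o'.2.2 = true) := by omega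
  have h7 : min o.2.1 n = min o'.2.1 n := by omega
  refine ⟨Bool.eq_iff_iff.2 (bit_eq_bit.1 h5), Bool.eq_iff_iff.2 (bit_eq_bit.1 h6), ?_⟩
  intro x hx
  omega

variable (Δ : ℝ)

/-- The vertices of high degree in the current state. -/
abbrev Conf.heavy (γ : Conf P n) : Finset (Fin n) := heavySet γ.inst.G γ.V Δ

theorem mem_heavy {γ : Conf P n} {u : Fin n} :
    u ∈ γ.heavy Δ ↔ u ∈ γ.V ∧ Δ / 2 ≤ ((nbrs γ.inst.G γ.V u).card : ℝ) := by
  simp [Conf.heavy, heavySet]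

/-- The fields of an arc before the draw. -/
def heavyFields (γ : Conf P n) (a : Fin n × Fin n) : List ℕ :=
  baseFields γ a ++ [bit (a.2 ∈ γ.V)] ++ [(nbrs γ.inst.G γ.V a.1).card] ++
    [bit (a.2 ∈ γ.heavy Δ)] ++ [(nbrs γ.inst.G (γ.heavy Δ) a.1).card] ++
    [nbrRank γ.inst.G (γ.heavy Δ) a]

/-- The rounds needed before the draw. -/
def Params.heavyRounds (P : Params) : ℕ :=
  P.totalRounds + 1 + (P.totalRounds + (P.totalRounds + 1 + (P.totalRounds + P.scanRounds)))

/-- An arc learns in turn whether its target remains, the degree of its source, whether its target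
is heavy, the number of heavy neighbours of its source, and its own rank among the heavy neighbours.
The source data are sums over arcs; the target data come from the reverse arc. -/
theorem impl_heavy (hP : LargeFor P n) :
    Impl P.cap P.W P.heavyRounds (arcView Conf.inst baseFields)
      (arcView Conf.inst (heavyFields Δ)) (PMF.pure (α := Conf P n)) := by
  have hb : ∀ (Q : Prop), bit Q ≤ 4 * n + 4 := fun Q => (bit_le_one Q).trans (by omega)
  have hN : ∀ (a : Fin n × Fin n) {x : ℕ}, x ≤ 4 * n + 4 → x < P.N := fun a _ h => val_lt hP h a
  have hd : ∀ {G : SimpleGraph (Fin n)} {X : Finset (Fin n)} {u : Fin n},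
      (nbrs G X u).card ≤ 4 * n + 4 := card_nbrs_le.trans (by omega)
  have s0 := small_baseFields (P := P) (n := n) hP
  have s1 := fieldsSmall_append s0 (val := fun γ a => bit (a.2 ∈ γ.V))
    fun γ a _ => hN a (hb _)
  have s2 := fieldsSmall_append s1 (val := fun γ a => (nbrs γ.inst.G γ.V a.1).card)
    fun γ a _ => hN a hd
  have s3 := fieldsSmall_append s2 (val := fun γ a => bit (a.2 ∈ γ.heavy Δ))
    fun γ a _ => hN a (hb _)
  have s4 := fieldsSmall_append s3 (val := fun γ a => (nbrs γ.inst.G (γ.heavy Δ) a.1).card)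
    fun γ a _ => hN a hd
  have o1 := impl_twin hP (by omega) s0 (val := fun γ a => bit (a.1 ∈ γ.V))
    (fun γ γ' a _ _ h => by
      simp only [baseFields, List.cons.injEq, bit_eq_bit] at h
      simp only [h]) fun _ _ => hb _
  have o2 := impl_srcSum hP (by omega) s1 (val := fun γ a => bit (a.2 ∈ γ.V))
    (fun γ γ' a _ _ h => by
      simp only [baseFields, List.cons_append, List.nil_append, List.cons.injEq, bit_eq_bit] at h
      simp only [h]) fun _ _ => hb _
  have o3 := impl_twin hP (by omega) s2 (val := fun γ a => bit (a.1 ∈ γ.heavy Δ))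
    (fun γ γ' a _ _ h => by
      simp only [baseFields, List.cons_append, List.nil_append, List.cons.injEq, bit_eq_bit] at h
      simp only [mem_heavy, h]) fun _ _ => hb _
  have o4 := impl_srcSum hP (by omega) s3 (val := fun γ a => bit (a.2 ∈ γ.heavy Δ))
    (fun γ γ' a _ _ h => by
      simp only [baseFields, List.cons_append, List.nil_append, List.cons.injEq, bit_eq_bit] at h
      simp only [h]) fun _ _ => hb _
  have o5 := impl_srcPrefix hP (by omega) s4 (val := fun γ a => bit (a.2 ∈ γ.heavy Δ))
    (fun γ γ' a _ _ h => by
      simp only [baseFields, List.cons_append, List.nil_append, List.cons.injEq, bit_eq_bit] at h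
      simp only [h]) fun _ _ => hb _
  simp only [srcSum_mem] at o2 o4
  simp only [srcPrefix_mem] at o5
  exact o1.comp_pure (o2.comp_pure (o3.comp_pure (o4.comp_pure o5)))

theorem small_heavyFields (hP : LargeFor P n) :
    FieldsSmall (fun γ : Conf P n => γ.inst.lay) 8 (heavyFields Δ) := by
  have hN : ∀ (a : Fin n × Fin n) {x : ℕ}, x ≤ 4 * n + 4 → x < P.N := fun a _ h => val_lt hP h a
  have hb : ∀ (Q : Prop), bit Q ≤ 4 * n + 4 := fun Q => (bit_le_one Q).trans (by omega)
  have hd : ∀ {G : SimpleGraph (Fin n)} {X : Finset (Fin n)} {u : Fin n},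
      (nbrs G X u).card ≤ 4 * n + 4 := card_nbrs_le.trans (by omega)
  exact fieldsSmall_append (fieldsSmall_append (fieldsSmall_append (fieldsSmall_append
    (fieldsSmall_append (small_baseFields hP) fun γ a _ => hN a (hb _)) fun γ a _ => hN a hd)
    fun γ a _ => hN a (hb _)) fun γ a _ => hN a hd)
    fun γ a _ => hN a ((nbrRank_lt _ _ a).le.trans (by omega))

/-- A state together with the random choices of a phase. -/
abbrev ChoiceConf (P : Params) (n : ℕ) : Type := Conf P n × (Fin n → Choice)

/-- The instance of a state with choices. -/
abbrev choiceInst (γ : ChoiceConf P n) : Inst P n := γ.1.inst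

/-- The fields of an arc after the draw. -/
def drawnFields (γ : ChoiceConf P n) (a : Fin n × Fin n) : List ℕ :=
  heavyFields Δ γ.1 a ++ [if arcIndex choiceInst γ a = 0 then choiceCode n (γ.2 a.1) else 0]

theorem heavyFields_eq {γ γ' : Conf P n} {a : Fin n × Fin n}
    (h : heavyFields Δ γ a = heavyFields Δ γ' a) :
    baseFields γ a = baseFields γ' a ∧ (a.2 ∈ γ.V ↔ a.2 ∈ γ'.V) ∧
      (nbrs γ.inst.G γ.V a.1).card = (nbrs γ'.inst.G γ'.V a.1).card ∧
      (a.2 ∈ γ.heavy Δ ↔ a.2 ∈ γ'.heavy Δ) ∧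
      (nbrs γ.inst.G (γ.heavy Δ) a.1).card = (nbrs γ'.inst.G (γ'.heavy Δ) a.1).card ∧
      nbrRank γ.inst.G (γ.heavy Δ) a = nbrRank γ'.inst.G (γ'.heavy Δ) a := by
  simp only [heavyFields, baseFields, List.cons_append, List.nil_append, List.cons.injEq,
    bit_eq_bit, and_true] at h ⊢
  tauto

theorem baseFields_eq {γ γ' : Conf P n} {a : Fin n × Fin n}
    (h : baseFields γ a = baseFields γ' a) :
    arcIndex Conf.inst γ a = arcIndex Conf.inst γ' a ∧ (a.1 ∈ γ.V ↔ a.1 ∈ γ'.V) ∧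
      (s(a.1, a.2) ∈ γ.M ↔ s(a.1, a.2) ∈ γ'.M) := by
  simpa only [baseFields, List.cons.injEq, bit_eq_bit, and_true] using h

theorem append_singleton_eq {l l' : List ℕ} {x x' : ℕ} (h : l ++ [x] = l' ++ [x']) :
    l = l' ∧ x = x' := by
  simpa using List.append_inj' h rfl

theorem small_drawnFields (hP : LargeFor P n) :
    FieldsSmall (fun γ : ChoiceConf P n => γ.1.inst.lay) 9 (drawnFields Δ) := by
  refine fieldsSmall_append (inst := choiceInst)
    (fun γ a ha => small_heavyFields Δ hP γ.1 a ha) fun γ a _ => val_lt hP ?_ a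
  split_ifs
  · exact choiceCode_le _
  · omega

/-- The first arc of a vertex knows the number of heavy neighbours, the only datum on which the law
of the choices depends. -/
theorem impl_choice (hP : LargeFor P n) :
    Impl P.cap P.W 1 (arcView Conf.inst (heavyFields Δ)) (arcView choiceInst (drawnFields Δ))
      fun γ : Conf P n => (indep n (choiceLaw γ.inst.G (γ.heavy Δ) Δ)).map fun o => (γ, o) := by
  classical
  refine impl_draw (lay := fun γ : Conf P n => γ.inst.lay) arcId_injective (arc_lt_I hP)
    (fun γ => choiceLaw γ.inst.G (γ.heavy Δ) Δ) (false, 0, false)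
    (fun γ a => if arcIndex Conf.inst γ a = 0 then some a.1 else none) ?_ ?_ ?_ ?_ ?_ ?_
  · intro γ γ' a _ _ h
    simp only [(baseFields_eq (heavyFields_eq Δ h).1).1]
  · intro γ s a ha b hb h1 h2
    simp only [Option.ite_none_right_eq_some, Option.some.injEq] at h1 h2
    obtain ⟨u, v⟩ := a
    obtain ⟨u', v'⟩ := b
    obtain ⟨h1, rfl⟩ := h1
    obtain ⟨h2, h3⟩ := h2
    obtain rfl : u' = u := h3
    rw [γ.inst.mem_arcs] at ha hb
    exact Prod.ext rfl (eq_of_arcIndex_eq_zero (inst := Conf.inst) (γ := γ) ha hb h1 h2)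
  · intro γ γ' a s ha ha' h hs
    simp only [Option.ite_none_right_eq_some, Option.some.injEq] at hs
    obtain ⟨-, rfl⟩ := hs
    have hc := (heavyFields_eq Δ h).2.2.2.2.1
    rw [γ.inst.mem_arcs] at ha
    rw [γ'.inst.mem_arcs] at ha'
    rw [choiceLaw, choiceLaw, if_pos ⟨_, ha⟩, if_pos ⟨_, ha'⟩, hc]
  -- A vertex whose slot belongs to no arc is isolated, and `choiceLaw` is a point mass there.
  · intro γ s hs
    rw [choiceLaw, if_neg]
    rintro ⟨w, hw⟩
    obtain ⟨x, hx, hx0⟩ := exists_arcIndex_eq_zero (inst := Conf.inst) (γ := γ) hw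
    exact hs (s, x) ((γ.inst.mem_arcs _).2 hx) (if_pos hx0)
  · intro γ γ' a o o' ha ha' h hs
    have hx : arcIndex choiceInst (γ, o) a = arcIndex choiceInst (γ', o') a :=
      (baseFields_eq (heavyFields_eq Δ h).1).1
    have h0 : arcIndex choiceInst (γ, o) a = arcIndex Conf.inst γ a := rfl
    simp only [drawnFields, h, ← hx]
    split_ifs with h1
    · rw [hs a.1 (if_pos (h0 ▸ h1))]
    · rfl
  · exact fun γ a ha => (small_drawnFields Δ hP γ a ha).mono (by omega)

/-- The membership of the arc in the set of candidates, as a field. -/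
abbrev candBit (γ : ChoiceConf P n) (a : Fin n × Fin n) : ℕ :=
  bit (IsCand γ.1.inst.G (γ.1.heavy Δ) γ.1.V γ.2 a)

/-- The fields with the candidates. -/
def candFields (γ : ChoiceConf P n) (a : Fin n × Fin n) : List ℕ :=
  drawnFields Δ γ a ++ [choiceCode n (γ.2 a.1)] ++ [candBit Δ γ a.swap] ++
    [srcPrefix choiceInst (fun γ a => candBit Δ γ a.swap) γ a]

/-- Whether the arc is selected by its source, as a field. -/
abbrev selBit (γ : ChoiceConf P n) (a : Fin n × Fin n) : ℕ :=
  bit (IsSelected γ.1.inst.G (γ.1.heavy Δ) γ.1.V γ.2 a)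

theorem candFields_eq {γ γ' : ChoiceConf P n} {a : Fin n × Fin n}
    (h : candFields Δ γ a = candFields Δ γ' a) :
    heavyFields Δ γ.1 a = heavyFields Δ γ'.1 a ∧
      choiceCode n (γ.2 a.1) = choiceCode n (γ'.2 a.1) ∧
      candBit Δ γ a.swap = candBit Δ γ' a.swap ∧
      srcPrefix choiceInst (fun γ a => candBit Δ γ a.swap) γ a
        = srcPrefix choiceInst (fun γ a => candBit Δ γ a.swap) γ' a := by
  obtain ⟨h, h1⟩ := append_singleton_eq h
  obtain ⟨h, h2⟩ := append_singleton_eq h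
  obtain ⟨h, h3⟩ := append_singleton_eq h
  exact ⟨(append_singleton_eq h).1, h3, h2, h1⟩

/-- Being the smallest candidate means that no earlier arc of the source has a candidate as its
reverse, that is, that a prefix sum vanishes. -/
theorem isSelected_iff (γ : ChoiceConf P n) (a : Fin n × Fin n) :
    IsSelected γ.1.inst.G (γ.1.heavy Δ) γ.1.V γ.2 a ↔ a.1 ∈ γ.1.heavy Δ ∧ (γ.2 a.1).2.2 = false ∧
      candBit Δ γ a.swap = 1 ∧ srcPrefix choiceInst (fun γ a => candBit Δ γ a.swap) γ a = 0 := by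
  classical
  rw [IsSelected, bit_eq_one]
  refine and_congr_right fun _ => and_congr_right fun _ => and_congr_right fun _ => ?_
  simp only [srcPrefix, Finset.sum_eq_zero_iff, Finset.mem_filter, mem_nbrs, Finset.mem_univ,
    true_and, candBit, Prod.swap_prod_mk]
  refine forall_congr' fun x => ?_
  rw [← not_lt, and_imp]
  refine forall_congr' fun _ => ?_
  constructor
  · exact fun h hx => bit_not fun hc => h hc hx
  · intro h hc hx
    have := h hx
    rw [bit_of hc] at this
    omega

/-- The state after a phase. -/
def ChoiceConf.next (γ : ChoiceConf P n) : Conf P n where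
  inst := γ.1.inst
  V := γ.1.V \ (γ.1.heavy Δ ∪ γ.1.V.filter fun v => (γ.2 v).1 = true)
  M := open Classical in γ.1.M ∪ choiceEdges γ.1.inst.G (γ.1.heavy Δ) γ.1.V γ.2

/-- The number of rounds for a phase of `GlobalAlg`. -/
def Params.globalRounds (P : Params) : ℕ :=
  P.heavyRounds + (1 + (P.totalRounds + (P.totalRounds + 1 + (P.scanRounds +
    (P.totalRounds + 1 + 1)))))

/-- The choices are spread to all arcs of the vertex, candidates are announced to the reverse arcs,
prefix sums find the selected ones, and a last exchange with the reverse settles membership in the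
matching. -/
theorem impl_select (hP : LargeFor P n) :
    Impl P.cap P.W (P.totalRounds + (P.totalRounds + 1 + (P.scanRounds + (P.totalRounds + 1 + 1))))
      (arcView choiceInst (drawnFields Δ))
      (arcView choiceInst fun γ => baseFields (ChoiceConf.next Δ γ))
      (PMF.pure (α := ChoiceConf P n)) := by
  classical
  have hN : ∀ (a : Fin n × Fin n) {x : ℕ}, x ≤ 4 * n + 4 → x < P.N := fun a _ h => val_lt hP h a
  have hb : ∀ (Q : Prop), bit Q ≤ 4 * n + 4 := fun Q => (bit_le_one Q).trans (by omega)
  have s0 := small_drawnFields (P := P) (n := n) Δ hP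
  have s1 := fieldsSmall_append (inst := choiceInst) s0
    (val := fun γ a => choiceCode n (γ.2 a.1)) fun γ a _ => hN a (choiceCode_le _)
  have s2 := fieldsSmall_append (inst := choiceInst) s1
    (val := fun γ a => candBit Δ γ a.swap) fun γ a _ => hN a (hb _)
  have s3 : FieldsSmall (fun γ => (choiceInst γ).lay) _ (candFields Δ) :=
    fieldsSmall_append (inst := choiceInst) s2 fun γ a _ =>
      srcPrefix_lt (val := fun γ a => candBit Δ γ a.swap) hP (fun _ _ => hb _) γ a
  have o1 := impl_srcSum (inst := choiceInst) hP (by omega) s0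
    (val := fun γ a => if arcIndex choiceInst γ a = 0 then choiceCode n (γ.2 a.1) else 0)
    (fun γ γ' a _ _ h => (append_singleton_eq h).2)
    (fun γ a => by
      split_ifs
      · exact choiceCode_le _
      · omega)
  -- Only the first arc carries the code, so the sum over the arcs of the vertex broadcasts it.
  have e1 := homeMem_congr (inst := choiceInst (P := P) (n := n))
    (F := fun γ a => drawnFields Δ γ a ++ [srcSum choiceInst (fun γ a =>
      if arcIndex choiceInst γ a = 0 then choiceCode n (γ.2 a.1) else 0) γ a.1])
    (F' := fun γ a => drawnFields Δ γ a ++ [choiceCode n (γ.2 a.1)]) fun γ a ha => by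
      rw [srcSum_first (inst := choiceInst) ((γ.1.inst.mem_arcs a).1 ha)
        fun γ u => choiceCode n (γ.2 u)]
  rw [arcView, arcView, e1] at o1
  have o2 := impl_twin (inst := choiceInst) hP (by omega) s1 (val := candBit Δ)
    (fun γ γ' a _ _ h => by
      obtain ⟨h, h1⟩ := append_singleton_eq h
      obtain ⟨h2, -, -, h5, -, h6⟩ := heavyFields_eq Δ (append_singleton_eq h).1
      obtain ⟨-, h7, -⟩ := baseFields_eq h2
      obtain ⟨h8, h9, h10⟩ := choiceCode_eq h1
      have h11 := h10 _ (nbrRank_lt γ'.1.inst.G (γ'.1.heavy Δ) a)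
      simp only [candBit, IsCand, h5, h6, h7, h8, h9, h11]) fun _ _ => hb _
  have o3 := impl_srcPrefix (inst := choiceInst) hP (by omega) s2
    (val := fun γ a => candBit Δ γ a.swap)
    (fun γ γ' a _ _ h => (append_singleton_eq h).2) fun _ _ => hb _
  have hsel : FieldLocal (fun γ => (choiceInst (P := P) (n := n) γ).lay) (candFields Δ)
      (selBit Δ) := by
    intro γ γ' a _ _ h
    obtain ⟨h, h1, h2, h3⟩ := candFields_eq Δ h
    obtain ⟨h4, -, h5, -⟩ := heavyFields_eq Δ h
    obtain ⟨-, h7, -⟩ := baseFields_eq h4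
    obtain ⟨-, h9, -⟩ := choiceCode_eq h1
    rw [selBit, selBit, bit_eq_bit, isSelected_iff, isSelected_iff, mem_heavy, mem_heavy, h2, h3,
      h5, h7, h9]
  have o4 := impl_twin (inst := choiceInst) hP (by omega) s3 (val := selBit Δ) hsel
    fun _ _ => hb _
  refine o1.comp_pure (o2.comp_pure (o3.comp_pure (o4.comp_pure
    (impl_local arcId_injective (arc_lt_I hP) ?_ ?_))))
  · intro γ γ' a ha ha' h
    obtain ⟨h0, h1⟩ := append_singleton_eq h
    have h2 := hsel γ γ' a ha ha' h0
    obtain ⟨h3, h4, -⟩ := candFields_eq Δ h0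
    obtain ⟨h5, -, h6, -⟩ := heavyFields_eq Δ h3
    obtain ⟨h7, h8, h9⟩ := baseFields_eq h5
    obtain ⟨h10, -⟩ := choiceCode_eq h4
    rw [bit_eq_bit] at h1 h2
    -- An edge enters the matching if it is selected along one of its two arcs, so an arc also needs
    -- the bit of its reverse.
    have key : ∀ γ : ChoiceConf P n, ∀ a ∈ γ.1.inst.lay.A,
        s(a.1, a.2) ∈ choiceEdges γ.1.inst.G (γ.1.heavy Δ) γ.1.V γ.2 ↔
          IsSelected γ.1.inst.G (γ.1.heavy Δ) γ.1.V γ.2 a ∨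
          IsSelected γ.1.inst.G (γ.1.heavy Δ) γ.1.V γ.2 a.swap := by
      intro γ a ha
      rw [γ.1.inst.mem_arcs] at ha
      rw [mem_choiceEdges]
      constructor
      · rintro ⟨b, -, hb, he⟩
        rcases Sym2.eq_iff.1 he with ⟨h1, h2⟩ | ⟨h1, h2⟩
        · exact Or.inl (by rwa [← show b = a from Prod.ext h1 h2])
        · exact Or.inr (by rwa [← show b = a.swap from Prod.ext h1 h2])
      · rintro (h | h)
        · exact ⟨a, ha, h, rfl⟩
        · exact ⟨a.swap, ha.symm, h, Sym2.eq_swap⟩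
    have e1 : arcIndex Conf.inst (ChoiceConf.next Δ γ) a
        = arcIndex Conf.inst (ChoiceConf.next Δ γ') a := h7
    simp only [baseFields, e1, List.cons.injEq, true_and, and_true, bit_eq_bit]
    simp only [ChoiceConf.next, Finset.mem_sdiff, Finset.mem_union, Finset.mem_filter, mem_heavy,
      key γ a ha, key γ' a ha', h1, h2, h6, h8, h9, h10, and_self]
  · exact fun γ a ha => (small_baseFields hP (ChoiceConf.next Δ γ) a ha).mono (by omega)

/-- The state of the machines for a state of the algorithms. -/
def stateConf (i : Inst P n) (s : State n) : Conf P n := ⟨i, s.2.1, s.2.2⟩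

variable {Δ}

/-- A phase of `GlobalAlg` takes a bounded number of rounds. -/
theorem impl_globalPhase (hP : LargeFor P n) (hΔ : 0 < Δ) :
    Impl P.cap P.W P.globalRounds (arcView Conf.inst baseFields) (arcView Conf.inst baseFields)
      fun γ : Conf P n => (globalPhase minPick γ.inst.G (Δ, γ.V, γ.M)).map (stateConf γ.inst) := by
  have h := (impl_heavy Δ hP).comp_pure ((impl_choice Δ hP).comp (impl_select Δ hP))
  simp only [PMF.bind_pure] at h
  refine h.congr_law fun γ => ?_
  rw [globalPhase_eq hΔ, PMF.map_comp, PMF.map_comp, PMF.map_comp]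
  rfl

end GlobalProgram

/-! ## An iteration of `ParallelAlg` as a program -/

section Parts

variable {n : ℕ} (G : SimpleGraph (Fin n)) (S : ℕ) (V : Finset (Fin n)) (φ : Fin n → ℕ)

/-- A set of the partition. -/
def part (i : ℕ) : Finset (Fin n) := V.filter fun v => φ v = i

/-- A set of the partition, or `∅` if it induces too many edges. -/
def keptPart (i : ℕ) : Finset (Fin n) :=
  open Classical in if 8 * S < (inducedOn G (part V φ i)).edgeSet.ncard then ∅ else part V φ i

/-- The graph induced by a set of the partition. -/
abbrev partGraph (i : ℕ) : SimpleGraph (Fin n) := inducedOn G (keptPart G S V φ i)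

/-- The vertices of a set of the partition that have neighbours in it. -/
def partCore (i : ℕ) : Finset (Fin n) :=
  open Classical in (keptPart G S V φ i).filter fun v => ∃ w, (partGraph G S V φ i).Adj v w

/-- The set of the partition that contains both ends of an arc. -/
def arcSlot (m : ℕ) (a : Fin n × Fin n) : Option (Fin m) :=
  open Classical in
  if h : ∃ i : Fin m, a.1 ∈ keptPart G S V φ i ∧ a.2 ∈ keptPart G S V φ i then some h.choose
  else none

variable {G S V φ}

theorem mem_part {i : ℕ} {v : Fin n} : v ∈ part V φ i ↔ v ∈ V ∧ φ v = i := by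
  simp [part]

theorem mem_keptPart {i : ℕ} {v : Fin n} : v ∈ keptPart G S V φ i ↔
    v ∈ V ∧ φ v = i ∧ (inducedOn G (part V φ i)).edgeSet.ncard ≤ 8 * S := by
  unfold keptPart
  split_ifs with h
  · simp only [Finset.notMem_empty, false_iff]
    omega
  · rw [mem_part]
    simp only [not_lt] at h
    tauto

theorem keptPart_eq_part {i : ℕ} {v : Fin n} (h : v ∈ keptPart G S V φ i) :
    keptPart G S V φ i = part V φ i := by
  unfold keptPart at h ⊢
  split_ifs with h'
  · simp [h'] at h
  · rfl

theorem arcSlot_eq_some {m : ℕ} {a : Fin n × Fin n} {i : Fin m} :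
    arcSlot G S V φ m a = some i ↔ a.1 ∈ keptPart G S V φ i ∧ a.2 ∈ keptPart G S V φ i := by
  unfold arcSlot
  constructor
  · intro h
    split_ifs at h with hex
    cases h
    exact hex.choose_spec
  · intro h
    have hex : ∃ i : Fin m, a.1 ∈ keptPart G S V φ i ∧ a.2 ∈ keptPart G S V φ i := ⟨i, h⟩
    rw [dif_pos hex, Option.some.injEq]
    have h1 := (mem_keptPart.1 hex.choose_spec.1).2.1
    have h2 := (mem_keptPart.1 h.1).2.1
    exact Fin.ext (h1.symm.trans h2)

theorem mem_partCore {i : ℕ} {v : Fin n} : v ∈ partCore G S V φ i ↔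
    v ∈ keptPart G S V φ i ∧ ∃ w, G.Adj v w ∧ w ∈ keptPart G S V φ i := by
  simp only [partCore, inducedOn, Finset.mem_filter]
  refine and_congr_right fun h => ?_
  simp [h]

/-- Counting the arcs of an induced subgraph. -/
theorem card_arcs_inducedOn (A : Finset (Fin n × Fin n)) (hA : ∀ a, a ∈ A ↔ G.Adj a.1 a.2)
    (X : Finset (Fin n)) :
    (A.filter fun a => a.1 ∈ X ∧ a.2 ∈ X).card = 2 * (inducedOn G X).edgeSet.ncard := by
  classical
  rw [Set.ncard_eq_toFinset_card', ← SimpleGraph.edgeFinset,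
    ← SimpleGraph.dart_card_eq_twice_card_edges, ← Fintype.card_coe]
  refine Fintype.card_congr ⟨fun a => ⟨a.1, ?_⟩, fun d => ⟨d.toProd, ?_⟩, fun a => rfl,
    fun d => rfl⟩
  · have := a.2
    rw [Finset.mem_filter, hA] at this
    exact this
  · have := d.adj
    rw [Finset.mem_filter, hA]
    exact this

end Parts

/-! ### The random partition and what an arc knows about its part. -/

section Program

variable {P : Params} {n : ℕ} (S m : ℕ)

/-- The random choices at a vertex: its set in the partition, and whether it survives if it is
isolated there. -/
abbrev PartChoice : Type := ℕ × Bool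

/-- The choices as a word. -/
def partCode (n : ℕ) (o : PartChoice) : ℕ := 2 * min o.1 n + bit (o.2 = true)

theorem partCode_le (o : PartChoice) : partCode n o ≤ 4 * n + 4 := by
  have := bit_le_one (o.2 = true)
  unfold partCode
  omega

theorem partCode_eq {o o' : PartChoice} (h : partCode n o = partCode n o') :
    min o.1 n = min o'.1 n ∧ o.2 = o'.2 := by
  have h1 := bit_le_one (o.2 = true)
  have h2 := bit_le_one (o'.2 = true)
  unfold partCode at h
  have h5 : bit (o.2 = true) = bit (o'.2 = true) := by omega
  exact ⟨by omega, Bool.eq_iff_iff.2 (bit_eq_bit.1 h5)⟩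

/-- The law of the choices at a vertex. -/
def partLaw (G : SimpleGraph (Fin n)) (m : ℕ) (c : ℝ) (v : Fin n) : PMF PartChoice :=
  open Classical in
  if ∃ w, G.Adj v w then
    (uniformOr (Finset.range m) 0).bind fun i => (coin c).map fun z => (i, z)
  else PMF.pure (0, false)

/-- A state with a random partition. -/
abbrev PartConf (P : Params) (n : ℕ) : Type := Conf P n × (Fin n → PartChoice)

/-- The instance of a state with a partition. -/
abbrev partInst (γ : PartConf P n) : Inst P n := γ.1.inst

/-- The partition. -/
abbrev PartConf.assign (γ : PartConf P n) (v : Fin n) : ℕ := (γ.2 v).1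

/-- The number of the part of a vertex, starting with `1`; the removed vertices have number `0`. -/
def partKey (γ : PartConf P n) (v : Fin n) : ℕ :=
  open Classical in if v ∈ γ.1.V then min (γ.2 v).1 n + 1 else 0

theorem partKey_le (γ : PartConf P n) (v : Fin n) : partKey γ v ≤ n + 1 := by
  unfold partKey
  split_ifs <;> omega

/-- The clamp in `partKey` sends all choices from `n` on to the key `n + 1`, which is no key of a
part with number below `n`. -/
theorem partKey_eq {γ : PartConf P n} {v : Fin n} {i : ℕ} (hi : i < n) :
    partKey γ v = i + 1 ↔ v ∈ part γ.1.V γ.assign i := by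
  rw [mem_part]
  unfold partKey PartConf.assign
  split_ifs with h
  · simp only [h, true_and]
    omega
  · simp [h]

/-- The two ends of an arc belong to the same part. -/
def IsActive (γ : PartConf P n) (a : Fin n × Fin n) : Prop :=
  partKey γ a.1 = partKey γ a.2 ∧ partKey γ a.1 ≠ 0

theorem isActive_iff {γ : PartConf P n} {a : Fin n × Fin n} {i : ℕ} (hi : i < n)
    (h : partKey γ a.1 = i + 1) : IsActive γ a ↔ a.2 ∈ part γ.1.V γ.assign i := by
  rw [IsActive, h, ← partKey_eq hi, eq_comm]
  simp

/-- The fields of an arc after the draw of the partition. -/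
def assignFields (γ : PartConf P n) (a : Fin n × Fin n) : List ℕ :=
  baseFields γ.1 a ++ [if arcIndex partInst γ a = 0 then partCode n (γ.2 a.1) else 0]

/-- The fields of an arc that describe its part. -/
def partFields (γ : PartConf P n) (a : Fin n × Fin n) : List ℕ :=
  assignFields γ a ++ [partCode n (γ.2 a.1)] ++ [partKey γ a.2] ++
    [groupTotal (fun γ => (partInst γ).lay) (fun γ a => partKey γ a.1)
      (fun γ a => bit (IsActive γ a)) γ a] ++
    [groupPrefix (fun γ => (partInst γ).lay) (fun γ a => partKey γ a.1)
      (fun γ a => bit (IsActive γ a)) arcId γ a] ++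
    [srcSum partInst (fun γ a => bit (IsActive γ a)) γ a.1]

theorem small_assignFields (hP : LargeFor P n) :
    FieldsSmall (fun γ : PartConf P n => γ.1.inst.lay) 4 assignFields := by
  refine fieldsSmall_append (inst := partInst)
    (fun γ a ha => small_baseFields hP γ.1 a ha) fun γ a _ => val_lt hP ?_ a
  split_ifs
  · exact partCode_le _
  · omega

theorem impl_assign (hP : LargeFor P n) (c : ℝ) :
    Impl P.cap P.W 1 (arcView Conf.inst baseFields) (arcView partInst assignFields)
      fun γ : Conf P n => (indep n (partLaw γ.inst.G m c)).map fun o => (γ, o) := by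
  classical
  refine impl_draw (lay := fun γ : Conf P n => γ.inst.lay) arcId_injective (arc_lt_I hP)
    (fun γ => partLaw γ.inst.G m c) (0, false)
    (fun γ a => if arcIndex Conf.inst γ a = 0 then some a.1 else none) ?_ ?_ ?_ ?_ ?_ ?_
  · intro γ γ' a _ _ h
    simp only [(baseFields_eq h).1]
  · intro γ s a ha b hb h1 h2
    simp only [Option.ite_none_right_eq_some, Option.some.injEq] at h1 h2
    obtain ⟨u, v⟩ := a
    obtain ⟨u', v'⟩ := b
    obtain ⟨h1, rfl⟩ := h1
    obtain ⟨h2, h3⟩ := h2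
    obtain rfl : u' = u := h3
    rw [γ.inst.mem_arcs] at ha hb
    exact Prod.ext rfl (eq_of_arcIndex_eq_zero (inst := Conf.inst) (γ := γ) ha hb h1 h2)
  · intro γ γ' a s ha ha' h hs
    simp only [Option.ite_none_right_eq_some, Option.some.injEq] at hs
    obtain ⟨-, rfl⟩ := hs
    rw [γ.inst.mem_arcs] at ha
    rw [γ'.inst.mem_arcs] at ha'
    rw [partLaw, partLaw, if_pos ⟨_, ha⟩, if_pos ⟨_, ha'⟩]
  · intro γ s hs
    rw [partLaw, if_neg]
    rintro ⟨w, hw⟩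
    obtain ⟨x, hx, hx0⟩ := exists_arcIndex_eq_zero (inst := Conf.inst) (γ := γ) hw
    exact hs (s, x) ((γ.inst.mem_arcs _).2 hx) (if_pos hx0)
  · intro γ γ' a o o' ha ha' h hs
    have hx : arcIndex partInst (γ, o) a = arcIndex partInst (γ', o') a := (baseFields_eq h).1
    have h0 : arcIndex partInst (γ, o) a = arcIndex Conf.inst γ a := rfl
    simp only [assignFields, h, ← hx]
    split_ifs with h1
    · rw [hs a.1 (if_pos (h0 ▸ h1))]
    · rfl
  · exact fun γ a ha => (small_assignFields hP γ a ha).mono (by omega)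

/-- The rounds needed to compute the fields that describe the parts. -/
def Params.partRounds (P : Params) : ℕ :=
  P.totalRounds + (P.totalRounds + 1 + (P.totalRounds + (P.scanRounds + P.totalRounds)))

theorem partKey_congr {γ γ' : PartConf P n} {v : Fin n}
    (h : partCode n (γ.2 v) = partCode n (γ'.2 v)) (hV : v ∈ γ.1.V ↔ v ∈ γ'.1.V) :
    partKey γ v = partKey γ' v := by
  simp only [partKey, hV, (partCode_eq h).1]

/-- The group total counts the arcs inside the part, for the test against `8 * S`. The group prefix
will be the index of the arc when the part is gathered. The sum over the source tells whether the
source is isolated in its part. -/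
theorem impl_parts (hP : LargeFor P n) :
    Impl P.cap P.W P.partRounds (arcView partInst assignFields) (arcView partInst partFields)
      (PMF.pure (α := PartConf P n)) ∧
    FieldsSmall (fun γ : PartConf P n => γ.1.inst.lay) 9 partFields := by
  classical
  have hN : ∀ (a : Fin n × Fin n) {x : ℕ}, x ≤ 4 * n + 4 → x < P.N := fun a _ h => val_lt hP h a
  have hb : ∀ (Q : Prop), bit Q ≤ 4 * n + 4 := fun Q => (bit_le_one Q).trans (by omega)
  have hk : ∀ (γ : PartConf P n) v, partKey γ v ≤ 4 * n + 4 := fun γ v =>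
    (partKey_le γ v).trans (by omega)
  have hG : ∀ (γ : PartConf P n), ∀ a ∈ γ.1.inst.lay.A, partKey γ a.1 < P.G := by
    intro γ a ha
    refine lt_of_le_of_lt (partKey_le γ _) (lt_of_le_of_lt ?_ hP.lt_G)
    have hadj := (γ.1.inst.mem_arcs a).1 ha
    have : 2 ≤ n := by
      have h1 := a.1.2
      have h2 := a.2.2
      have h3 := Fin.val_ne_iff.2 hadj.ne
      omega
    nlinarith
  have s0 := small_assignFields (P := P) (n := n) hP
  have s1 := fieldsSmall_append (inst := partInst) s0
    (val := fun γ a => partCode n (γ.2 a.1)) fun γ a _ => hN a (partCode_le _)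
  have s2 := fieldsSmall_append (inst := partInst) s1
    (val := fun γ a => partKey γ a.2) fun γ a _ => hN a (hk _ _)
  have hsum : ∀ γ : PartConf P n, ∑ a ∈ γ.1.inst.lay.A, bit (IsActive γ a) < P.N := fun γ =>
    sum_arcs_lt hP _ fun _ => hb _
  have s3 := fieldsSmall_append (inst := partInst) s2
    (val := fun γ a => groupTotal (fun γ => (partInst γ).lay) (fun γ a => partKey γ a.1)
      (fun γ a => bit (IsActive γ a)) γ a) fun γ a _ => groupTotal_le.trans_lt (hsum γ)
  have s4 := fieldsSmall_append (inst := partInst) s3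
    (val := fun γ a => groupPrefix (fun γ => (partInst γ).lay) (fun γ a => partKey γ a.1)
      (fun γ a => bit (IsActive γ a)) arcId γ a) fun γ a _ => groupPrefix_le.trans_lt (hsum γ)
  have s5 : FieldsSmall (fun γ : PartConf P n => γ.1.inst.lay) 9 partFields :=
    fieldsSmall_append (inst := partInst) s4 fun γ a _ =>
      srcSum_lt (val := fun γ a => bit (IsActive γ a)) hP (fun _ _ => hb _) γ a
  refine ⟨?_, s5⟩
  have o1 := impl_srcSum (inst := partInst) hP (by omega) s0
    (val := fun γ a => if arcIndex partInst γ a = 0 then partCode n (γ.2 a.1) else 0)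
    (fun γ γ' a _ _ h => (append_singleton_eq h).2)
    (fun γ a => by
      split_ifs
      · exact partCode_le _
      · omega)
  have e1 := homeMem_congr (inst := partInst (P := P) (n := n))
    (F := fun γ a => assignFields γ a ++ [srcSum partInst (fun γ a =>
      if arcIndex partInst γ a = 0 then partCode n (γ.2 a.1) else 0) γ a.1])
    (F' := fun γ a => assignFields γ a ++ [partCode n (γ.2 a.1)]) fun γ a ha => by
      rw [srcSum_first (inst := partInst) ((γ.1.inst.mem_arcs a).1 ha)
        fun γ u => partCode n (γ.2 u)]
  rw [arcView, arcView, e1] at o1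
  have l1 : FieldLocal (fun γ : PartConf P n => γ.1.inst.lay)
      (fun γ a => assignFields γ a ++ [partCode n (γ.2 a.1)]) fun γ a => partKey γ a.1 := by
    intro γ γ' a _ _ h
    obtain ⟨h, h1⟩ := append_singleton_eq h
    exact partKey_congr h1 (baseFields_eq (append_singleton_eq h).1).2.1
  have o2 := impl_twin (inst := partInst) hP (by omega) s1 l1 fun _ _ => hk _ _
  have l2 : FieldLocal (fun γ : PartConf P n => γ.1.inst.lay)
      (fun γ a => assignFields γ a ++ [partCode n (γ.2 a.1)] ++ [partKey γ a.2])
      fun γ a => partKey γ a.1 := fun γ γ' a ha ha' h =>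
    l1 γ γ' a ha ha' (append_singleton_eq h).1
  have l2' : FieldLocal (fun γ : PartConf P n => γ.1.inst.lay)
      (fun γ a => assignFields γ a ++ [partCode n (γ.2 a.1)] ++ [partKey γ a.2])
      fun γ a => bit (IsActive γ a) := fun γ γ' a ha ha' h => by
    simp only [IsActive, l2 γ γ' a ha ha' h, (append_singleton_eq h).2]
  have o3 := impl_total (lay := fun γ : PartConf P n => (partInst γ).lay) arcId_injective
    (arc_lt_I hP) (by omega) s2 (grp := fun γ a => partKey γ a.1) l2 l2' hG hsum
  have o4 := impl_scan (lay := fun γ : PartConf P n => (partInst γ).lay) arcId_injective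
    (arc_lt_I hP) (arc_lt_I hP) arcId_injective (by omega) s3
    (grp := fun γ a => partKey γ a.1)
    (fun γ γ' a ha ha' h => l2 γ γ' a ha ha' (append_singleton_eq h).1)
    (fun γ γ' a ha ha' h => l2' γ γ' a ha ha' (append_singleton_eq h).1) hG hsum
  have o5 := impl_srcSum (inst := partInst) hP (by omega) s4
    (val := fun γ a => bit (IsActive γ a))
    (fun γ γ' a ha ha' h => l2' γ γ' a ha ha' (append_singleton_eq (append_singleton_eq h).1).1)
    fun _ _ => hb _
  exact o1.comp_pure (o2.comp_pure (o3.comp_pure (o4.comp_pure o5)))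

/-- What the fields of an arc say about its part. -/
theorem partFields_eq {γ γ' : PartConf P n} {a : Fin n × Fin n}
    (h : partFields γ a = partFields γ' a) :
    baseFields γ.1 a = baseFields γ'.1 a ∧ (γ.2 a.1).2 = (γ'.2 a.1).2 ∧
      partKey γ a.1 = partKey γ' a.1 ∧ partKey γ a.2 = partKey γ' a.2 ∧
      groupTotal (fun γ => (partInst γ).lay) (fun γ a => partKey γ a.1)
        (fun γ a => bit (IsActive γ a)) γ a = groupTotal (fun γ => (partInst γ).lay)
        (fun γ a => partKey γ a.1) (fun γ a => bit (IsActive γ a)) γ' a ∧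
      groupPrefix (fun γ => (partInst γ).lay) (fun γ a => partKey γ a.1)
        (fun γ a => bit (IsActive γ a)) arcId γ a = groupPrefix (fun γ => (partInst γ).lay)
        (fun γ a => partKey γ a.1) (fun γ a => bit (IsActive γ a)) arcId γ' a ∧
      srcSum partInst (fun γ a => bit (IsActive γ a)) γ a.1
        = srcSum partInst (fun γ a => bit (IsActive γ a)) γ' a.1 := by
  obtain ⟨h, h1⟩ := append_singleton_eq h
  obtain ⟨h, h2⟩ := append_singleton_eq h
  obtain ⟨h, h3⟩ := append_singleton_eq h
  obtain ⟨h, h4⟩ := append_singleton_eq h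
  obtain ⟨h, h5⟩ := append_singleton_eq h
  have h6 := (append_singleton_eq h).1
  exact ⟨h6, (partCode_eq h5).2, partKey_congr h5 (baseFields_eq h6).2.1, h4, h3, h2, h1⟩

/-- The active arcs of a group are the arcs inside the part, two per edge. -/
theorem groupTotal_active {γ : PartConf P n} {a : Fin n × Fin n} {i : ℕ} (hi : i < n)
    (h : partKey γ a.1 = i + 1) :
    groupTotal (fun γ => (partInst γ).lay) (fun γ a => partKey γ a.1)
        (fun γ a => bit (IsActive γ a)) γ a
      = 2 * (inducedOn γ.1.inst.G (part γ.1.V γ.assign i)).edgeSet.ncard := by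
  classical
  rw [← card_arcs_inducedOn γ.1.inst.lay.A γ.1.inst.mem_arcs, groupTotal, h,
    ← card_filter_eq_sum_bit, Finset.filter_filter]
  congr 1
  refine Finset.filter_congr fun b _ => ?_
  rw [← partKey_eq hi]
  exact and_congr_right fun hb => isActive_iff hi hb

/-- An arc can thus decide whether its part is kept: `8 * S` edges are `16 * S` arcs. -/
theorem mem_keptPart_iff {γ : PartConf P n} {a : Fin n × Fin n} {i : ℕ} (hi : i < n) :
    a.1 ∈ keptPart γ.1.inst.G S γ.1.V γ.assign i ↔ partKey γ a.1 = i + 1 ∧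
      groupTotal (fun γ => (partInst γ).lay) (fun γ a => partKey γ a.1)
        (fun γ a => bit (IsActive γ a)) γ a ≤ 16 * S := by
  rw [mem_keptPart, ← and_assoc, ← mem_part, ← partKey_eq hi]
  refine and_congr_right fun h => ?_
  rw [groupTotal_active hi h]
  omega

/-- The part that an arc belongs to. -/
abbrev confSlot (γ : PartConf P n) (a : Fin n × Fin n) : Option (Fin m) :=
  arcSlot γ.1.inst.G S γ.1.V γ.assign m a

theorem confSlot_eq_some (hm : m ≤ n) {γ : PartConf P n} {a : Fin n × Fin n} {i : Fin m} :
    confSlot S m γ a = some i ↔ partKey γ a.1 = i + 1 ∧ partKey γ a.2 = i + 1 ∧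
      groupTotal (fun γ => (partInst γ).lay) (fun γ a => partKey γ a.1)
        (fun γ a => bit (IsActive γ a)) γ a ≤ 16 * S := by
  have hi := i.2.trans_le hm
  rw [confSlot, arcSlot_eq_some]
  constructor
  · rintro ⟨h1, h2⟩
    rw [keptPart_eq_part h1, ← partKey_eq hi] at h2
    exact ⟨((mem_keptPart_iff S hi).1 h1).1, h2, ((mem_keptPart_iff S hi).1 h1).2⟩
  · rintro ⟨h1, h2, h3⟩
    have h1 := (mem_keptPart_iff S hi).2 ⟨h1, h3⟩
    exact ⟨h1, by rwa [keptPart_eq_part h1, ← partKey_eq hi]⟩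

/-- The number of the group of an arc. -/
def slotGroup (γ : PartConf P n) (a : Fin n × Fin n) : ℕ :=
  match confSlot S m γ a with
  | some i => i + 1
  | none => 0

theorem slotGroup_eq {γ : PartConf P n} {a : Fin n × Fin n} {i : Fin m} :
    slotGroup S m γ a = i + 1 ↔ confSlot S m γ a = some i := by
  unfold slotGroup
  split
  next j h => simp [h, Fin.ext_iff]
  next h => simp [h]

theorem slotGroup_ne_zero {γ : PartConf P n} {a : Fin n × Fin n} (h : slotGroup S m γ a ≠ 0) :
    ∃ i, confSlot S m γ a = some i := by
  unfold slotGroup at h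
  split at h
  next j h' => exact ⟨j, h'⟩
  next h' => exact absurd rfl h

theorem slotGroup_le (γ : PartConf P n) (a : Fin n × Fin n) : slotGroup S m γ a ≤ m := by
  unfold slotGroup
  split
  next j h' => exact j.2
  next h' => exact Nat.zero_le _

theorem confSlot_local (hm : m ≤ n) :
    FieldLocal (fun γ : PartConf P n => γ.1.inst.lay) partFields (confSlot S m) := by
  intro γ γ' a _ _ h
  obtain ⟨-, -, h1, h2, h3, -⟩ := partFields_eq h
  refine Option.ext fun i => ?_
  rw [confSlot_eq_some S m hm, confSlot_eq_some S m hm, h1, h2, h3]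

theorem slotGroup_local (hm : m ≤ n) :
    FieldLocal (fun γ : PartConf P n => γ.1.inst.lay) partFields (slotGroup S m) := by
  intro γ γ' a ha ha' h
  rw [slotGroup, slotGroup, confSlot_local S m hm γ γ' a ha ha' h]

/-- In a kept part the arcs of the slot are exactly the active ones, so their index was already
computed as a prefix sum. Gathering needs this number, and obtaining it costs no further rounds. -/
theorem groupIndex_slot (hm : m ≤ n) {γ : PartConf P n} {a : Fin n × Fin n} {i : Fin m}
    (h : confSlot S m γ a = some i) :
    groupIndex arcId (fun γ => (partInst γ).lay) (slotGroup S m) γ a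
      = groupPrefix (fun γ => (partInst γ).lay) (fun γ a => partKey γ a.1)
        (fun γ a => bit (IsActive γ a)) arcId γ a := by
  classical
  have hi := i.2.trans_le hm
  have h1 := (confSlot_eq_some S m hm).1 h
  have h2 := (mem_keptPart_iff (a := a) S hi).2 ⟨h1.1, h1.2.2⟩
  rw [groupIndex, groupPrefix, ← card_filter_eq_sum_bit, Finset.filter_filter,
    (slotGroup_eq S m).2 h, h1.1]
  congr 1
  refine Finset.filter_congr fun b _ => ?_
  rw [slotGroup_eq, confSlot, arcSlot_eq_some, keptPart_eq_part h2, ← partKey_eq hi]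
  constructor
  · rintro ⟨⟨h3, h4⟩, h5⟩
    exact ⟨⟨h3, h5⟩, (isActive_iff hi h3).2 h4⟩
  · rintro ⟨⟨h3, h5⟩, h4⟩
    exact ⟨⟨h3, (isActive_iff hi h3).1 h4⟩, h5⟩

/-- A kept part has at most `8 * S` edges, whatever the partition is. This is why the space bound
holds surely and not only with high probability. -/
theorem card_slotGroup_le (γ : PartConf P n) {g : ℕ} (hg : g ≠ 0) :
    (γ.1.inst.lay.A.filter fun a => slotGroup S m γ a = g).card ≤ 16 * S := by
  classical
  rcases Finset.eq_empty_or_nonempty (γ.1.inst.lay.A.filter fun a => slotGroup S m γ a = g)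
    with h | ⟨a, ha⟩
  · simp [h]
  · obtain ⟨-, ha⟩ := Finset.mem_filter.1 ha
    obtain ⟨i, hi⟩ := slotGroup_ne_zero S m (a := a) (γ := γ) (by omega)
    obtain rfl : (i : ℕ) + 1 = g := ha ▸ ((slotGroup_eq S m).2 hi).symm
    have h1 := (arcSlot_eq_some.1 hi).1
    have h2 := (mem_keptPart.1 h1).2.2
    simp only [slotGroup_eq, confSlot, arcSlot_eq_some, keptPart_eq_part h1]
    rw [card_arcs_inducedOn _ γ.1.inst.mem_arcs]
    omega

end Program

/-! ## The emulated phases -/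

section LocalPhases

variable {n : ℕ} {mm : SimpleGraph (Fin n) → Finset (Sym2 (Fin n))}

theorem mem_localPhase (hmm : IsMaximalMatchingRule mm) (G : SimpleGraph (Fin n)) {s s' : State n}
    (h : s' ∈ (localPhase mm G s).support) :
    s'.2.1 ⊆ s.2.1 ∧ ∀ e ∈ s'.2.2, e ∈ s.2.2 ∨ e ∈ G.edgeSet := by
  classical
  obtain ⟨δ, U, M⟩ := s
  simp only [localPhase, PMF.mem_support_bind_iff, PMF.mem_support_map_iff] at h
  obtain ⟨R, -, H, -, F, -, rfl⟩ := h
  refine ⟨Finset.sdiff_subset, fun e he => ?_⟩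
  rcases Finset.mem_union.1 he with he | he
  · exact Or.inl he
  · have h1 := (hmm (inducedOn G (H ∪ F))).1.1 e he
    refine Or.inr ?_
    induction e with
    | h u v => exact h1.1

theorem mem_iterate_localPhase (hmm : IsMaximalMatchingRule mm) (G : SimpleGraph (Fin n)) :
    ∀ (k : ℕ) {s s' : State n}, s' ∈ (iterate (localPhase mm G) k s).support →
      s'.2.1 ⊆ s.2.1 ∧ ∀ e ∈ s'.2.2, e ∈ s.2.2 ∨ e ∈ G.edgeSet
  | 0, s, s', h => by
      rw [iterate, PMF.mem_support_pure_iff] at h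
      subst h
      exact ⟨subset_rfl, fun e he => Or.inl he⟩
  | k + 1, s, s', h => by
      rw [iterate, PMF.mem_support_bind_iff] at h
      obtain ⟨t, ht, hs⟩ := h
      obtain ⟨h1, h2⟩ := mem_localPhase hmm G ht
      obtain ⟨h3, h4⟩ := mem_iterate_localPhase hmm G k hs
      refine ⟨h3.trans h1, fun e he => ?_⟩
      rcases h4 e he with h | h
      · exact h2 e h
      · exact Or.inr h

/-- The outcome of the emulation of phases: the surviving vertices and the matching. -/
abbrev PhaseOutcome (n : ℕ) : Type := Finset (Fin n) × Finset (Sym2 (Fin n))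

/-- The law of the outcome for the non-isolated vertices of a part. -/
def phaseLaw (mm : SimpleGraph (Fin n) → Finset (Sym2 (Fin n))) (G : SimpleGraph (Fin n)) (S : ℕ)
    (V : Finset (Fin n)) (φ : Fin n → ℕ) (τ : ℕ) (δ : ℝ) (i : ℕ) : PMF (PhaseOutcome n) :=
  (iterate (localPhase mm (partGraph G S V φ i)) τ (δ, partCore G S V φ i, ∅)).map Prod.snd

variable {G : SimpleGraph (Fin n)} {S : ℕ} {V : Finset (Fin n)} {φ : Fin n → ℕ} {τ : ℕ} {δ : ℝ}
  {i : ℕ}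

theorem mem_phaseLaw (hmm : IsMaximalMatchingRule mm) {o : PhaseOutcome n}
    (h : o ∈ (phaseLaw mm G S V φ τ δ i).support) :
    o.1 ⊆ partCore G S V φ i ∧ ∀ e ∈ o.2, e ∈ (partGraph G S V φ i).edgeSet := by
  rw [phaseLaw, PMF.mem_support_map_iff] at h
  obtain ⟨s, hs, rfl⟩ := h
  obtain ⟨h1, h2⟩ := mem_iterate_localPhase hmm _ _ hs
  exact ⟨h1, fun e he => (h2 e he).resolve_left (by simp)⟩

theorem partGraph_adj {u v : Fin n} : (partGraph G S V φ i).Adj u v ↔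
    G.Adj u v ∧ u ∈ keptPart G S V φ i ∧ v ∈ keptPart G S V φ i := Iff.rfl

/-- The core is empty, and only edges of the part graph can be matched. This covers the slots for
which no machine is responsible. -/
theorem phaseLaw_of_no_arcs (hmm : IsMaximalMatchingRule mm)
    (h : ∀ u v, ¬ (partGraph G S V φ i).Adj u v) :
    phaseLaw mm G S V φ τ δ i = PMF.pure (∅, ∅) := by
  rw [phaseLaw]
  refine map_eq_pure_of_support fun s hs => ?_
  obtain ⟨h1, h2⟩ := mem_phaseLaw hmm ((PMF.mem_support_map_iff _ _ _).2 ⟨s, hs, rfl⟩)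
  refine Prod.ext (Finset.subset_empty.1 fun v hv => ?_) (Finset.eq_empty_of_forall_notMem
    fun e he => ?_)
  · obtain ⟨h3, w, h4, h5⟩ := mem_partCore.1 (h1 hv)
    exact absurd ⟨h4, h3, h5⟩ (h v w)
  · have := h2 e he
    induction e with
    | h u v => exact h u v this

/-- The vertices with neighbours can be recovered from the edges, so the gathered arcs of a part
determine the law of the emulation. -/
theorem phaseLaw_congr {G' : SimpleGraph (Fin n)} {V' : Finset (Fin n)} {φ' : Fin n → ℕ}
    (h : partGraph G S V φ i = partGraph G' S V' φ' i) :
    phaseLaw mm G S V φ τ δ i = phaseLaw mm G' S V' φ' τ δ i := by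
  have hc : partCore G S V φ i = partCore G' S V' φ' i := by
    ext v
    have h1 : ∀ w, (partGraph G S V φ i).Adj v w ↔ (partGraph G' S V' φ' i).Adj v w := by
      simp [h]
    simp only [partGraph_adj] at h1
    rw [mem_partCore, mem_partCore]
    constructor
    · rintro ⟨h2, w, h3, h4⟩
      obtain ⟨h5, h6, h7⟩ := (h1 w).1 ⟨h3, h2, h4⟩
      exact ⟨h6, w, h5, h7⟩
    · rintro ⟨h2, w, h3, h4⟩
      obtain ⟨h5, h6, h7⟩ := (h1 w).2 ⟨h3, h2, h4⟩
      exact ⟨h6, w, h5, h7⟩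
  rw [phaseLaw, phaseLaw, h, hc]

end LocalPhases

/-! ### Emulation on gathered parts and collection of the outcomes. -/

section Program

variable {P : Params} {n : ℕ} (S m : ℕ)

/-- A state with a partition and the outcomes on its parts. -/
abbrev OutcomeConf (P : Params) (n m : ℕ) : Type := PartConf P n × (Fin m → PhaseOutcome n)

/-- The instance of a state with outcomes. -/
abbrev outcomeInst (γ : OutcomeConf P n m) : Inst P n := γ.1.1.inst

/-- The answer to an arc: whether its source survives, and whether it is in the matching. -/
def reply (γ : OutcomeConf P n m) (a : Fin n × Fin n) : ℕ :=
  match confSlot S m γ.1 a with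
  | some i => 2 * bit (a.1 ∈ (γ.2 i).1) + bit (s(a.1, a.2) ∈ (γ.2 i).2)
  | none => 0

theorem reply_le (γ : OutcomeConf P n m) (a : Fin n × Fin n) : reply S m γ a ≤ 3 := by
  unfold reply
  split
  next i h =>
    have := bit_le_one (a.1 ∈ (γ.2 i).1)
    have := bit_le_one (s(a.1, a.2) ∈ (γ.2 i).2)
    omega
  next h => omega

theorem reply_div_pos {γ : OutcomeConf P n m} {a : Fin n × Fin n} :
    0 < reply S m γ a / 2 ↔ ∃ i, confSlot S m γ.1 a = some i ∧ a.1 ∈ (γ.2 i).1 := by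
  unfold reply
  split
  next i h =>
    have h1 := bit_le_one (s(a.1, a.2) ∈ (γ.2 i).2)
    have h2 : (2 * bit (a.1 ∈ (γ.2 i).1) + bit (s(a.1, a.2) ∈ (γ.2 i).2)) / 2
        = bit (a.1 ∈ (γ.2 i).1) := by omega
    rw [h2, bit_pos, h]
    simp
  next h => simp [h]

theorem reply_mod {γ : OutcomeConf P n m} {a : Fin n × Fin n} :
    reply S m γ a % 2 = 1 ↔ ∃ i, confSlot S m γ.1 a = some i ∧ s(a.1, a.2) ∈ (γ.2 i).2 := by
  unfold reply
  split
  next i h =>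
    have h1 := bit_le_one (s(a.1, a.2) ∈ (γ.2 i).2)
    have h2 : (2 * bit (a.1 ∈ (γ.2 i).1) + bit (s(a.1, a.2) ∈ (γ.2 i).2)) % 2
        = bit (s(a.1, a.2) ∈ (γ.2 i).2) := by omega
    rw [h2, bit_eq_one, h]
    simp
  next h => simp [h]

/-- The state after an iteration. -/
def nextConf (γ : OutcomeConf P n m) : Conf P n where
  inst := γ.1.1.inst
  V := (Finset.univ.biUnion fun i : Fin m =>
      (γ.2 i).1 ∩ partCore γ.1.1.inst.G S γ.1.1.V γ.1.assign i) ∪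
    Finset.univ.biUnion fun i : Fin m => (keptPart γ.1.1.inst.G S γ.1.1.V γ.1.assign i \
      partCore γ.1.1.inst.G S γ.1.1.V γ.1.assign i).filter fun v => (γ.1.2 v).2 = true
  M := open Classical in γ.1.1.M ∪ Finset.univ.biUnion fun i : Fin m =>
    (γ.2 i).2.filter fun e => e ∈ (partGraph γ.1.1.inst.G S γ.1.1.V γ.1.assign i).edgeSet

theorem mem_nextConf_M {γ : OutcomeConf P n m} {a : Fin n × Fin n}
    (ha : a ∈ γ.1.1.inst.lay.A) :
    s(a.1, a.2) ∈ (nextConf S m γ).M ↔ s(a.1, a.2) ∈ γ.1.1.M ∨ reply S m γ a % 2 = 1 := by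
  rw [γ.1.1.inst.mem_arcs] at ha
  simp only [nextConf, reply_mod, Finset.mem_union, Finset.mem_biUnion, Finset.mem_univ, true_and,
    Finset.mem_filter, SimpleGraph.mem_edgeSet, partGraph_adj, confSlot, arcSlot_eq_some, ha]
  simp only [and_comm]

/-- A vertex of a core has an arc inside its part, and the replies to these arcs report its
survival; a sum over its arcs spreads the news. Any other vertex of a kept part has no active arc
and relies on the coin drawn with its part. -/
theorem mem_nextConf_V (hm : m ≤ n) {γ : OutcomeConf P n m} {a : Fin n × Fin n} :
    a.1 ∈ (nextConf S m γ).V ↔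
      0 < srcSum (outcomeInst m) (fun γ a => reply S m γ a / 2) γ a.1 ∨
      (γ.1.2 a.1).2 = true ∧ (∃ i : Fin m, partKey γ.1 a.1 = i + 1) ∧
        groupTotal (fun γ => (partInst γ).lay) (fun γ a => partKey γ a.1)
          (fun γ a => bit (IsActive γ a)) γ.1 a ≤ 16 * S ∧
        srcSum partInst (fun γ a => bit (IsActive γ a)) γ.1 a.1 = 0 := by
  classical
  simp only [nextConf, Finset.mem_union, Finset.mem_biUnion, Finset.mem_univ, true_and,
    Finset.mem_filter, Finset.mem_inter, Finset.mem_sdiff]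
  refine or_congr ?_ ?_
  · rw [Nat.pos_iff_ne_zero, srcSum, ne_eq, Finset.sum_eq_zero_iff]
    simp only [mem_nbrs, Finset.mem_univ, true_and, not_forall, ← ne_eq, ← Nat.pos_iff_ne_zero,
      reply_div_pos, confSlot, arcSlot_eq_some, mem_partCore, exists_prop]
    constructor
    · rintro ⟨i, h1, h2, w, h3, h4⟩
      exact ⟨w, h3, i, ⟨h2, h4⟩, h1⟩
    · rintro ⟨w, h3, i, ⟨h2, h4⟩, h1⟩
      exact ⟨i, h1, h2, w, h3, h4⟩
  · have key : ∀ i : Fin m, a.1 ∈ keptPart γ.1.1.inst.G S γ.1.1.V γ.1.assign i →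
        (a.1 ∉ partCore γ.1.1.inst.G S γ.1.1.V γ.1.assign i ↔
          srcSum partInst (fun γ a => bit (IsActive γ a)) γ.1 a.1 = 0) := by
      intro i h
      have hi := i.2.trans_le hm
      have hk := ((mem_keptPart_iff S hi).1 h).1
      rw [mem_partCore, srcSum, Finset.sum_eq_zero_iff]
      simp only [h, true_and, not_exists, not_and, mem_nbrs, Finset.mem_univ]
      refine forall_congr' fun w => forall_congr' fun _ => ?_
      rw [keptPart_eq_part h, ← isActive_iff (a := (a.1, w)) hi hk]
      exact ⟨bit_not, fun h0 hc => absurd (h0.symm.trans (bit_of hc)) zero_ne_one⟩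
    constructor
    · rintro ⟨i, ⟨h1, h2⟩, h3⟩
      obtain ⟨h4, h5⟩ := (mem_keptPart_iff S (i.2.trans_le hm)).1 h1
      exact ⟨h3, ⟨i, h4⟩, h5, (key i h1).1 h2⟩
    · rintro ⟨h3, ⟨i, h4⟩, h5, h6⟩
      have h1 := (mem_keptPart_iff S (i.2.trans_le hm)).2 ⟨h4, h5⟩
      exact ⟨i, ⟨h1, (key i h1).2 h6⟩, h3⟩

variable {mm : SimpleGraph (Fin n) → Finset (Sym2 (Fin n))}

/-- The fields of an arc after the emulation of phases. -/
def outcomeFields (γ : OutcomeConf P n m) (a : Fin n × Fin n) : List ℕ :=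
  partFields γ.1 a ++ [reply S m γ a]

/-- Local computation is free, so the machine that has gathered a part runs all `τ` phases in one
round. -/
theorem impl_emulate (hP : LargeFor P n) (hm : m ≤ n) (hS : 16 * S ≤ P.Kg)
    (hmm : IsMaximalMatchingRule mm) (τ : ℕ) (δ : ℝ) :
    Impl P.cap P.W P.gatherRounds (arcView partInst partFields)
      (arcView (outcomeInst m) (outcomeFields S m))
      fun γ : PartConf P n =>
        (indep m fun i => phaseLaw mm γ.1.inst.G S γ.1.V γ.assign τ δ i).map fun o => (γ, o) := by
  classical
  have hedge : ∀ (γ : PartConf P n) (i : Fin m) u v,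
      (partGraph γ.1.inst.G S γ.1.V γ.assign i).Adj u v ↔
        (u, v) ∈ γ.1.inst.lay.A ∧ confSlot S m γ (u, v) = some i := by
    intro γ i u v
    rw [partGraph_adj, γ.1.inst.mem_arcs, confSlot, arcSlot_eq_some]
  have hr : ∀ (γ : OutcomeConf P n m) (a : Fin n × Fin n), reply S m γ a < P.N := fun γ a =>
    val_lt hP ((reply_le S m γ a).trans (by omega)) a
  refine impl_gather (lay := fun γ : PartConf P n => γ.1.inst.lay) arcId_injective (arc_lt_I hP)
    (fun γ i => phaseLaw mm γ.1.inst.G S γ.1.V γ.assign τ δ i) (∅, ∅) (confSlot S m)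
    (k := 9) (by omega) (impl_parts hP).2 (reply S m) (slotGroup_local S m hm) ?_ ?_ ?_
    (confSlot_local S m hm) ?_ ?_ ?_ ?_ hr
  · intro γ a ha
    refine lt_of_le_of_lt ((slotGroup_le S m γ a).trans hm) (lt_of_le_of_lt ?_ hP.lt_G)
    exact Nat.le_mul_self n
  · intro γ γ' a ha ha' h
    have h1 := confSlot_local S m hm γ γ' a ha ha' h
    simp only [slotGroup_local S m hm γ γ' a ha ha' h]
    split_ifs with h0
    · rfl
    · obtain ⟨i, hi⟩ := slotGroup_ne_zero S m h0
      have h2 := groupIndex_slot S m hm hi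
      have h3 := groupIndex_slot S m hm (h1.trans hi)
      rw [h2, h3]
      exact (partFields_eq h).2.2.2.2.2.1
  · exact fun γ g hg => (card_slotGroup_le S m γ hg).trans hS
  · intro γ s a ha hs
    have h1 := (slotGroup_eq S m).2 hs
    exact ⟨by omega, fun b hb hbs => by rw [h1, (slotGroup_eq S m).2 hbs]⟩
  -- The arcs of a slot are the edges of the part graph, on which alone the law depends.
  · intro γ γ' i _ h _
    refine phaseLaw_congr ?_
    ext u v
    rw [hedge, hedge]
    exact h (u, v)
  · intro γ i h
    refine phaseLaw_of_no_arcs hmm fun u v huv => ?_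
    obtain ⟨h1, h2⟩ := (hedge γ i u v).1 huv
    exact h _ h1 h2
  · intro γ γ' a o o' ha ha' h hs
    have h1 := confSlot_local S m hm γ γ' a ha ha' h
    rcases hc : confSlot S m γ a with _ | i
    · simp only [reply, hc, h1.symm.trans hc]
    · simp only [reply, hc, h1.symm.trans hc, hs i hc]

/-- The number of rounds for an iteration of `ParallelAlg`. -/
def Params.parallelRounds (P : Params) : ℕ :=
  1 + (P.partRounds + (P.gatherRounds + (P.totalRounds + 1)))

theorem impl_collect (hP : LargeFor P n) (hm : m ≤ n) :
    Impl P.cap P.W (P.totalRounds + 1) (arcView (outcomeInst m) (outcomeFields S m))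
      (arcView (outcomeInst m) fun γ => baseFields (nextConf S m γ))
      (PMF.pure (α := OutcomeConf P n m)) := by
  have hr : ∀ (γ : OutcomeConf P n m) (a : Fin n × Fin n), reply S m γ a < P.N := fun γ a =>
    val_lt hP ((reply_le S m γ a).trans (by omega)) a
  have s1 := fieldsSmall_append (inst := outcomeInst m)
    (F := fun γ => partFields γ.1) (fun γ a ha => (impl_parts hP).2 γ.1 a ha)
    (val := reply S m) fun γ a _ => hr γ a
  have o1 := impl_srcSum (inst := outcomeInst m) hP (by omega) s1
    (val := fun γ a => reply S m γ a / 2)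
    (fun γ γ' a _ _ h => by simp only [(append_singleton_eq h).2])
    (fun γ a => by
      have := reply_le S m γ a
      omega)
  refine o1.comp_pure (impl_local arcId_injective (arc_lt_I hP) ?_ ?_)
  · intro γ γ' a ha ha' h
    obtain ⟨h, h1⟩ := append_singleton_eq h
    obtain ⟨h, h2⟩ := append_singleton_eq h
    obtain ⟨h3, h4, h5, -, h6, -, h7⟩ := partFields_eq h
    obtain ⟨h8, -, h9⟩ := baseFields_eq h3
    have e1 : arcIndex Conf.inst (nextConf S m γ) a = arcIndex Conf.inst (nextConf S m γ') a := h8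
    simp only [baseFields, e1, List.cons.injEq, true_and, and_true, bit_eq_bit]
    rw [mem_nextConf_V S m hm, mem_nextConf_V S m hm, mem_nextConf_M S m ha,
      mem_nextConf_M S m ha', h1, h2, h4, h5, h6, h7, h9]
    exact ⟨Iff.rfl, Iff.rfl⟩
  · exact fun γ a ha => (small_baseFields hP (nextConf S m γ) a ha).mono (by omega)

/-- The law of the state after an iteration, as the program computes it. -/
def parallelLaw (mm : SimpleGraph (Fin n) → Finset (Sym2 (Fin n))) (c : ℝ) (τ : ℕ) (δ : ℝ)
    (γ : Conf P n) : PMF (Conf P n) :=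
  (indep n (partLaw γ.inst.G m c)).bind fun o =>
    (indep m fun i => phaseLaw mm γ.inst.G S γ.V (fun v => (o v).1) τ δ i).map fun r =>
      nextConf S m ((γ, o), r)

/-- An iteration of `ParallelAlg` takes a bounded number of rounds. -/
theorem impl_parallelLaw (hP : LargeFor P n) (hm : m ≤ n) (hS : 16 * S ≤ P.Kg)
    (hmm : IsMaximalMatchingRule mm) (c : ℝ) (τ : ℕ) (δ : ℝ) :
    Impl P.cap P.W P.parallelRounds (arcView Conf.inst baseFields)
      (arcView (Γ := Conf P n) Conf.inst baseFields) (parallelLaw S m mm c τ δ) := by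
  have h := (impl_assign m hP c).comp ((impl_parts hP).1.comp_pure
    ((impl_emulate S m hP hm hS hmm τ δ).comp (impl_collect S m hP hm)))
  simp only [PMF.bind_pure, bind_map_eq] at h
  refine h.congr_law fun γ => ?_
  rw [parallelLaw, map_bind_eq, map_bind_eq]
  simp only [PMF.map_comp]
  rfl

/-- The vertices of degree less than `D` are kept. -/
def filterConf (D : ℝ) (γ : Conf P n) : Conf P n where
  inst := γ.inst
  V := open Classical in γ.V.filter fun v => ((nbrs γ.inst.G γ.V v).card : ℝ) < D
  M := γ.M

/-- The number of rounds to remove the vertices of high degree. -/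
def Params.filterRounds (P : Params) : ℕ := P.totalRounds + 1 + (P.totalRounds + 1)

theorem impl_filterConf (hP : LargeFor P n) (D : ℝ) :
    Impl P.cap P.W P.filterRounds (arcView Conf.inst baseFields)
      (arcView Conf.inst baseFields) fun γ : Conf P n => PMF.pure (filterConf D γ) := by
  classical
  have hb : ∀ (Q : Prop), bit Q ≤ 4 * n + 4 := fun Q => (bit_le_one Q).trans (by omega)
  have s0 := small_baseFields (P := P) (n := n) hP
  have s1 := fieldsSmall_append s0 (val := fun γ a => bit (a.2 ∈ γ.V))
    fun γ a _ => val_lt hP (hb _) a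
  have o1 := impl_twin hP (by omega) s0 (val := fun γ a => bit (a.1 ∈ γ.V))
    (fun γ γ' a _ _ h => by simp only [(baseFields_eq h).2.1]) fun _ _ => hb _
  have o2 := impl_srcSum hP (by omega) s1 (val := fun γ a => bit (a.2 ∈ γ.V))
    (fun γ γ' a _ _ h => (append_singleton_eq h).2) fun _ _ => hb _
  simp only [srcSum_mem] at o2
  have o3 := impl_local (lay := fun γ : Conf P n => γ.inst.lay) arcId_injective (arc_lt_I hP)
    (F := fun γ a => baseFields γ a ++ [bit (a.2 ∈ γ.V)] ++ [(nbrs γ.inst.G γ.V a.1).card])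
    (F' := fun γ => baseFields (filterConf D γ))
    (fun γ γ' a _ _ h => by
      obtain ⟨h, h1⟩ := append_singleton_eq h
      obtain ⟨h2, h3, h4⟩ := baseFields_eq (append_singleton_eq h).1
      have e1 : arcIndex Conf.inst (filterConf D γ) a = arcIndex Conf.inst (filterConf D γ') a := h2
      simp only [baseFields, e1, List.cons.injEq, true_and, and_true, bit_eq_bit]
      simp only [filterConf, Finset.mem_filter, h1, h3, h4, and_self])
    fun γ a ha => (small_baseFields hP (filterConf D γ) a ha).mono (by omega)
  refine (o1.comp_pure (o2.comp_pure o3)).congr_law fun γ => ?_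
  rw [PMF.pure_map, PMF.pure_map]
  rfl

end Program

/-! ## The law of an iteration of `ParallelAlg` -/

section Coins

theorem pmf_bool_ext {p q : PMF Bool} (h : p true = q true) : p = q := by
  have h1 : ∀ p : PMF Bool, p true + p false = 1 := fun p => by
    rw [← p.tsum_coe, tsum_fintype, Fintype.sum_bool]
  have h2 := (h1 p).trans (h1 q).symm
  rw [h] at h2
  ext b
  cases b
  · exact (ENNReal.add_right_inj (q.apply_ne_top _)).1 h2
  · exact h

theorem coin_true {p : ℝ} (hp : p ≤ 1) : coin p true = ENNReal.ofReal p := by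
  simp [coin, hp]

theorem coin_and {p q : ℝ} (hp : 0 ≤ p) (hp' : p ≤ 1) (hq : q ≤ 1) :
    ((coin p).bind fun a => if a = true then coin q else PMF.pure false) = coin (p * q) := by
  refine pmf_bool_ext ?_
  rw [PMF.bind_apply, tsum_fintype, Fintype.sum_bool, coin_true hp', coin_true (by nlinarith)]
  simp [coin_true hq, ENNReal.ofReal_mul hp]

theorem coin_not {p : ℝ} (hp : 0 ≤ p) (hp' : p ≤ 1) : (coin p).map (!·) = coin (1 - p) := by
  have h1 : coin p false = 1 - ENNReal.ofReal p := by simp [coin, hp']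
  refine pmf_bool_ext ?_
  rw [PMF.map_apply, tsum_fintype, Fintype.sum_bool, coin_true (p := 1 - p) (by linarith)]
  simp [h1, ENNReal.ofReal_sub 1 hp]

theorem coin_nor {p q : ℝ} (hp : 0 ≤ p) (hp' : p ≤ 1) (hq : 0 ≤ q) (hq' : q ≤ 1) :
    ((coin p).bind fun a => (coin q).map fun b => !(a || b)) = coin ((1 - p) * (1 - q)) := by
  rw [← coin_and (by linarith) (by linarith) (by linarith), ← coin_not hp hp', bind_map_eq,
    ← coin_not hq hq']
  refine congrArg _ (funext fun a => ?_)
  cases a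
  · simp
  · exact PMF.map_const (coin q) false

end Coins

/-! ### Random subsets by their indicators. -/

section RandomSubsets

variable {n : ℕ}

/-- The set with a given indicator. -/
def ofBits (b : Fin n → Bool) : Finset (Fin n) := Finset.univ.filter fun v => b v = true

theorem mem_ofBits {b : Fin n → Bool} {v : Fin n} : v ∈ ofBits b ↔ b v = true := by
  simp [ofBits]

/-- The law of the indicator of a random subset. -/
def bitLaw (U : Finset (Fin n)) (p : Fin n → ℝ) (v : Fin n) : PMF Bool :=
  if v ∈ U then coin (p v) else PMF.pure false

theorem randomSubset_eq (U : Finset (Fin n)) (p : Fin n → ℝ) :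
    randomSubset U p = (indep n (bitLaw U p)).map ofBits := by
  have h : bitLaw U p = fun v => (coin (p v)).map fun b => if v ∈ U then b else false := by
    funext v
    unfold bitLaw
    split_ifs
    · exact (PMF.map_id _).symm
    · exact (PMF.map_const _ _).symm
  rw [h, indep_map, PMF.map_comp, randomSubset]
  congr 1
  funext b
  ext v
  simp only [Function.comp_apply, mem_ofBits, Finset.mem_filter]
  split_ifs with hv <;> simp [hv]

theorem subset_of_mem_randomSubset {U X : Finset (Fin n)} {p : Fin n → ℝ}
    (h : X ∈ (randomSubset U p).support) : X ⊆ U := by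
  rw [randomSubset, PMF.mem_support_map_iff] at h
  obtain ⟨b, -, rfl⟩ := h
  exact Finset.filter_subset _ _

theorem randomSubset_congr {U : Finset (Fin n)} {p q : Fin n → ℝ} (h : ∀ v ∈ U, p v = q v) :
    randomSubset U p = randomSubset U q := by
  rw [randomSubset_eq, randomSubset_eq]
  congr 2
  funext v
  unfold bitLaw
  split_ifs with hv
  · rw [h v hv]
  · rfl

theorem randomSubset_of_nonpos {U : Finset (Fin n)} {p : Fin n → ℝ} (h : ∀ v ∈ U, p v ≤ 0) :
    randomSubset U p = PMF.pure ∅ := by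
  have : bitLaw U p = fun _ => PMF.pure false := by
    funext v
    unfold bitLaw
    split_ifs with hv
    · exact coin_of_nonpos (h v hv)
    · rfl
  rw [randomSubset_eq, this, indep_pure, PMF.pure_map]
  congr 1
  ext v
  simp [mem_ofBits]

/-- Two random subsets drawn after each other, vertex by vertex. -/
theorem randomSubset_bind_map (U U' : Finset (Fin n)) (p q : Fin n → ℝ)
    (g : Fin n → Bool → Bool → Bool) :
    ((randomSubset U p).bind fun X => (randomSubset U' q).map fun Y =>
        ofBits fun v => g v (decide (v ∈ X)) (decide (v ∈ Y)))
      = (indep n fun v => (bitLaw U p v).bind fun a => (bitLaw U' q v).map (g v a)).map ofBits := by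
  simp only [randomSubset_eq, bind_map_eq, PMF.map_comp, indep_bind, indep_map, map_bind_eq]
  refine congrArg _ (funext fun a => ?_)
  congr 1
  funext b
  simp [mem_ofBits]

theorem randomSubset_union {A B : Finset (Fin n)} (hAB : Disjoint A B) (p : Fin n → ℝ) :
    randomSubset (A ∪ B) p
      = (randomSubset A p).bind fun X => (randomSubset B p).map fun Y => X ∪ Y := by
  have h1 : ∀ X Y : Finset (Fin n),
      X ∪ Y = ofBits fun v => (decide (v ∈ X)) || (decide (v ∈ Y)) := by
    intro X Y
    ext v
    simp [mem_ofBits]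
  rw [show (fun X => (randomSubset B p).map fun Y => X ∪ Y) = fun X => (randomSubset B p).map
    fun Y => ofBits fun v => (decide (v ∈ X)) || (decide (v ∈ Y)) by simp only [h1],
    randomSubset_bind_map A B p p fun _ a b => a || b, randomSubset_eq]
  congr 2
  funext v
  by_cases hA : v ∈ A
  · have hB : v ∉ B := Finset.disjoint_left.1 hAB hA
    simp [bitLaw, hA, hB, PMF.pure_map]
  · have h2 : ∀ x : PMF Bool, x = x.map fun b => b := fun x => x.map_id.symm
    simpa [bitLaw, hA, PMF.pure_bind] using h2 _

/-- This is what `R` and `H` leave of a set of isolated vertices: at each vertex neither of two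
independent coins succeeds. -/
theorem randomSubset_nor {B : Finset (Fin n)} {p q : ℝ} (hp : 0 ≤ p) (hp' : p ≤ 1) (hq : 0 ≤ q)
    (hq' : q ≤ 1) :
    ((randomSubset B fun _ => p).bind fun X => (randomSubset B fun _ => q).map fun Y =>
      B \ (X ∪ Y)) = randomSubset B fun _ => (1 - p) * (1 - q) := by
  have h1 : ∀ X Y : Finset (Fin n), B \ (X ∪ Y)
      = ofBits fun v => decide (v ∈ B) && !((decide (v ∈ X)) || (decide (v ∈ Y))) := by
    intro X Y
    ext v
    simp [mem_ofBits]
  simp only [h1]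
  rw [randomSubset_bind_map B B _ _ fun v a b => decide (v ∈ B) && !(a || b), randomSubset_eq]
  congr 2
  funext v
  by_cases hB : v ∈ B
  · simpa [bitLaw, hB] using coin_nor hp hp' hq hq'
  · simp [bitLaw, hB, PMF.pure_map]

/-- Successive thinnings multiply probabilities; repeated, this yields the powers of `survival`. -/
theorem randomSubset_bind {B : Finset (Fin n)} {p q : ℝ} (hp : 0 ≤ p) (hp' : p ≤ 1)
    (hq : q ≤ 1) :
    ((randomSubset B fun _ => p).bind fun X => randomSubset X fun _ => q)
      = randomSubset B fun _ => p * q := by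
  have h1 : ∀ b : Fin n → Bool, bitLaw (ofBits b) (fun _ => q)
      = fun v => if b v = true then coin q else PMF.pure false := fun b => by
    funext v
    simp only [bitLaw, mem_ofBits]
  simp only [randomSubset_eq, bind_map_eq, ← map_bind_eq, h1]
  rw [← indep_bind n _ fun v a => if a = true then coin q else PMF.pure false]
  congr 2
  funext v
  by_cases hB : v ∈ B
  · simpa [bitLaw, hB] using coin_and hp hp' hq
  · simp [bitLaw, hB]

theorem randomSubset_one (B : Finset (Fin n)) : (randomSubset B fun _ => 1) = PMF.pure B := by
  have h1 : coin 1 = PMF.pure true := pmf_bool_ext (by simp [coin_true le_rfl])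
  have : bitLaw B (fun _ => 1) = fun v => PMF.pure (decide (v ∈ B)) := by
    funext v
    unfold bitLaw
    split_ifs with hv <;> simp [h1, hv]
  rw [randomSubset_eq, this, indep_pure, PMF.pure_map]
  congr 1
  ext v
  simp [mem_ofBits]

end RandomSubsets

/-! ### Isolated vertices separate from the rest of a phase. -/

section Factor

variable {n : ℕ} {mm : SimpleGraph (Fin n) → Finset (Sym2 (Fin n))}

/-- The probability that an isolated vertex survives a phase. -/
def survival (n : ℕ) : ℝ := (1 - muR n) * (1 - muH n 0)

theorem muR_nonneg (n : ℕ) : 0 ≤ muR n := by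
  unfold muR
  have : 0 ≤ Real.logb 2 n := by
    rcases Nat.eq_zero_or_pos n with rfl | h
    · simp
    · exact Real.logb_nonneg (by norm_num) (by exact_mod_cast h)
  positivity

theorem muR_le_one {n : ℕ} (hn : 2 ≤ n) : muR n ≤ 1 := by
  unfold muR
  have h : (1 : ℝ) ≤ Real.logb 2 n := by
    rw [Real.le_logb_iff_rpow_le (by norm_num) (by positivity)]
    exact_mod_cast hn
  exact inv_le_one_of_one_le₀ (by linarith)

theorem muH_zero_nonneg (n : ℕ) : 0 ≤ muH n 0 := by
  rw [muH, if_pos (by norm_num)]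
  positivity

theorem muH_zero_le_one (n : ℕ) : muH n 0 ≤ 1 := by
  rw [muH, if_pos (by norm_num)]
  have h : Real.exp (alpha n / 2 * (0 - 1 / 2)) ≤ 1 := by
    rw [Real.exp_le_one_iff]
    have : 0 ≤ alpha n := by
      unfold alpha
      have := Real.log_natCast_nonneg n
      positivity
    nlinarith
  linarith

theorem survival_nonneg {n : ℕ} (hn : 2 ≤ n) : 0 ≤ survival n :=
  mul_nonneg (by linarith [muR_le_one hn]) (by linarith [muH_zero_le_one n])

theorem survival_le_one (n : ℕ) : survival n ≤ 1 :=
  mul_le_one₀ (by linarith [muR_nonneg n]) (by linarith [muH_zero_le_one n])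
    (by linarith [muH_zero_nonneg n])

theorem muF_zero : muF 0 = 0 := by
  rw [muF, if_pos (by norm_num)]
  simp

variable {G G' : SimpleGraph (Fin n)}

theorem nbrs_union_of_isolated {A B X Y : Finset (Fin n)} (hX : X ⊆ A) (hY : Y ⊆ B)
    (hB : ∀ v ∈ B, ∀ w ∈ A ∪ B, ¬ G.Adj v w) (hA : ∀ v ∈ A, ∀ w ∈ A, G.Adj v w ↔ G'.Adj v w)
    {v : Fin n} (hv : v ∈ A) : nbrs G (X ∪ Y) v = nbrs G' X v := by
  ext w
  rw [mem_nbrs, mem_nbrs, Finset.mem_union]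
  constructor
  · rintro ⟨h | h, hw⟩
    · exact ⟨h, (hA v hv w (hX h)).1 hw⟩
    · exact absurd hw.symm (hB w (hY h) v (Finset.mem_union_left _ hv))
  · rintro ⟨h, hw⟩
    exact ⟨Or.inl h, (hA v hv w (hX h)).2 hw⟩

theorem nbrs_eq_empty_of_isolated {A B X : Finset (Fin n)} (hX : X ⊆ A ∪ B)
    (hB : ∀ v ∈ B, ∀ w ∈ A ∪ B, ¬ G.Adj v w) {v : Fin n} (hv : v ∈ B) : nbrs G X v = ∅ := by
  ext w
  simp only [mem_nbrs, Finset.notMem_empty, iff_false, not_and]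
  exact fun h => hB v hv w (hX h)

theorem union_sdiff_union {A B RA RB HA HB FA : Finset (Fin n)} (hAB : Disjoint A B)
    (hRA : RA ⊆ A) (hHA : HA ⊆ A) (hFA : FA ⊆ A) (hRB : RB ⊆ B) (hHB : HB ⊆ B) :
    (A ∪ B) \ (RA ∪ RB ∪ (HA ∪ HB) ∪ FA) = A \ (RA ∪ HA ∪ FA) ∪ B \ (RB ∪ HB) := by
  ext v
  simp only [Finset.mem_sdiff, Finset.mem_union]
  by_cases hA : v ∈ A
  · have hB : v ∉ B := Finset.disjoint_left.1 hAB hA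
    have h1 : v ∉ RB := fun h => hB (hRB h)
    have h2 : v ∉ HB := fun h => hB (hHB h)
    simp [hA, hB, h1, h2]
  · have h1 : v ∉ RA := fun h => hA (hRA h)
    have h2 : v ∉ HA := fun h => hA (hHA h)
    have h3 : v ∉ FA := fun h => hA (hFA h)
    simp [hA, h1, h2, h3]

/-- The rule `mm` is given only the graph, and isolated vertices do not change the induced graph.
Hence it returns the same matching with and without them. -/
theorem inducedOn_union_of_isolated {A B X Y : Finset (Fin n)} (hX : X ⊆ A) (hY : Y ⊆ B)
    (hB : ∀ v ∈ B, ∀ w ∈ A ∪ B, ¬ G.Adj v w) (hA : ∀ v ∈ A, ∀ w ∈ A, G.Adj v w ↔ G'.Adj v w) :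
    inducedOn G' X = inducedOn G (X ∪ Y) := by
  have hmem : ∀ v w, G.Adj v w → v ∈ X ∪ Y → w ∈ X ∪ Y → v ∈ X := fun v w hvw hv hw =>
    (Finset.mem_union.1 hv).resolve_right fun h =>
      hB v (hY h) w (Finset.union_subset_union hX hY hw) hvw
  ext v w
  constructor
  · rintro ⟨h1, h2, h3⟩
    exact ⟨(hA v (hX h2) w (hX h3)).2 h1, Finset.mem_union_left _ h2, Finset.mem_union_left _ h3⟩
  · rintro ⟨h1, h2, h3⟩
    have h4 := hmem v w h1 h2 h3
    have h5 := hmem w v h1.symm h3 h2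
    exact ⟨(hA v (hX h4) w (hX h5)).1 h1, h4, h5⟩

/-- Isolated vertices go their own way in a phase. -/
theorem localPhase_union (hn : 2 ≤ n) {A B : Finset (Fin n)} (hAB : Disjoint A B)
    (hB : ∀ v ∈ B, ∀ w ∈ A ∪ B, ¬ G.Adj v w) (hA : ∀ v ∈ A, ∀ w ∈ A, G.Adj v w ↔ G'.Adj v w)
    (δ : ℝ) (M : Finset (Sym2 (Fin n))) :
    localPhase mm G (δ, A ∪ B, M) = (localPhase mm G' (δ, A, M)).bind fun s =>
      (randomSubset B fun _ => survival n).map fun B' => (s.1, s.2.1 ∪ B', s.2.2) := by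
  classical
  simp only [localPhase]
  rw [survival, ← randomSubset_nor (muR_nonneg n) (muR_le_one hn) (muH_zero_nonneg n)
    (muH_zero_le_one n)]
  simp only [PMF.bind_bind, map_bind_eq, bind_map_eq, PMF.map_comp]
  rw [randomSubset_union hAB]
  simp only [PMF.bind_bind, bind_map_eq]
  refine bind_congr_of_support fun RA hRA => ?_
  have hRA := subset_of_mem_randomSubset hRA
  have key : ∀ RB ∈ (randomSubset B fun _ => muR n).support,
      ((randomSubset (A ∪ B) fun v => muH n (((nbrs G (RA ∪ RB) v).card : ℝ) / muR n / δ)).bind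
        fun H => (randomSubset (A ∪ B) fun v => muF (((nbrs G H v).card : ℝ) / δ)).map fun F =>
          ((δ / 2, (A ∪ B) \ (RA ∪ RB ∪ H ∪ F), M ∪ mm (inducedOn G (H ∪ F))) : State n))
      = (randomSubset A fun v => muH n (((nbrs G' RA v).card : ℝ) / muR n / δ)).bind fun HA =>
        (randomSubset A fun v => muF (((nbrs G' HA v).card : ℝ) / δ)).bind fun FA =>
        (randomSubset B fun _ => muH n 0).map fun HB =>
          (δ / 2, (A \ (RA ∪ HA ∪ FA)) ∪ (B \ (RB ∪ HB)),
            M ∪ mm (inducedOn G' (HA ∪ FA))) := by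
    intro RB hRB
    have hRB := subset_of_mem_randomSubset hRB
    rw [randomSubset_union hAB]
    simp only [PMF.bind_bind, bind_map_eq]
    rw [randomSubset_congr (U := A) (q := fun v =>
        muH n (((nbrs G' RA v).card : ℝ) / muR n / δ)) fun v hv => by
          rw [nbrs_union_of_isolated hRA hRB hB hA hv],
      -- A vertex of `B` has no neighbour in `R`, so it enters `H` with probability `muH n 0`.
      randomSubset_congr (U := B) (q := fun _ => muH n 0) fun v hv => by
          rw [nbrs_eq_empty_of_isolated (Finset.union_subset_union hRA hRB) hB hv]
          simp]
    refine bind_congr_of_support fun HA hHA => ?_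
    have hHA := subset_of_mem_randomSubset hHA
    have hF : ∀ HB ∈ (randomSubset B fun _ => muH n 0).support,
        ((randomSubset (A ∪ B) fun v => muF (((nbrs G (HA ∪ HB) v).card : ℝ) / δ)).map fun F =>
          ((δ / 2, (A ∪ B) \ (RA ∪ RB ∪ (HA ∪ HB) ∪ F),
            M ∪ mm (inducedOn G (HA ∪ HB ∪ F))) : State n))
        = (randomSubset A fun v => muF (((nbrs G' HA v).card : ℝ) / δ)).bind fun FA =>
          PMF.pure (δ / 2, (A \ (RA ∪ HA ∪ FA)) ∪ (B \ (RB ∪ HB)),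
            M ∪ mm (inducedOn G' (HA ∪ FA))) := by
      intro HB hHB
      have hHB := subset_of_mem_randomSubset hHB
      rw [randomSubset_union hAB, map_bind_eq]
      rw [randomSubset_congr (U := A) (q := fun v => muF (((nbrs G' HA v).card : ℝ) / δ))
          fun v hv => by rw [nbrs_union_of_isolated hHA hHB hB hA hv],
        -- It has no neighbour in `H` either, and `muF 0 = 0`, so `F` contains no vertex of `B`.
        randomSubset_of_nonpos (U := B) fun v hv => by
          rw [nbrs_eq_empty_of_isolated (Finset.union_subset_union hHA hHB) hB hv]
          simp [muF_zero]]
      refine bind_congr_of_support fun FA hFA => ?_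
      have hFA := subset_of_mem_randomSubset hFA
      simp only [PMF.pure_map, Finset.union_empty]
      congr 3
      · exact union_sdiff_union hAB hRA hHA hFA hRB hHB
      · rw [inducedOn_union_of_isolated (Finset.union_subset hHA hFA) hHB hB hA,
          Finset.union_right_comm]
    -- As the draws on `A` no longer refer to those on `B`, the latter can be postponed.
    rw [bind_congr_of_support hF, PMF.bind_comm]
    simp only [map_as_bind]
  rw [bind_congr_of_support key, PMF.bind_comm]
  refine congrArg _ (funext fun HA => ?_)
  rw [PMF.bind_comm]
  rfl

/-- Isolated vertices go their own way in a sequence of phases. -/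
theorem iterate_localPhase_union (hn : 2 ≤ n) (hmm : IsMaximalMatchingRule mm) :
    ∀ (k : ℕ) {A B : Finset (Fin n)} (_ : Disjoint A B)
      (_ : ∀ v ∈ B, ∀ w ∈ A ∪ B, ¬ G.Adj v w) (_ : ∀ v ∈ A, ∀ w ∈ A, G.Adj v w ↔ G'.Adj v w)
      (δ : ℝ) (M : Finset (Sym2 (Fin n))),
      iterate (localPhase mm G) k (δ, A ∪ B, M)
        = (iterate (localPhase mm G') k (δ, A, M)).bind fun s =>
          (randomSubset B fun _ => survival n ^ k).map fun B' => (s.1, s.2.1 ∪ B', s.2.2)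
  | 0, A, B, _, _, _, δ, M => by
      simp [iterate, randomSubset_one, PMF.pure_map]
  | k + 1, A, B, hAB, hB, hA, δ, M => by
      rw [iterate, iterate, localPhase_union hn hAB hB hA, PMF.bind_bind, PMF.bind_bind]
      refine bind_congr_of_support fun s hs => ?_
      rw [bind_map_eq]
      obtain ⟨h1, -⟩ := mem_localPhase hmm G' hs
      have h2 : ∀ B' ∈ (randomSubset B fun _ => survival n).support,
          iterate (localPhase mm G) k (s.1, s.2.1 ∪ B', s.2.2)
            = (iterate (localPhase mm G') k s).bind fun s =>
              (randomSubset B' fun _ => survival n ^ k).map fun B' =>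
                (s.1, s.2.1 ∪ B', s.2.2) := by
        intro B' hB'
        have hB' := subset_of_mem_randomSubset hB'
        exact iterate_localPhase_union hn hmm k (Finset.disjoint_of_subset_left h1
          (Finset.disjoint_of_subset_right hB' hAB))
          (fun v hv w hw => hB v (hB' hv) w (Finset.union_subset_union h1 hB' hw))
          (fun v hv w hw => hA v (h1 hv) w (h1 hw)) s.1 s.2.2
      rw [bind_congr_of_support h2, PMF.bind_comm]
      refine congrArg _ (funext fun t => ?_)
      -- Survival of the first phase and of the remaining `k` phases are two independent thinnings,
      -- which gives the next power.
      rw [← map_bind_eq, randomSubset_bind (survival_nonneg hn) (survival_le_one n)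
        (pow_le_one₀ (survival_nonneg hn) (survival_le_one n)), pow_succ']

end Factor

/-! ### The law computed by the program is the law of an iteration. -/

section IterationLaw

variable {P : Params} {n : ℕ}

/-- The memories in a state depend only on the status of the vertices that have neighbours. -/
theorem homeMem_baseFields_congr {γ γ' : Conf P n} (hi : γ.inst = γ'.inst)
    (hV : ∀ v w, γ.inst.G.Adj v w → (v ∈ γ.V ↔ v ∈ γ'.V)) (hM : γ.M = γ'.M) :
    homeMem arcId (fun γ : Conf P n => γ.inst.lay) baseFields γ
      = homeMem arcId (fun γ : Conf P n => γ.inst.lay) baseFields γ' := by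
  obtain ⟨i, V, M⟩ := γ
  obtain ⟨i', V', M'⟩ := γ'
  obtain rfl : i = i' := hi
  obtain rfl : M = M' := hM
  funext j
  ext w
  rw [homeMem, mem_placed, mem_placed]
  refine exists_congr fun a => and_congr_right fun ha => and_congr_right fun _ => ?_
  have h1 := hV a.1 a.2 ((i.mem_arcs a).1 ha)
  simp only at h1
  simp only [baseFields, bit_eq_bit.2 h1]
  rfl

section Assign

variable {G : SimpleGraph (Fin n)} {S : ℕ} {V : Finset (Fin n)} {φ φ' : Fin n → ℕ}

theorem inducedOn_part_congr (h : ∀ v w, G.Adj v w → φ v = φ' v) (i : ℕ) :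
    inducedOn G (part V φ i) = inducedOn G (part V φ' i) := by
  ext u v
  refine and_congr_right fun huv => ?_
  rw [mem_part, mem_part, mem_part, mem_part, h u v huv, h v u huv.symm]

theorem mem_keptPart_congr (h : ∀ v w, G.Adj v w → φ v = φ' v) {i : ℕ} {u v : Fin n}
    (huv : G.Adj u v) : u ∈ keptPart G S V φ i ↔ u ∈ keptPart G S V φ' i := by
  rw [mem_keptPart, mem_keptPart, h u v huv, inducedOn_part_congr h]

theorem partGraph_congr (h : ∀ v w, G.Adj v w → φ v = φ' v) (i : ℕ) :
    partGraph G S V φ i = partGraph G S V φ' i := by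
  ext u v
  rw [partGraph_adj, partGraph_adj]
  refine and_congr_right fun huv => ?_
  rw [mem_keptPart_congr h huv, mem_keptPart_congr h huv.symm]

theorem mem_partCore_congr (h : ∀ v w, G.Adj v w → φ v = φ' v) {i : ℕ} {u : Fin n} :
    u ∈ partCore G S V φ i ↔ u ∈ partCore G S V φ' i := by
  rw [mem_partCore, mem_partCore]
  constructor
  · rintro ⟨h1, w, h2, h3⟩
    exact ⟨(mem_keptPart_congr h h2).1 h1, w, h2, (mem_keptPart_congr h h2.symm).1 h3⟩
  · rintro ⟨h1, w, h2, h3⟩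
    exact ⟨(mem_keptPart_congr h h2).2 h1, w, h2, (mem_keptPart_congr h h2.symm).2 h3⟩

end Assign

variable {S m : ℕ} {mm : SimpleGraph (Fin n) → Finset (Sym2 (Fin n))}

/-- The choices at vertices isolated in the whole graph leave no trace in the memories. -/
theorem nextConf_congr (γ : Conf P n) {o o' : Fin n → PartChoice}
    (h : ∀ v w, γ.inst.G.Adj v w → o v = o' v) (r : Fin m → PhaseOutcome n) :
    homeMem arcId (fun γ : Conf P n => γ.inst.lay) baseFields (nextConf S m ((γ, o), r))
      = homeMem arcId (fun γ : Conf P n => γ.inst.lay) baseFields (nextConf S m ((γ, o'), r)) := by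
  classical
  have h1 : ∀ v w, γ.inst.G.Adj v w → PartConf.assign (γ, o) v = PartConf.assign (γ, o') v :=
    fun v w hvw => by simp only [PartConf.assign, h v w hvw]
  refine homeMem_baseFields_congr rfl (fun v w hvw => ?_) ?_
  · simp only [nextConf, Finset.mem_union, Finset.mem_biUnion, Finset.mem_inter,
      Finset.mem_filter, Finset.mem_sdiff, mem_partCore_congr h1,
      mem_keptPart_congr h1 (show γ.inst.G.Adj v w from hvw), h v w hvw]
  · simp only [nextConf]
    refine congrArg _ (Finset.biUnion_congr rfl fun i _ => Finset.filter_congr fun e _ => ?_)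
    rw [partGraph_congr h1]

/-- The law of the choices without regard to isolated vertices. -/
theorem parallelLaw_map (c : ℝ) (τ : ℕ) (δ : ℝ) (γ : Conf P n) :
    (parallelLaw S m mm c τ δ γ).map (homeMem arcId (fun γ : Conf P n => γ.inst.lay) baseFields)
      = ((indep n fun _ => uniformOr (Finset.range m) 0).bind fun φ =>
        (indep n fun _ => coin c).bind fun ζ =>
        (indep m fun i => phaseLaw mm γ.inst.G S γ.V φ τ δ i).map fun r =>
          nextConf S m ((γ, fun v => (φ v, ζ v)), r)).map
        (homeMem arcId (fun γ : Conf P n => γ.inst.lay) baseFields) := by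
  classical
  -- As in a phase of `GlobalAlg`, no machine draws for an isolated vertex, and its choice is
  -- replaced by a constant.
  let mask : Fin n → PartChoice → PartChoice := fun v o =>
    if ∃ w, γ.inst.G.Adj v w then o else (0, false)
  have hlaw : partLaw γ.inst.G m c = fun v => (((uniformOr (Finset.range m) 0).bind fun i =>
      (coin c).map fun z => ((i, z) : PartChoice))).map (mask v) := by
    funext v
    unfold partLaw
    simp only [mask]
    split_ifs with h
    · exact (PMF.map_id _).symm
    · exact (PMF.map_const _ _).symm
  have hmask : ∀ (o : Fin n → PartChoice) v w, γ.inst.G.Adj v w → mask v (o v) = o v :=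
    fun o v w hvw => if_pos ⟨w, hvw⟩
  rw [parallelLaw, hlaw, indep_map, indep_bind]
  simp only [indep_map, map_bind_eq, bind_map_eq, PMF.bind_bind, PMF.map_comp]
  refine congrArg _ (funext fun φ => congrArg _ (funext fun ζ => ?_))
  have hp : (indep m fun i : Fin m => phaseLaw mm γ.inst.G S γ.V
      (fun v => (mask v (φ v, ζ v)).1) τ δ i)
      = indep m fun i : Fin m => phaseLaw mm γ.inst.G S γ.V φ τ δ i := by
    congr 1
    funext i
    refine phaseLaw_congr (partGraph_congr (fun v w hvw => ?_) i)
    rw [hmask (fun v => (φ v, ζ v)) v w hvw]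
  refine (congrArg _ hp).trans ?_
  congr 1
  funext r
  exact nextConf_congr γ (hmask fun v => (φ v, ζ v)) r

/-- Each kept part is split into its core and the vertices isolated in it. The core is treated by
`phaseLaw`, and the fate of the isolated vertices over all phases is a single coin each. -/
theorem parallelIteration_eq (hn : 2 ≤ n) (hmm : IsMaximalMatchingRule mm) (γ : Conf P n) {Δ : ℝ}
    (hm : 0 < numParts n S Δ) :
    (parallelIteration mm γ.inst.G S (Δ, γ.V, γ.M)).map (stateConf γ.inst)
      = (indep n fun _ => uniformOr (Finset.range (numParts n S Δ)) 0).bind fun φ =>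
        (indep n fun _ => coin (survival n ^ numPhases n S Δ)).bind fun ζ =>
        (indep (numParts n S Δ) fun i => phaseLaw mm γ.inst.G S γ.V φ (numPhases n S Δ)
          (Δ / numParts n S Δ) i).map fun r =>
          nextConf S (numParts n S Δ) ((γ, fun v => (φ v, ζ v)), r) := by
  classical
  set m := numParts n S Δ with hm'
  set τ := numPhases n S Δ
  set G := γ.inst.G
  have e0 : parallelIteration mm G S (Δ, γ.V, γ.M)
      = (indep n fun _ => uniformOr (Finset.range m) 0).bind fun φ =>
        (indep m fun i => iterate (localPhase mm G) τ (Δ / m, keptPart G S γ.V φ i, ∅)).map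
          fun res => (nextDelta n S Δ, Finset.univ.biUnion fun i => (res i).2.1,
            γ.M ∪ Finset.univ.biUnion fun i => (res i).2.2) := rfl
  rw [e0, map_bind_eq]
  refine bind_congr_of_support fun φ hφ => ?_
  have hφ : ∀ v, φ v < m := by
    intro v
    have h1 := mem_support_indep.1 hφ v
    rw [uniformOr_of_nonempty (by simpa using hm.ne'), PMF.mem_support_uniformOfFinset_iff] at h1
    exact Finset.mem_range.1 h1
  let X : Fin m → PMF (State n) := fun i =>
    iterate (localPhase mm (partGraph G S γ.V φ i)) τ (Δ / m, partCore G S γ.V φ i, ∅)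
  let I : Fin m → Finset (Fin n) := fun i => keptPart G S γ.V φ i \ partCore G S γ.V φ i
  have hcore : ∀ i : Fin m, partCore G S γ.V φ i ⊆ keptPart G S γ.V φ i := fun i v hv =>
    (mem_partCore.1 hv).1
  have hfac : ∀ i : Fin m, iterate (localPhase mm G) τ (Δ / m, keptPart G S γ.V φ i, ∅)
      = (X i).bind fun s => (indep n fun _ => coin (survival n ^ τ)).map fun z =>
        (s.1, s.2.1 ∪ (I i).filter fun v => z v = true, s.2.2) := by
    intro i
    have hu : keptPart G S γ.V φ i = partCore G S γ.V φ i ∪ I i :=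
      (Finset.union_sdiff_of_subset (hcore i)).symm
    have hB : ∀ v ∈ I i, ∀ w ∈ partCore G S γ.V φ i ∪ I i, ¬ G.Adj v w := by
      intro v hv w hw hvw
      rw [← hu] at hw
      obtain ⟨h1, h2⟩ := Finset.mem_sdiff.1 hv
      exact h2 (mem_partCore.2 ⟨h1, w, hvw, hw⟩)
    have hA : ∀ v ∈ partCore G S γ.V φ i, ∀ w ∈ partCore G S γ.V φ i,
        G.Adj v w ↔ (partGraph G S γ.V φ i).Adj v w := fun v hv w hw =>
      ⟨fun h => ⟨h, hcore i hv, hcore i hw⟩, fun h => h.1⟩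
    conv_lhs => rw [hu]
    rw [iterate_localPhase_union hn hmm τ Finset.disjoint_sdiff hB hA]
    simp only [randomSubset, PMF.map_comp]
    rfl
  have hX : ∀ i : Fin m, phaseLaw mm G S γ.V φ τ (Δ / m) i = (X i).map Prod.snd := fun i => rfl
  rw [funext hfac, indep_bind, PMF.map_comp, map_bind_eq]
  simp only [hX, indep_map, PMF.map_comp, map_as_bind _ (_ ∘ _)]
  rw [PMF.bind_comm]
  refine bind_congr_of_support fun s hs => ?_
  -- On the support, outcomes stay inside the core and inside the part graph. So the intersection
  -- and the filter in `nextConf`, which make the next state sensible for arbitrary outcomes, change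
  -- nothing.
  have hs : ∀ i, (s i).2.1 ⊆ partCore G S γ.V φ i ∧
      ∀ e ∈ (s i).2.2, e ∈ (partGraph G S γ.V φ i).edgeSet := by
    intro i
    obtain ⟨h1, h2⟩ := mem_iterate_localPhase hmm _ _ (mem_support_indep.1 hs i)
    exact ⟨h1, fun e he => (h2 e he).resolve_left (by simp)⟩
  let h : Fin n → Fin m := fun v => ⟨φ v, hφ v⟩
  -- In the factored law every part tosses coins for all vertices, but a vertex uses only the coin
  -- of its own part `φ v`. One coin per vertex therefore has the same effect.
  conv_rhs => rw [← indep_reindex (fun (_ : Fin m) (_ : Fin n) => coin (survival n ^ τ)) h]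
  simp only [← map_as_bind, PMF.map_comp]
  congr 1
  funext z
  simp only [Function.comp_apply, stateConf, nextConf]
  congr 1
  · ext v
    simp only [Finset.mem_biUnion, Finset.mem_univ, true_and, Finset.mem_union,
      Finset.mem_inter, Finset.mem_filter, ← exists_or]
    refine exists_congr fun i => or_congr ?_ ?_
    · exact ⟨fun hv => ⟨hv, (hs i).1 hv⟩, fun hv => hv.1⟩
    · refine and_congr_right fun hv => ?_
      have h1 := (mem_keptPart.1 (Finset.mem_sdiff.1 hv).1).2.1
      rw [show h v = i from Fin.ext h1]
  · congr 1
    refine Finset.biUnion_congr rfl fun i _ => ?_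
    exact (Finset.filter_true_of_mem (hs i).2).symm

/-- An iteration of `ParallelAlg` takes a bounded number of rounds. -/
theorem impl_parallelIteration (hP : LargeFor P n) (hn : 2 ≤ n) (hmm : IsMaximalMatchingRule mm)
    (hS : 16 * S ≤ P.Kg) {Δ : ℝ} (hm : 0 < numParts n S Δ) (hmn : numParts n S Δ ≤ n) :
    Impl P.cap P.W P.parallelRounds (arcView Conf.inst baseFields) (arcView Conf.inst baseFields)
      fun γ : Conf P n =>
        (parallelIteration mm γ.inst.G S (Δ, γ.V, γ.M)).map (stateConf γ.inst) := by
  refine (impl_parallelLaw S _ hP hmn hS hmm (survival n ^ numPhases n S Δ) (numPhases n S Δ)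
    (Δ / numParts n S Δ)).congr_law fun γ => ?_
  rw [parallelIteration_eq hn hmm γ hm]
  have h := parallelLaw_map (S := S) (m := numParts n S Δ) (mm := mm)
    (survival n ^ numPhases n S Δ) (numPhases n S Δ) (Δ / numParts n S Δ) γ
  have h2 := congrArg (PMF.map fun (x : ℕ → Finset Fact) (i : Fin P.p) => (x i).image enc) h
  rw [PMF.map_comp, PMF.map_comp] at h2
  exact h2

end IterationLaw

/-! ## Reading the input and writing the output -/

/-- A graph with an initial distribution of its edges. -/
structure Input (n p S : ℕ) where
  /-- the graph -/
  G : SimpleGraph (Fin n)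
  /-- the shares of the machines -/
  share : Fin p → List (Fin n × Fin n)
  isInput : IsInputFor G S share

section Input

variable {n p S : ℕ}

theorem Input.mem_share_iff (γ : Input n p S) {a : Fin n × Fin n} :
    γ.G.Adj a.1 a.2 ↔ ∃ i, ∃ x ∈ γ.share i, s(x.1, x.2) = s(a.1, a.2) := by
  have h := γ.isInput.2.2 s(a.1, a.2)
  rw [SimpleGraph.mem_edgeSet] at h
  rw [← h, List.mem_map]
  simp only [List.mem_flatMap, List.mem_finRange, true_and]
  constructor
  · rintro ⟨x, ⟨i, hx⟩, he⟩
    exact ⟨i, x, hx, he⟩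
  · rintro ⟨i, x, hx, he⟩
    exact ⟨x, ⟨i, hx⟩, he⟩

theorem Input.unique (γ : Input n p S) {i j : Fin p} {x y : Fin n × Fin n}
    (hx : x ∈ γ.share i) (hy : y ∈ γ.share j) (h : s(x.1, x.2) = s(y.1, y.2)) : i = j := by
  have h1 := γ.isInput.2.1
  rw [List.map_flatMap, List.nodup_flatMap] at h1
  by_contra hij
  have : Std.Symm (Function.onFun List.Disjoint
      fun i => (γ.share i).map fun x : Fin n × Fin n => s(x.1, x.2)) :=
    ⟨fun _ _ h => List.Disjoint.symm h⟩
  have h2 := List.Pairwise.forall h1.2 (List.mem_finRange i) (List.mem_finRange j) hij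
  exact h2 (List.mem_map.2 ⟨x, hx, h⟩) (List.mem_map.2 ⟨y, hy, rfl⟩)

/-- The machine that holds an arc initially. -/
def Input.holder (γ : Input n p S) (a : Fin n × Fin n) : ℕ :=
  open Classical in
  if h : ∃ i : Fin p, ∃ x ∈ γ.share i, s(x.1, x.2) = s(a.1, a.2) then (h.choose : ℕ) else 0

theorem Input.holder_eq (γ : Input n p S) {i : Fin p} {x a : Fin n × Fin n} (hx : x ∈ γ.share i)
    (h : s(x.1, x.2) = s(a.1, a.2)) : γ.holder a = i := by
  have hex : ∃ i : Fin p, ∃ x ∈ γ.share i, s(x.1, x.2) = s(a.1, a.2) := ⟨i, x, hx, h⟩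
  rw [Input.holder, dif_pos hex]
  obtain ⟨y, hy, hya⟩ := hex.choose_spec
  rw [γ.unique hy hx (hya.trans h.symm)]

/-- The arcs of the graph. -/
def Input.arcs (γ : Input n p S) : Finset (Fin n × Fin n) :=
  open Classical in Finset.univ.filter fun a => γ.G.Adj a.1 a.2

theorem Input.mem_arcs (γ : Input n p S) {a : Fin n × Fin n} :
    a ∈ γ.arcs ↔ γ.G.Adj a.1 a.2 := by
  simp [Input.arcs]

theorem Input.holder_lt (γ : Input n p S) {a : Fin n × Fin n} (ha : a ∈ γ.arcs) :
    γ.holder a < p := by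
  obtain ⟨i, x, hx, he⟩ := γ.mem_share_iff.1 (γ.mem_arcs.1 ha)
  rw [γ.holder_eq hx he]
  exact i.2

/-- A machine that holds an edge can produce both of its arcs, so the initial holder of an arc is
the holder of its edge. -/
theorem Input.mem_arcs_holder (γ : Input n p S) {a : Fin n × Fin n} {i : Fin p} :
    a ∈ γ.arcs ∧ γ.holder a = i ↔ ∃ x ∈ γ.share i, a = x ∨ a = x.swap := by
  have hs : ∀ x : Fin n × Fin n, s(x.1, x.2) = s(a.1, a.2) ↔ a = x ∨ a = x.swap := by
    intro x
    rw [Sym2.eq_iff, Prod.ext_iff, Prod.ext_iff]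
    simp only [Prod.fst_swap, Prod.snd_swap]
    constructor <;> rintro (⟨h1, h2⟩ | ⟨h1, h2⟩) <;> simp [h1, h2]
  constructor
  · rintro ⟨ha, hi⟩
    obtain ⟨j, x, hx, he⟩ := γ.mem_share_iff.1 (γ.mem_arcs.1 ha)
    rw [γ.holder_eq hx he] at hi
    obtain rfl := Fin.ext hi
    exact ⟨x, hx, (hs x).1 he⟩
  · rintro ⟨x, hx, he⟩
    have he := (hs x).2 he
    exact ⟨γ.mem_arcs.2 (γ.mem_share_iff.2 ⟨i, x, hx, he⟩), γ.holder_eq hx he⟩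

theorem Input.card_holder_le (γ : Input n p S) (i : ℕ) :
    (γ.arcs.filter fun a => γ.holder a = i).card ≤ 2 * S := by
  classical
  by_cases hi : i < p
  · refine (Finset.card_le_card (t := (γ.share ⟨i, hi⟩).toFinset ∪
      (γ.share ⟨i, hi⟩).toFinset.image Prod.swap) fun a ha => ?_).trans ?_
    · obtain ⟨x, hx, h | h⟩ := (γ.mem_arcs_holder (i := ⟨i, hi⟩)).1 (Finset.mem_filter.1 ha)
      · exact Finset.mem_union_left _ (List.mem_toFinset.2 (h ▸ hx))
      · exact Finset.mem_union_right _ (Finset.mem_image.2 ⟨x, List.mem_toFinset.2 hx, h.symm⟩)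
    · have h1 := (γ.share ⟨i, hi⟩).toFinset_card_le
      have h2 := γ.isInput.1 ⟨i, hi⟩
      have h3 := Finset.card_image_le (s := (γ.share ⟨i, hi⟩).toFinset)
        (f := (Prod.swap : Fin n × Fin n → Fin n × Fin n))
      have h4 := Finset.card_union_le (γ.share ⟨i, hi⟩).toFinset
        ((γ.share ⟨i, hi⟩).toFinset.image Prod.swap)
      omega
  · rw [Finset.card_eq_zero.2]
    · omega
    · refine Finset.filter_eq_empty_iff.2 fun a ha h => ?_
      have := γ.holder_lt ha
      omega

theorem Input.card_arcs_le (γ : Input n p S) : γ.arcs.card ≤ n * n :=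
  (Finset.card_le_univ _).trans (le_of_eq (by simp))

/-- The home machine of an arc. -/
def Input.home (γ : Input n p S) (a : Fin n × Fin n) : ℕ :=
  if p ≤ n * n then γ.holder a else arcId a

/-- If there are more than `n * n` machines, arcs move to the machines with their names. The number
of machines in use is then at most `n * n`, which keeps the tree of constant depth for every `p`. -/
theorem Input.home_lt (γ : Input n p S) {a : Fin n × Fin n} (ha : a ∈ γ.arcs) :
    γ.home a < min p (n * n) := by
  unfold Input.home
  split_ifs with h
  · rw [min_eq_left h]
    exact γ.holder_lt ha
  · rw [min_eq_right (by omega)]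
    exact arcId_lt a

theorem Input.card_home_le (γ : Input n p S) (hS : 0 < S) (i : ℕ) :
    (γ.arcs.filter fun a => γ.home a = i).card ≤ min (2 * S) (n * n) := by
  refine le_min ?_ ((Finset.card_le_card (Finset.filter_subset _ _)).trans γ.card_arcs_le)
  unfold Input.home
  split_ifs with h
  · exact γ.card_holder_le i
  · refine le_trans (Finset.card_le_one.2 fun a ha b hb => ?_) (by omega : 1 ≤ 2 * S)
    exact arcId_injective ((Finset.mem_filter.1 ha).2.trans (Finset.mem_filter.1 hb).2.symm)

theorem initialMemories_injective {share share' : Fin p → List (Fin n × Fin n)} {i : Fin p}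
    (h : initialMemories share i = initialMemories share' i) : share i = share' i := by
  unfold initialMemories at h
  generalize share i = l at h
  generalize share' i = l' at h
  induction l generalizing l' with
  | nil =>
    cases l' with
    | nil => rfl
    | cons y l' => simp at h
  | cons x l ih =>
    cases l' with
    | nil => simp at h
    | cons y l' =>
      simp only [List.flatMap_cons, List.cons_append, List.nil_append, List.cons.injEq] at h
      rw [ih l' h.2.2, Prod.ext (Fin.ext h.1) (Fin.ext h.2.1)]

theorem Input.share_eq {γ γ' : Input n p S} {i : Fin p}
    (h : initialMemories γ.share i = initialMemories γ'.share i) : γ.share i = γ'.share i :=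
  initialMemories_injective h

end Input

/-! ### The first rounds and the last round of the program. -/

section Rounds

variable {P : Params} {n S : ℕ}

/-- The parameters fit the size of the input. -/
structure FitsInput (P : Params) (n S : ℕ) : Prop where
  large : LargeFor P n
  S_pos : 0 < S
  q_eq : P.q = min P.p (n * n)
  K_eq : P.K = min (2 * S) (n * n)
  two_mul_le_cap : 2 * S ≤ P.cap

/-- The arcs of the input on their home machines. -/
def Input.inst (hP : FitsInput P n S) (γ : Input n P.p S) : Inst P n where
  G := γ.G
  lay :=
    { A := γ.arcs
      home := γ.home
      home_lt := fun a ha => hP.q_eq ▸ γ.home_lt ha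
      load := fun i => hP.K_eq ▸ γ.card_home_le hP.S_pos i
      card_le := by
        have h := Finset.card_le_mul_card_image_of_maps_to (s := γ.arcs)
          (t := Finset.range P.q) (f := γ.home)
          (fun a ha => Finset.mem_range.2 (hP.q_eq ▸ γ.home_lt ha)) P.K
          fun i _ => hP.K_eq ▸ γ.card_home_le hP.S_pos i
        rwa [Finset.card_range, mul_comm] at h
      card_lt := γ.card_arcs_le.trans_lt (hP.large.lt_G.trans_le P.G_le_N) }
  mem_arcs := fun _ => γ.mem_arcs

/-- The initial memories. -/
def inputView (n p S : ℕ) : View p (Input n p S) :=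
  ⟨List ℕ, id, fun γ => initialMemories γ.share⟩

theorem enc_arcId_lt (hP : FitsInput P n S) (a : Fin n × Fin n) : enc [arcId a] < P.W := by
  refine (enc_lt (M := 32) (two_le_N P) (w := [arcId a]) ⟨by simp, fun x hx => ?_⟩).trans_le
    P.pow_le_W
  rw [List.mem_singleton.1 hx]
  exact (arc_lt_I hP.large a).trans_le P.I_le_N

/-- In the first round, the edges are turned into arcs. -/
theorem impl_readArcs (hP : FitsInput P n S) :
    Impl P.cap P.W 1 (inputView n P.p S)
      (factsView P.p (placed (fun γ : Input n P.p S => γ.arcs) Input.holder fun _ a => [arcId a]))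
      PMF.pure := by
  classical
  refine Impl.of_round (fun γ i => PMF.pure
    ((γ.share i).flatMap fun x => [enc [arcId x], enc [arcId x.swap]], [])) ?_ ?_ ?_
  · intro γ γ' i h
    rw [Input.share_eq h]
  · intro γ r hr
    obtain rfl : r = fun i =>
        ((γ.share i).flatMap fun x => [enc [arcId x], enc [arcId x.swap]], []) :=
      funext fun i => by simpa using hr i
    have h1 : ∀ i : Fin P.p,
        ((γ.share i).flatMap fun x => [enc [arcId x], enc [arcId x.swap]]).length ≤ P.cap ∧
        ∀ w ∈ (γ.share i).flatMap fun x => [enc [arcId x], enc [arcId x.swap]], w < P.W := by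
      intro i
      constructor
      · have h1 := γ.isInput.1 i
        have h2 := hP.two_mul_le_cap
        simp only [List.length_flatMap, List.length_cons, List.length_nil, List.map_const',
          List.sum_replicate, smul_eq_mul]
        omega
      · intro w hw
        obtain ⟨x, -, hw⟩ := List.mem_flatMap.1 hw
        simp only [List.mem_cons, List.not_mem_nil, or_false] at hw
        rcases hw with rfl | rfl <;> exact enc_arcId_lt hP _
    constructor
    · intro i
      simpa using h1 i
    · intro i
      simpa [exchange, received] using h1 i
  · intro γ
    rw [indep_pure, PMF.pure_map, PMF.pure_map]
    congr 1
    funext i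
    ext w
    simp only [exchange, received, List.filter_nil, List.map_nil, List.mem_toFinset,
      List.mem_append, List.mem_flatMap, List.mem_cons, List.not_mem_nil, or_false, and_false,
      exists_false, Finset.mem_image, mem_placed]
    constructor
    · rintro ⟨x, hx, rfl | rfl⟩
      · obtain ⟨h1, h2⟩ := γ.mem_arcs_holder.2 ⟨x, hx, Or.inl rfl⟩
        exact ⟨_, ⟨x, h1, h2, rfl⟩, rfl⟩
      · obtain ⟨h1, h2⟩ := γ.mem_arcs_holder.2 ⟨x, hx, Or.inr rfl⟩
        exact ⟨_, ⟨x.swap, h1, h2, rfl⟩, rfl⟩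
    · rintro ⟨_, ⟨a, h1, h2, rfl⟩, rfl⟩
      obtain ⟨x, hx, rfl | rfl⟩ := γ.mem_arcs_holder.1 ⟨h1, h2⟩
      · exact ⟨_, hx, Or.inl rfl⟩
      · exact ⟨_, hx, Or.inr rfl⟩

/-- The initial state of `ParallelAlg`. -/
def startConf (hP : FitsInput P n S) (γ : Input n P.p S) : Conf P n :=
  ⟨γ.inst hP, Finset.univ, ∅⟩

/-- The number of rounds to set up the initial state. -/
def Params.startRounds (P : Params) : ℕ := 1 + (1 + (P.scanRounds + 1))

/-- Edges become arcs, arcs go to their homes, and a scan gives every arc its index. The rest of the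
initial state is constant: all vertices remain and the matching is empty. -/
theorem impl_start (hP : FitsInput P n S) :
    Impl P.cap P.W P.startRounds (inputView n P.p S)
      (arcView Conf.inst baseFields) fun γ => PMF.pure (startConf hP γ) := by
  have h1 : Deliver P.p 32 P.N P.cap
      (placed (fun γ : Input n P.p S => γ.arcs) Input.holder fun _ a => [arcId a])
      (homeMem arcId (fun γ : Input n P.p S => (γ.inst hP).lay) fun _ _ => []) := by
    refine Deliver.route _ Input.holder Input.home _ ?_ ?_ ?_ ?_ ?_
    · intro γ γ' i a h ha hi
      obtain ⟨h1, h2, -⟩ := placed_know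
        (fun γ γ' a b hab => arcId_injective (List.cons.inj hab).1) h ha hi
      refine ⟨h1, h2, ?_, rfl⟩
      unfold Input.home
      rw [hi, h2]
    · exact fun γ a ha => γ.holder_lt ha
    · exact fun γ i => (γ.card_holder_le i).trans hP.two_mul_le_cap
    · exact fun γ i => (γ.card_home_le hP.S_pos i).trans
        ((min_le_left _ _).trans hP.two_mul_le_cap)
    · refine fun γ a _ => ⟨by simp, fun x hx => ?_⟩
      rw [List.mem_singleton.1 hx]
      exact (arc_lt_I hP.large a).trans_le P.I_le_N
  have h2 := impl_srcPrefix (inst := Input.inst (P := P) hP) hP.large (k := 0)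
    (F := fun _ _ => []) (val := fun _ _ => 1) (by omega)
    (fun γ a _ => ⟨by simp, by simp⟩) (fun _ _ _ _ _ _ => rfl) (fun _ _ => by omega)
  have h3 := impl_local (lay := fun γ : Input n P.p S => (γ.inst hP).lay) arcId_injective
    (arc_lt_I hP.large)
    (F := fun γ a => [] ++ [srcPrefix (Input.inst (P := P) hP) (fun _ _ => 1) γ a])
    (F' := fun γ => baseFields (startConf hP γ))
    (fun γ γ' a _ _ h => by
      have e1 : arcIndex Conf.inst (startConf hP γ) a = arcIndex Conf.inst (startConf hP γ') a :=
        (append_singleton_eq h).2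
      simp only [baseFields, e1]
      rfl)
    fun γ a ha => (small_baseFields hP.large (startConf hP γ) a ha).mono (by omega)
  refine ((impl_readArcs hP).comp_pure ((h1.impl (two_le_N P) P.pow_le_W).comp_pure
    (h2.comp_pure h3))).congr_law fun γ => ?_
  rw [PMF.pure_map, PMF.pure_map]
  rfl

theorem listedEdges_flatMap (l : List (Fin n × Fin n)) (e : Sym2 ℕ) :
    e ∈ listedEdges (l.flatMap fun a => [(a.1 : ℕ), (a.2 : ℕ)])
      ↔ ∃ a ∈ l, s((a.1 : ℕ), (a.2 : ℕ)) = e := by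
  induction l with
  | nil => simp [listedEdges]
  | cons a l ih =>
    simp only [List.flatMap_cons, List.cons_append, List.nil_append, listedEdges,
      Finset.mem_insert, ih, List.mem_cons, exists_eq_or_imp, eq_comm (a := e)]

/-- The arcs of the matching on a machine, each edge in one orientation. -/
def matchingArcs (γ : Conf P n) (i : ℕ) : Finset (Fin n × Fin n) :=
  open Classical in
  γ.inst.lay.A.filter fun a => γ.inst.lay.home a = i ∧ s(a.1, a.2) ∈ γ.M ∧ a.1 < a.2

/-- The edges listed in the memories. -/
def outputView (P : Params) (n : ℕ) : View P.p (Conf P n) :=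
  ⟨Finset (Sym2 ℕ), listedEdges, fun γ i =>
    (matchingArcs γ i).image fun a => s((a.1 : ℕ), (a.2 : ℕ))⟩

/-- A matching edge is listed by the home of its increasing arc. Since only arcs of the graph are
stored, the matching has to consist of edges. -/
theorem biUnion_outputView (γ : Conf P n) (hM : ∀ e ∈ γ.M, e ∈ γ.inst.G.edgeSet) :
    (Finset.univ.biUnion fun i => (outputView P n).val γ i) = γ.M.image (Sym2.map Fin.val) := by
  ext e
  simp only [outputView, matchingArcs, Finset.mem_biUnion, Finset.mem_univ, true_and,
    Finset.mem_image, Finset.mem_filter]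
  constructor
  · rintro ⟨i, a, ⟨-, -, h, -⟩, rfl⟩
    exact ⟨_, h, rfl⟩
  · rintro ⟨e, he, rfl⟩
    have h1 := hM e he
    induction e with
    | h u v =>
      have key : ∀ u v, s(u, v) ∈ γ.M → γ.inst.G.Adj u v → u < v →
          ∃ i : Fin P.p, ∃ a, (a ∈ γ.inst.lay.A ∧ γ.inst.lay.home a = i ∧ s(a.1, a.2) ∈ γ.M ∧
            a.1 < a.2) ∧ s((a.1 : ℕ), (a.2 : ℕ)) = s((u : ℕ), (v : ℕ)) := by
        intro u v h h1 h2
        have hA := (γ.inst.mem_arcs (u, v)).2 h1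
        exact ⟨⟨_, (γ.inst.lay.home_lt _ hA).trans_le P.q_le_p⟩, (u, v), ⟨hA, rfl, h, h2⟩, rfl⟩
      rcases lt_or_gt_of_ne (γ.inst.G.ne_of_adj h1) with h2 | h2
      · exact key u v he h1 h2
      · obtain ⟨i, a, h3, h4⟩ := key v u (Sym2.eq_swap ▸ he) h1.symm h2
        exact ⟨i, a, h3, h4.trans Sym2.eq_swap⟩

/-- In the last round, the matching is written. -/
theorem impl_output (hP : LargeFor P n) :
    Impl P.cap P.W 1 (arcView Conf.inst baseFields) (outputView P n)
      (PMF.pure (α := Conf P n)) := by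
  classical
  refine Impl.of_round (fun γ i => PMF.pure
    ((matchingArcs γ i).toList.flatMap fun a => [(a.1 : ℕ), (a.2 : ℕ)], [])) ?_ ?_ ?_
  · intro γ γ' i h
    have key : ∀ γ γ' : Conf P n, homeMem arcId (fun γ : Conf P n => γ.inst.lay) baseFields γ i
        = homeMem arcId (fun γ : Conf P n => γ.inst.lay) baseFields γ' i →
        matchingArcs γ i ⊆ matchingArcs γ' i := by
      intro γ γ' h a ha
      rw [matchingArcs, Finset.mem_filter] at ha ⊢
      obtain ⟨h1, h2, h3, h4⟩ := ha
      obtain ⟨h5, h6, h7⟩ := homeMem_know arcId_injective h h1 h2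
      exact ⟨h5, h6, (baseFields_eq h7).2.2.2 h3, h4⟩
    have h := Finset.image_injective enc_injective h
    rw [(key γ γ' h).antisymm (key γ' γ h.symm)]
  · intro γ r hr
    obtain rfl : r = fun i : Fin P.p =>
        ((matchingArcs γ i).toList.flatMap fun a => [(a.1 : ℕ), (a.2 : ℕ)], []) :=
      funext fun i => by simpa using hr i
    have h1 : ∀ i : Fin P.p,
        ((matchingArcs γ i).toList.flatMap fun a => [(a.1 : ℕ), (a.2 : ℕ)]).length ≤ P.cap ∧
        ∀ w ∈ (matchingArcs γ i).toList.flatMap fun a => [(a.1 : ℕ), (a.2 : ℕ)], w < P.W := by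
      intro i
      constructor
      -- Two words for each of at most `K` edges fit into the term `3 * K` of `le_cap`.
      · have h1 : (matchingArcs γ i).card ≤ P.K :=
          (Finset.card_le_card fun a ha => by
            rw [matchingArcs, Finset.mem_filter] at ha
            exact Finset.mem_filter.2 ⟨ha.1, ha.2.1⟩).trans (γ.inst.lay.load i)
        have h2 := P.le_cap
        simp only [List.length_flatMap, List.length_cons, List.length_nil, List.map_const',
          List.sum_replicate, smul_eq_mul, Finset.length_toList]
        omega
      · intro w hw
        obtain ⟨x, -, hw⟩ := List.mem_flatMap.1 hw
        have hn : n ≤ P.W := by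
          have h1 : n ≤ P.N := (Nat.le_mul_self n).trans (hP.lt_G.le.trans P.G_le_N)
          refine h1.trans (le_trans ?_ P.pow_le_W)
          exact Nat.le_self_pow (by have := one_le_encExp 32; omega) _
        simp only [List.mem_cons, List.not_mem_nil, or_false] at hw
        rcases hw with rfl | rfl
        · exact x.1.2.trans_le hn
        · exact x.2.2.trans_le hn
    constructor
    · intro i
      simpa using h1 i
    · intro i
      simpa [exchange, received] using h1 i
  · intro γ
    rw [indep_pure, PMF.pure_map, PMF.pure_map]
    congr 1
    funext i
    have he : exchange (fun i : Fin P.p =>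
        ((matchingArcs γ i).toList.flatMap fun a => [(a.1 : ℕ), (a.2 : ℕ)], [])) i
        = (matchingArcs γ i).toList.flatMap fun a => [(a.1 : ℕ), (a.2 : ℕ)] := by
      simp [exchange, received]
    rw [he]
    refine Finset.ext fun e => ?_
    rw [show (outputView P n).read = listedEdges from rfl, listedEdges_flatMap]
    simp [outputView]

end Rounds

/-! ## The whole algorithm as a program -/

section Algorithm

variable {P : Params} {n S : ℕ}

theorem iterate_fst {f : ℝ → ℝ} {step : State n → PMF (State n)}
    (hf : ∀ s, ∀ s' ∈ (step s).support, s'.1 = f s.1) : ∀ (k : ℕ) (s : State n),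
    ∀ s' ∈ (iterate step k s).support, s'.1 = f^[k] s.1
  | 0, s, s', h => by
      rw [iterate, PMF.mem_support_pure_iff] at h
      rw [h]
      rfl
  | k + 1, s, s', h => by
      rw [iterate, PMF.mem_support_bind_iff] at h
      obtain ⟨t, ht, hs⟩ := h
      rw [iterate_fst hf k t s' hs, hf s t ht, Function.iterate_succ_apply]

theorem iterate_edges {G : SimpleGraph (Fin n)} {step : State n → PMF (State n)}
    (hf : ∀ s, ∀ s' ∈ (step s).support, ∀ e ∈ s'.2.2, e ∈ s.2.2 ∨ e ∈ G.edgeSet) :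
    ∀ (k : ℕ) (s : State n), ∀ s' ∈ (iterate step k s).support,
      ∀ e ∈ s'.2.2, e ∈ s.2.2 ∨ e ∈ G.edgeSet
  | 0, s, s', h, e, he => by
      rw [iterate, PMF.mem_support_pure_iff] at h
      exact Or.inl (h ▸ he)
  | k + 1, s, s', h, e, he => by
      rw [iterate, PMF.mem_support_bind_iff] at h
      obtain ⟨t, ht, hs⟩ := h
      rcases iterate_edges hf k t s' hs e he with h | h
      · exact hf s t ht e h
      · exact Or.inr h

/-- A loop takes as many rounds as its iterations together. -/
theorem impl_iterate {R : ℕ} (step : SimpleGraph (Fin n) → State n → PMF (State n)) (f : ℝ → ℝ)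
    (good : ℝ → Prop)
    (hstep : ∀ Δ, good Δ → Impl P.cap P.W R (arcView Conf.inst baseFields)
      (arcView Conf.inst baseFields)
      fun γ : Conf P n => (step γ.inst.G (Δ, γ.V, γ.M)).map (stateConf γ.inst))
    (hf : ∀ G s, ∀ s' ∈ (step G s).support, s'.1 = f s.1) : ∀ (k : ℕ) (Δ : ℝ),
    (∀ j < k, good (f^[j] Δ)) → Impl P.cap P.W (k * R) (arcView Conf.inst baseFields)
      (arcView Conf.inst baseFields)
      fun γ : Conf P n => (iterate (step γ.inst.G) k (Δ, γ.V, γ.M)).map (stateConf γ.inst)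
  | 0, Δ, _ => by
      rw [Nat.zero_mul]
      refine (Impl.zero _).congr_law fun γ => ?_
      rw [iterate, PMF.pure_map, PMF.pure_map, PMF.pure_map]
      rfl
  | k + 1, Δ, h => by
      have h1 := (hstep Δ (h 0 (by omega))).comp (impl_iterate step f good hstep hf k (f Δ)
        fun j hj => by
          rw [← Function.iterate_succ_apply]
          exact h (j + 1) (by omega))
      rw [Nat.succ_mul, Nat.add_comm]
      refine h1.congr_law fun γ => congrArg _ ?_
      rw [iterate, bind_map_eq, map_bind_eq]
      refine bind_congr_of_support fun s hs => ?_
      rw [← hf γ.inst.G _ s hs]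
      rfl

variable {mm : SimpleGraph (Fin n) → Finset (Sym2 (Fin n))}

theorem parallelIteration_fst (mm : SimpleGraph (Fin n) → Finset (Sym2 (Fin n))) (S : ℕ)
    (G : SimpleGraph (Fin n)) (s : State n) :
    ∀ s' ∈ (parallelIteration mm G S s).support, s'.1 = nextDelta n S s.1 := by
  intro s' h
  simp only [parallelIteration, PMF.mem_support_bind_iff, PMF.mem_support_map_iff] at h
  obtain ⟨φ, -, res, -, rfl⟩ := h
  rfl

theorem parallelIteration_edges (hmm : IsMaximalMatchingRule mm) (G : SimpleGraph (Fin n))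
    (s : State n) : ∀ s' ∈ (parallelIteration mm G S s).support,
      ∀ e ∈ s'.2.2, e ∈ s.2.2 ∨ e ∈ G.edgeSet := by
  classical
  intro s' h e he
  simp only [parallelIteration, PMF.mem_support_bind_iff, PMF.mem_support_map_iff] at h
  obtain ⟨φ, -, res, hres, rfl⟩ := h
  rcases Finset.mem_union.1 he with he | he
  · exact Or.inl he
  · obtain ⟨i, -, hi⟩ := Finset.mem_biUnion.1 he
    exact Or.inr (((mem_iterate_localPhase hmm G _ (mem_support_indep.1 hres i)).2 e
      hi).resolve_left (by simp))

theorem globalPhase_fst (pick : Fin n → Finset (Fin n) → Fin n) (G : SimpleGraph (Fin n))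
    (s : State n) : ∀ s' ∈ (globalPhase pick G s).support, s'.1 = s.1 / 2 := by
  intro s' h
  simp only [globalPhase, PMF.mem_support_bind_iff, PMF.mem_support_map_iff] at h
  obtain ⟨F, -, M, -, rfl⟩ := h
  rfl

theorem matchHeavy_edges (G : SimpleGraph (Fin n)) (H F : Finset (Fin n)) :
    ∀ M ∈ (matchHeavy minPick G H F).support, ∀ e ∈ M, e ∈ G.edgeSet := by
  classical
  intro M h e he
  simp only [matchHeavy, PMF.mem_support_bind_iff, PMF.mem_support_map_iff] at h
  obtain ⟨star, hstar, red, -, rfl⟩ := h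
  simp only [Finset.mem_image, Finset.mem_filter] at he
  obtain ⟨w, ⟨-, hr, hne⟩, rfl⟩ := he
  have h1 := isSelectionRule_minPick w _ hne
  simp only [Finset.mem_filter] at h1
  obtain ⟨-, h2, h3⟩ := h1
  generalize minPick w _ = v at h2 h3 ⊢
  -- A vertex without heavy neighbours has itself as default choice; selecting it would require it
  -- to be both red and blue.
  have hvw : v ≠ w := by
    rintro rfl
    rw [hr] at h2
    exact absurd h2 (by simp)
  have h4 := mem_support_indep.1 hstar v
  rw [h3] at h4
  rcases (nbrs G H v).eq_empty_or_nonempty with h5 | h5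
  · rw [h5, uniformOr_empty, PMF.mem_support_pure_iff] at h4
    exact absurd h4.symm hvw
  · rw [uniformOr_of_nonempty h5, PMF.mem_support_uniformOfFinset_iff, mem_nbrs] at h4
    exact h4.2

theorem globalPhase_edges (G : SimpleGraph (Fin n)) (s : State n) :
    ∀ s' ∈ (globalPhase minPick G s).support, ∀ e ∈ s'.2.2, e ∈ s.2.2 ∨ e ∈ G.edgeSet := by
  classical
  intro s' h e he
  simp only [globalPhase, PMF.mem_support_bind_iff, PMF.mem_support_map_iff] at h
  obtain ⟨F, -, M, hM, rfl⟩ := h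
  rcases Finset.mem_union.1 he with he | he
  · exact Or.inl he
  · exact Or.inr (matchHeavy_edges G _ _ M hM e he)

/-- The matching is only accumulated and never consulted, so `GlobalAlg` may as well start from the
matching of the main loop. -/
theorem iterate_globalPhase_union [DecidableEq (Sym2 (Fin n))]
    (pick : Fin n → Finset (Fin n) → Fin n) (G : SimpleGraph (Fin n)) (M : Finset (Sym2 (Fin n))) :
    ∀ (k : ℕ) (Δ : ℝ) (V : Finset (Fin n)) (X : Finset (Sym2 (Fin n))),
      iterate (globalPhase pick G) k (Δ, V, M ∪ X)
        = (iterate (globalPhase pick G) k (Δ, V, X)).map fun s => (s.1, s.2.1, M ∪ s.2.2)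
  | 0, Δ, V, X => by rw [iterate, iterate, PMF.pure_map]
  | k + 1, Δ, V, X => by
      classical
      rw [iterate, iterate, map_bind_eq]
      have h1 : globalPhase pick G (Δ, V, M ∪ X)
          = (globalPhase pick G (Δ, V, X)).map fun s => (s.1, s.2.1, M ∪ s.2.2) := by
        simp only [globalPhase, map_bind_eq, PMF.map_comp]
        refine congrArg _ (funext fun F => ?_)
        congr 1
        funext M'
        simp only [Function.comp_apply, Prod.mk.injEq, true_and]
        ext e
        simp [or_assoc]
      rw [h1, bind_map_eq]
      refine congrArg _ (funext fun s => ?_)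
      exact iterate_globalPhase_union pick G M k s.1 s.2.1 s.2.2

/-- The number of iterations of the loop of `ParallelAlg`. -/
def loopCount (n S : ℕ) : ℕ := whileCount (nextDelta n S) (loopThreshold n S) n

/-- The value of `Δ` after the loop of `ParallelAlg`. -/
def finalDelta (n S : ℕ) : ℝ := (nextDelta n S)^[loopCount n S] n

/-- The number of phases of `GlobalAlg`. -/
def phaseCount (n S : ℕ) : ℕ := whileCount (fun x => x / 2) 1 (2 * finalDelta n S)

/-- The state after `ParallelAlg`. -/
def parallelConf (mm : SimpleGraph (Fin n) → Finset (Sym2 (Fin n))) (S : ℕ) (γ : Conf P n) :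
    PMF (Conf P n) :=
  ((iterate (parallelIteration mm γ.inst.G S) (loopCount n S) ((n : ℝ), γ.V, γ.M)).map
    (stateConf γ.inst)).bind fun γ =>
  (iterate (globalPhase minPick γ.inst.G) (phaseCount n S) (2 * finalDelta n S,
    (filterConf (2 * finalDelta n S) γ).V, γ.M)).map (stateConf γ.inst)

theorem parallelAlg_eq (i : Inst P n) :
    parallelAlg mm minPick i.G S = (parallelConf mm S ⟨i, Finset.univ, ∅⟩).map Conf.M := by
  classical
  rw [parallelAlg, parallelConf, bind_map_eq, map_bind_eq]
  refine bind_congr_of_support fun s hs => ?_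
  -- `Δ` evolves deterministically, so all thresholds and loop lengths can be built into the
  -- program.
  have h1 : s.1 = finalDelta n S := iterate_fst (parallelIteration_fst mm S i.G) _ _ s hs
  obtain ⟨Δ, V, M⟩ := s
  obtain rfl : Δ = finalDelta n S := h1
  rw [PMF.map_comp]
  simp only [globalAlg, PMF.map_comp]
  have h2 := iterate_globalPhase_union minPick i.G M (phaseCount n S) (2 * finalDelta n S)
    (filterConf (2 * finalDelta n S) ⟨i, V, M⟩ : Conf P n).V ∅
  rw [Finset.union_empty] at h2
  change _ = (iterate (globalPhase minPick i.G) (phaseCount n S) (2 * finalDelta n S,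
    (filterConf (2 * finalDelta n S) ⟨i, V, M⟩ : Conf P n).V, M)).map _
  rw [h2, PMF.map_comp]
  rfl

theorem parallelConf_edges (hmm : IsMaximalMatchingRule mm) {γ γ' : Conf P n}
    (hM : γ.M = ∅) (h : γ' ∈ (parallelConf mm S γ).support) :
    γ'.inst = γ.inst ∧ ∀ e ∈ γ'.M, e ∈ γ'.inst.G.edgeSet := by
  rw [parallelConf, bind_map_eq, PMF.mem_support_bind_iff] at h
  obtain ⟨s, hs, h⟩ := h
  rw [PMF.mem_support_map_iff] at h
  obtain ⟨t, ht, rfl⟩ := h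
  refine ⟨rfl, fun e he => ?_⟩
  rcases iterate_edges (globalPhase_edges γ.inst.G) _ _ t ht e he with h1 | h1
  · rcases iterate_edges (parallelIteration_edges hmm γ.inst.G) _ _ s hs e h1 with h2 | h2
    · simp [hM] at h2
    · exact h2
  · exact h1

/-- The number of rounds of the whole program. -/
def Params.algRounds (P : Params) (n S : ℕ) : ℕ :=
  P.startRounds + (loopCount n S * P.parallelRounds +
    (P.filterRounds + (phaseCount n S * P.globalRounds + 1)))

/-- A program that computes exactly what `ParallelAlg` does. -/
theorem exists_program {S' : ℕ} (hP : FitsInput P n S) (hn : 2 ≤ n)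
    (hmm : IsMaximalMatchingRule mm) (hS : 16 * S' ≤ P.Kg)
    (hm : ∀ j < loopCount n S', 0 < numParts n S' ((nextDelta n S')^[j] n) ∧
      numParts n S' ((nextDelta n S')^[j] n) ≤ n) (hΔ : 0 < finalDelta n S') :
    ∃ Q : Program P.p, Q.rounds = P.algRounds n S' ∧ ∀ γ : Input n P.p S,
      Fits P.cap P.W (initialMemories γ.share) →
      Q.output P.cap P.W (initialMemories γ.share)
        = (parallelAlg mm minPick γ.G S').map fun M => some (M.image (Sym2.map Fin.val)) := by
  have h1 := impl_iterate (P := P) (n := n) (R := P.parallelRounds)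
    (fun G => parallelIteration mm G S') (nextDelta n S')
    (fun Δ => 0 < numParts n S' Δ ∧ numParts n S' Δ ≤ n)
    (fun Δ h => impl_parallelIteration hP.large hn hmm hS h.1 h.2)
    (fun G s => parallelIteration_fst mm S' G s) (loopCount n S') n hm
  have h2 := impl_filterConf (P := P) (n := n) hP.large (2 * finalDelta n S')
  have hpos : ∀ j : ℕ, 0 < (fun x : ℝ => x / 2)^[j] (2 * finalDelta n S') := by
    intro j
    induction j with
    | zero => simpa using hΔ
    | succ j ih =>
      rw [Function.iterate_succ_apply']
      exact half_pos ih
  have h3 := impl_iterate (P := P) (n := n) (R := P.globalRounds)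
    (fun G => globalPhase minPick G) (fun x => x / 2) (fun Δ => 0 < Δ)
    (fun Δ h => impl_globalPhase hP.large h)
    (fun G s => globalPhase_fst minPick G s) (phaseCount n S') (2 * finalDelta n S')
    (fun j _ => hpos j)
  obtain ⟨Q, hQ, hrun⟩ := (impl_start hP).comp (h1.comp (h2.comp (h3.comp (impl_output hP.large))))
  refine ⟨Q, hQ, fun γ hfit => ?_⟩
  have h4 := hrun γ _ hfit fun i => rfl
  simp only [PMF.pure_bind, PMF.bind_pure] at h4
  have h5 := congrArg (PMF.map (Option.map fun d : Fin P.p → (outputView P n).κ =>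
    (Finset.univ.biUnion fun i => (d i : Finset (Sym2 ℕ)) : Finset (Sym2 ℕ)))) h4
  rw [PMF.map_comp, PMF.map_comp] at h5
  have h6 : Q.output P.cap P.W (initialMemories γ.share)
      = (parallelConf mm S' (startConf hP γ)).map fun γ' =>
        some (Finset.univ.biUnion fun i => (outputView P n).val γ' i) := by
    rw [Program.output, hQ]
    refine Eq.trans ?_ h5
    congr 1
    funext o
    cases o <;> rfl
  rw [h6, show γ.G = (γ.inst hP).G from rfl, parallelAlg_eq, PMF.map_comp]
  refine map_congr_of_support fun γ' hγ' => ?_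
  rw [biUnion_outputView γ' (parallelConf_edges hmm rfl hγ').2]
  rfl

end Algorithm

/-! ## The number of iterations -/

section Counts

variable {n S : ℕ}

/-- The constant exceeds `e`, so `16 ≤ n` ensures `log log n ≥ 1`. -/
theorem log_ge (hn : 16 ≤ n) : 2.77 ≤ Real.log n := by
  have h1 : Real.log 16 ≤ Real.log n := Real.log_le_log (by norm_num) (by exact_mod_cast hn)
  have h2 : Real.log 16 = 4 * Real.log 2 := by
    rw [show (16 : ℝ) = 2 ^ 4 by norm_num, Real.log_pow]
    norm_num
  linarith [Real.log_two_gt_d9]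

theorem one_le_loglog (hn : 16 ≤ n) : 1 ≤ Real.log (Real.log n) := by
  rw [Real.le_log_iff_exp_le (by linarith [log_ge hn])]
  linarith [log_ge hn, Real.exp_one_lt_d9]

/-- Constants are absorbed into `log log n ≥ 1`; here `0.7` is a bound for `log 2`. -/
theorem log_const_mul_le {c : ℝ} {k : ℕ} (hc : 0 < c) (hck : c ≤ 2 ^ k) (hn : 16 ≤ n) :
    Real.log (c * Real.log n) ≤ (0.7 * k + 1) * Real.log (Real.log n) := by
  have h1 := log_ge hn
  have h2 := one_le_loglog hn
  rw [Real.log_mul hc.ne' (by linarith)]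
  have h3 : Real.log c ≤ k * Real.log 2 := by
    rw [← Real.log_pow]
    exact Real.log_le_log hc hck
  have h4 : (k : ℝ) * Real.log 2 ≤ 0.7 * k := by
    have : (0 : ℝ) ≤ k := k.cast_nonneg
    nlinarith [Real.log_two_lt_d9]
  have h5 : (0 : ℝ) ≤ 0.7 * k := by positivity
  nlinarith

theorem nextDelta_pos {Δ : ℝ} (h : 0 < Δ) : 0 < nextDelta n S Δ := by
  unfold nextDelta
  positivity

theorem iterate_nextDelta_pos (hn : 0 < n) (j : ℕ) : 0 < (nextDelta n S)^[j] n := by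
  induction j with
  | zero => simpa using hn
  | succ j ih =>
    rw [Function.iterate_succ_apply']
    exact nextDelta_pos ih

theorem iterate_nextDelta_le (hn : 0 < n) (j : ℕ) : (nextDelta n S)^[j] n ≤ n := by
  induction j with
  | zero => simp
  | succ j ih =>
    rw [Function.iterate_succ_apply']
    exact (div_le_self (iterate_nextDelta_pos hn j).le (one_le_pow₀ (by norm_num))).trans ih

theorem le_of_lt_loopCount {j : ℕ} (hj : j < loopCount n S) :
    loopThreshold n S ≤ (nextDelta n S)^[j] n := by
  by_contra h
  exact Nat.notMem_of_lt_sInf hj (not_le.1 h)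

theorem finalDelta_lt (hn : 2 ≤ n) (hS : 1 ≤ S) (hSn : S ≤ n) :
    finalDelta n S < loopThreshold n S :=
  Nat.sInf_mem (parallelAlg_terminates n S hn hS hSn)

theorem threshold_pow (hn : 16 ≤ n) : Real.exp 1 ≤ (200 * Real.log n) ^ 32 := by
  have h1 := log_ge hn
  have h2 : 200 * Real.log n ≤ (200 * Real.log n) ^ 32 :=
    le_self_pow₀ (by linarith) (by norm_num)
  linarith [Real.exp_one_lt_d9]

/-- While the loop runs, the excess `Δ * S / n` is at least `(200 log n)^32`; all that is needed
later is that its logarithm is at least `1`. -/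
theorem mul_div_ge {Δ : ℝ} (hn : 16 ≤ n) (hS : 1 ≤ S) (h : loopThreshold n S ≤ Δ) :
    Real.exp 1 ≤ Δ * S / n := by
  have hn' : (0 : ℝ) < n := by exact_mod_cast (by omega : 0 < n)
  have hS' : (0 : ℝ) < S := by exact_mod_cast hS
  refine (threshold_pow hn).trans ?_
  rw [le_div_iff₀ hn']
  unfold loopThreshold at h
  have := mul_le_mul_of_nonneg_right h hS'.le
  calc (200 * Real.log n) ^ 32 * n = n / S * (200 * Real.log n) ^ 32 * S := by field_simp
    _ ≤ Δ * S := this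

theorem numParts_pos {Δ : ℝ} (hn : 16 ≤ n) (hS : 1 ≤ S) (hSn : S ≤ n)
    (h : loopThreshold n S ≤ Δ) : 0 < numParts n S Δ := by
  have hn' : (0 : ℝ) < n := by exact_mod_cast (by omega : 0 < n)
  have hS' : (0 : ℝ) < S := by exact_mod_cast hS
  have hSn' : (S : ℝ) ≤ n := by exact_mod_cast hSn
  have h1 := mul_div_ge hn hS h
  have h2 : (1 : ℝ) ≤ Real.exp 1 := Real.one_le_exp (by norm_num)
  have h3 : 0 < Δ := by
    by_contra h0
    rw [not_lt] at h0
    have : Δ * S / n ≤ 0 := div_nonpos_of_nonpos_of_nonneg (by nlinarith) hn'.le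
    linarith
  refine Nat.floor_pos.2 (Real.one_le_sqrt.2 ?_)
  refine (h2.trans h1).trans ?_
  rw [div_le_div_iff₀ hn' hS']
  nlinarith [mul_le_mul hSn' hSn' hS'.le hn'.le]

theorem numParts_le {Δ : ℝ} (hS : 1 ≤ S) (h0 : 0 ≤ Δ) (hΔ : Δ ≤ n) : numParts n S Δ ≤ n := by
  have hS' : (1 : ℝ) ≤ S := by exact_mod_cast hS
  refine Nat.floor_le_of_le (Real.sqrt_le_iff.2 ⟨n.cast_nonneg, ?_⟩)
  refine (div_le_self (by positivity) hS').trans ?_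
  nlinarith [(Nat.cast_nonneg n : (0 : ℝ) ≤ n)]

/-- An iteration of the loop reduces the excess of `Δ` by a factor. -/
theorem log_nextDelta_le {Δ : ℝ} (hn : 16 ≤ n) (hS : 1 ≤ S) (hSn : S ≤ n)
    (h : loopThreshold n S ≤ Δ) (h0 : 0 < Δ) :
    Real.log (nextDelta n S Δ * S / n)
      ≤ (1 - Real.log 2 / (32 * Real.log (120 * alpha n))) * Real.log (Δ * S / n) := by
  have hn' : (0 : ℝ) < n := by exact_mod_cast (by omega : 0 < n)
  have hS' : (0 : ℝ) < S := by exact_mod_cast hS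
  have hm := numParts_pos hn hS hSn h
  have hm' : (0 : ℝ) < numParts n S Δ := by exact_mod_cast hm
  have hb : 0 < Real.log (120 * alpha n) := Real.log_pos (by
    unfold alpha
    linarith [log_ge hn])
  -- `m` is at most `√(n Δ / S)`, and the product of this root with `√(Δ S / n)` is `Δ`.
  have h1 : Real.sqrt (Δ * S / n) ≤ Δ / numParts n S Δ := by
    rw [le_div_iff₀ hm']
    calc Real.sqrt (Δ * S / n) * numParts n S Δ
        ≤ Real.sqrt (Δ * S / n) * Real.sqrt (n * Δ / S) :=
          mul_le_mul_of_nonneg_left (Nat.floor_le (Real.sqrt_nonneg _)) (Real.sqrt_nonneg _)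
      _ = Real.sqrt (Δ ^ 2) := by
          rw [← Real.sqrt_mul (by positivity)]
          congr 1
          field_simp
      _ = Δ := Real.sqrt_sq h0.le
  have h2 : Real.log (Δ * S / n) / 2 ≤ Real.log (Δ / numParts n S Δ) := by
    rw [← Real.log_sqrt (by positivity)]
    exact Real.log_le_log (Real.sqrt_pos.2 (by positivity)) h1
  have h3 : 1 / 16 * (Real.log (Δ / numParts n S Δ) / Real.log (120 * alpha n))
      ≤ numPhases n S Δ := Nat.le_ceil _
  have h4 : Real.log (nextDelta n S Δ * S / n)
      = Real.log (Δ * S / n) - numPhases n S Δ * Real.log 2 := by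
    rw [← Real.log_pow, ← Real.log_div (by positivity) (by positivity)]
    congr 1
    unfold nextDelta
    field_simp
  -- The factor `1 / 16` in `τ` and the square root in `h1` combine to `1 / 32`.
  have h5 : Real.log 2 / (32 * Real.log (120 * alpha n)) * Real.log (Δ * S / n)
      ≤ numPhases n S Δ * Real.log 2 := by
    have h6 : Real.log (Δ * S / n) / 2 / Real.log (120 * alpha n)
        ≤ Real.log (Δ / numParts n S Δ) / Real.log (120 * alpha n) :=
      div_le_div_of_nonneg_right h2 hb.le
    have h7 : 0 ≤ Real.log 2 := Real.log_nonneg (by norm_num)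
    calc Real.log 2 / (32 * Real.log (120 * alpha n)) * Real.log (Δ * S / n)
        = 1 / 16 * (Real.log (Δ * S / n) / 2 / Real.log (120 * alpha n)) * Real.log 2 := by
          field_simp
          ring
      _ ≤ numPhases n S Δ * Real.log 2 := by
          refine mul_le_mul_of_nonneg_right (le_trans ?_ h3) h7
          linarith
  rw [h4]
  linarith

theorem loopCount_le (hn : 16 ≤ n) (hS : 1 ≤ S) (hSn : S ≤ n) :
    (loopCount n S : ℝ) ≤ 600 * Real.log (Real.log n) ^ 2 + 1 := by
  have hn' : (0 : ℝ) < n := by exact_mod_cast (by omega : 0 < n)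
  have hS' : (0 : ℝ) < S := by exact_mod_cast hS
  have hl := log_ge hn
  have hll := one_le_loglog hn
  rcases Nat.eq_zero_or_pos (loopCount n S) with h0 | h0
  · rw [h0, Nat.cast_zero]
    positivity
  -- `120 * 96 ≤ 2 ^ 14`, and `0.7 * 14 + 1 ≤ 11`.
  have hb1 : Real.log (120 * alpha n) ≤ 11 * Real.log (Real.log n) := by
    have := log_const_mul_le (c := 120 * 96) (k := 14) (by norm_num) (by norm_num) hn
    have e : 120 * alpha n = 120 * 96 * Real.log n := by
      unfold alpha
      ring
    rw [e]
    norm_num at this ⊢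
    linarith
  have hb0 : 1 ≤ Real.log (120 * alpha n) := by
    rw [Real.le_log_iff_exp_le (by unfold alpha; linarith)]
    unfold alpha
    linarith [Real.exp_one_lt_d9]
  set c := Real.log 2 / (32 * Real.log (120 * alpha n)) with hc
  have hl2 := Real.log_two_gt_d9
  have hl2' := Real.log_two_lt_d9
  have hc0 : 0 < c := by positivity
  have hc1 : c ≤ 1 := by
    rw [hc, div_le_one (by positivity)]
    linarith
  -- The excess starts at `S ≤ n` and its logarithm shrinks by the factor `1 - c` per iteration.
  have hdecay : ∀ j < loopCount n S,
      Real.log ((nextDelta n S)^[j] n * S / n) ≤ (1 - c) ^ j * Real.log n := by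
    intro j
    induction j with
    | zero =>
      intro _
      rw [Function.iterate_zero, id, mul_div_cancel_left₀ _ hn'.ne', pow_zero, one_mul]
      exact Real.log_le_log hS' (by exact_mod_cast hSn)
    | succ j ih =>
      intro hj
      rw [Function.iterate_succ_apply']
      refine (log_nextDelta_le hn hS hSn (le_of_lt_loopCount (by omega))
        (iterate_nextDelta_pos (by omega) j)).trans ?_
      rw [pow_succ', mul_assoc]
      exact mul_le_mul_of_nonneg_left (ih (by omega)) (by linarith)
  -- For the last iteration `j`, the logarithm of the excess is still at least `1`, so `1 ≤ (1 - c)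
  -- ^ j * log n` and hence `c * j ≤ log log n`.
  obtain ⟨j, hj⟩ := Nat.exists_eq_succ_of_ne_zero h0.ne'
  have hj' : j < loopCount n S := by omega
  have h1 : 1 ≤ Real.log ((nextDelta n S)^[j] n * S / n) := by
    have h2 := mul_div_ge hn hS (le_of_lt_loopCount hj')
    rwa [Real.le_log_iff_exp_le (lt_of_lt_of_le (Real.exp_pos _) h2)]
  have h2 : (1 - c) ^ j ≤ Real.exp (-(c * j)) := by
    calc (1 - c) ^ j ≤ Real.exp (-c) ^ j :=
          pow_le_pow_left₀ (by linarith) (Real.one_sub_le_exp_neg c) j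
      _ = Real.exp (-(c * j)) := by
          rw [← Real.exp_nat_mul]
          congr 1
          ring
  have h3 : 1 ≤ Real.exp (-(c * j)) * Real.log n :=
    (h1.trans (hdecay j hj')).trans (mul_le_mul_of_nonneg_right h2 (by linarith))
  have h4 : c * j ≤ Real.log (Real.log n) := by
    rw [Real.le_log_iff_exp_le (by linarith)]
    rw [Real.exp_neg, inv_mul_eq_div, le_div_iff₀ (Real.exp_pos _), one_mul] at h3
    exact h3
  -- `1 / c` is at most `32 * 11 * log log n / log 2`, and `352 / log 2 < 600`.
  have h5 : (j : ℝ) ≤ 600 * Real.log (Real.log n) ^ 2 := by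
    have h6 : Real.log 2 * j ≤ Real.log (Real.log n) * (32 * Real.log (120 * alpha n)) := by
      rw [hc, div_mul_eq_mul_div, div_le_iff₀ (by positivity)] at h4
      exact h4
    have h7 : Real.log (Real.log n) * (32 * Real.log (120 * alpha n))
        ≤ Real.log (Real.log n) * (32 * (11 * Real.log (Real.log n))) := by gcongr
    have h8 : (0 : ℝ) ≤ j := j.cast_nonneg
    nlinarith
  rw [hj]
  push_cast
  linarith

theorem iterate_half (k : ℕ) (Δ : ℝ) : (fun x : ℝ => x / 2)^[k] Δ = Δ / 2 ^ k := by
  induction k with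
  | zero => simp
  | succ k ih => rw [Function.iterate_succ_apply', ih, pow_succ, div_div]

theorem phaseCount_le (hn : 16 ≤ n) (hS : 1 ≤ S) (hSn : S ≤ n) :
    (phaseCount n S : ℝ) ≤ 400 * Real.log (Real.log n) ^ 2 + 2 * Real.log ((n : ℝ) / S) + 3 := by
  have hn' : (0 : ℝ) < n := by exact_mod_cast (by omega : 0 < n)
  have hS' : (0 : ℝ) < S := by exact_mod_cast hS
  have hl := log_ge hn
  have hll := one_le_loglog hn
  have hq : 0 ≤ Real.log ((n : ℝ) / S) := Real.log_nonneg (by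
    rw [le_div_iff₀ hS', one_mul]
    exact_mod_cast hSn)
  rcases Nat.eq_zero_or_pos (phaseCount n S) with h0 | h0
  · rw [h0, Nat.cast_zero]
    positivity
  obtain ⟨j, hj⟩ := Nat.exists_eq_succ_of_ne_zero h0.ne'
  -- In the last phase the threshold is still at least `1`, so `2 ^ j` is at most twice the
  -- threshold of the main loop.
  have h1 : (1 : ℝ) ≤ 2 * finalDelta n S / 2 ^ j := by
    rw [← iterate_half]
    by_contra h
    exact Nat.notMem_of_lt_sInf (show j < phaseCount n S by omega) (not_le.1 h)
  have h2 : (2 : ℝ) ^ j ≤ 2 * loopThreshold n S := by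
    rw [le_div_iff₀ (by positivity), one_mul] at h1
    linarith [finalDelta_lt (by omega) hS hSn]
  have h3 : (j : ℝ) * Real.log 2 ≤ Real.log 2 + Real.log ((n : ℝ) / S)
      + 32 * Real.log (200 * Real.log n) := by
    have h4 := Real.log_le_log (by positivity) h2
    have h5 : 0 < (200 * Real.log n) ^ 32 := by positivity
    have h6 : (0 : ℝ) < n / S := by positivity
    rw [Real.log_pow, loopThreshold, Real.log_mul (by norm_num) (by positivity),
      Real.log_mul h6.ne' h5.ne', Real.log_pow] at h4
    push_cast at h4
    linarith
  -- The polylogarithmic factor costs `32 * 6.6 / log 2 < 400` multiples of `log log n`, and `log (n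
  -- / S)` gets the factor `1 / log 2 < 2`.
  have h7 := log_const_mul_le (c := 200) (k := 8) (by norm_num) (by norm_num) hn
  have hl2 := Real.log_two_gt_d9
  have hl2' := Real.log_two_lt_d9
  have h8 : (0 : ℝ) ≤ j := j.cast_nonneg
  have h9 : Real.log (Real.log n) ≤ Real.log (Real.log n) ^ 2 := by nlinarith
  rw [hj]
  push_cast at h7 ⊢
  nlinarith

end Counts

/-! ## The parameters -/

/-- A branching factor whose `k`-th power reaches `n`. -/
theorem exists_branching {n S k : ℕ} {δ : ℝ} (hn : 1 ≤ n) (hk : 1 ≤ k) (hkδ : 2 / k ≤ δ)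
    (hS : (n : ℝ) ^ δ ≤ S) : ∃ B : ℕ, 0 < B ∧ B ≤ n ∧ n ≤ B ^ k ∧ B * B ≤ 4 * S := by
  have hn' : (1 : ℝ) ≤ n := by exact_mod_cast hn
  have hk' : (1 : ℝ) ≤ k := by exact_mod_cast hk
  set x := (n : ℝ) ^ (1 / k : ℝ) with hx
  have hx1 : 1 ≤ x := Real.one_le_rpow hn' (by positivity)
  have hxk : x ^ k = n := by
    rw [hx, one_div, Real.rpow_inv_natCast_pow (by positivity) (by omega)]
  -- Rounding `x = n^(1/k)` up at most doubles it, as `x ≥ 1`; then `B * B ≤ 4 * n^(2/k) ≤ 4 * n^δ`.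
  refine ⟨⌈x⌉₊, Nat.ceil_pos.2 (by linarith), Nat.ceil_le.2 ?_, ?_, ?_⟩
  · calc x ≤ (n : ℝ) ^ (1 : ℝ) := Real.rpow_le_rpow_of_exponent_le hn' (by
          rw [div_le_one (by linarith)]
          exact hk')
      _ = n := Real.rpow_one _
  · have : (n : ℝ) ≤ (⌈x⌉₊ : ℝ) ^ k := by
      rw [← hxk]
      exact pow_le_pow_left₀ (by linarith) (Nat.le_ceil x) k
    exact_mod_cast this
  · have h1 : (⌈x⌉₊ : ℝ) ≤ 2 * x := by linarith [Nat.ceil_lt_add_one (show 0 ≤ x by linarith)]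
    have h2 : x * x ≤ S := by
      refine le_trans ?_ hS
      rw [hx, ← Real.rpow_add (by linarith)]
      exact Real.rpow_le_rpow_of_exponent_le hn' (by
        convert hkδ using 1
        ring)
    have h3 : ((⌈x⌉₊ * ⌈x⌉₊ : ℕ) : ℝ) ≤ (4 * S : ℕ) := by
      push_cast
      nlinarith
    exact_mod_cast h3

/-- The parameters of the program. -/
theorem exists_params {n S p k B C : ℕ} (hn : 16 ≤ n) (hk : 1 ≤ k) (hkn : 2 * k ≤ n)
    (hS : 0 < S) (hB : 0 < B) (hBn : B ≤ n) (hnB : n ≤ B ^ k) (hBS : B * B ≤ 4 * S)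
    (hC : 8 * encExp 32 ≤ C) (hC' : 26 + 8 * k ≤ C) :
    ∃ P : Params, P.p = p ∧ P.L = 2 * k ∧ P.D = 5 * k - 1 ∧ P.Kg = 16 * min S n ∧
      P.cap = C * S ∧ P.W = n ^ C ∧ FitsInput P n S := by
  have h1 : n ≤ n ^ 8 := Nat.le_self_pow (by omega) n
  have h2 : n * n ≤ n ^ 8 := by
    rw [← pow_two]
    exact Nat.pow_le_pow_right (by omega) (by omega)
  have h3 : n * n * (4 * n + 4) < n ^ 8 := by
    calc n * n * (4 * n + 4) < n * n * (n * n) :=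
          Nat.mul_lt_mul_of_pos_left (by nlinarith) (by positivity)
      _ = n ^ 4 := by ring
      _ ≤ n ^ 8 := Nat.pow_le_pow_right (by omega) (by omega)
  have h4 : n * n * (n * n) ≤ n ^ 8 := by
    calc n * n * (n * n) = n ^ 4 := by ring
      _ ≤ n ^ 8 := Nat.pow_le_pow_right (by omega) (by omega)
  have h5 : (n * n + 1) * (n * n) ≤ n ^ 5 := by
    calc (n * n + 1) * (n * n) ≤ n ^ 3 * (n * n) := Nat.mul_le_mul_right _ (by nlinarith)
      _ = n ^ 5 := by ring
  have h6 : n ^ 5 ≤ n ^ 8 := Nat.pow_le_pow_right (by omega) (by omega)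
  refine ⟨{
    p := p
    q := min p (n * n)
    B := B
    -- At most `n ^ 2 ≤ B ^ (2 * k)` machines are in use.
    L := 2 * k
    -- Sort keys are below `G * I ≤ n ^ 5 ≤ B ^ (5 * k)`, and the number of digits is `D + 1`.
    D := 5 * k - 1
    -- The largest number needed is about `n ^ 5`; the exponent `8` leaves room.
    N := n ^ 8
    K := min (2 * S) (n * n)
    Kg := 16 * min S n
    I := n * n
    G := n * n + 1
    cap := C * S
    W := n ^ C
    q_le_p := min_le_left _ _
    q_le_pow := ?_
    B_pos := hB
    K_pos := lt_min (by omega) (by positivity)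
    three_le_N := by omega
    G_pos := by omega
    q_le_N := (min_le_right _ _).trans h2
    B_le_N := hBn.trans h1
    L_le_N := hkn.trans h1
    I_le_N := h2
    mul_le_N := (Nat.mul_le_mul (min_le_right _ _) (min_le_right _ _)).trans h4
    G_le_N := by nlinarith
    G_mul_le_N := h5.trans h6
    G_mul_le_pow := ?_
    pow_le_W := ?_
    le_cap := ?_ }, rfl, rfl, rfl, rfl, rfl, rfl, ?_⟩
  · calc min p (n * n) ≤ n * n := min_le_right _ _
      _ ≤ B ^ k * B ^ k := Nat.mul_le_mul hnB hnB
      _ = B ^ (2 * k) := by rw [← pow_add, two_mul]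
  · calc (n * n + 1) * (n * n) ≤ n ^ 5 := h5
      _ ≤ (B ^ k) ^ 5 := Nat.pow_le_pow_left hnB 5
      _ = B ^ (5 * k - 1 + 1) := by
        rw [← pow_mul, show 5 * k - 1 + 1 = k * 5 by omega]
  · rw [← pow_mul]
    exact Nat.pow_le_pow_right (by omega) hC
  -- The terms are `3 * 2 * S` for the items, `16 * S` for a gathered part, and `(2 * k + 1) * 4 *
  -- S` for the tree, in all `(26 + 8 * k) * S`.
  · have h7 : (2 * k + 1) * (B * B) ≤ (2 * k + 1) * (4 * S) := Nat.mul_le_mul_left _ hBS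
    have h8 : min (2 * S) (n * n) ≤ 2 * S := min_le_left _ _
    have h9 : min S n ≤ S := min_le_left _ _
    have h10 : (26 + 8 * k) * S ≤ C * S := Nat.mul_le_mul_right _ hC'
    nlinarith
  · exact {
      large := { le_I := le_rfl, lt_G := Nat.lt_succ_self _, lt_N := h3 }
      S_pos := hS
      q_eq := rfl
      K_eq := rfl
      two_mul_le_cap := Nat.mul_le_mul_right _ (by omega) }

theorem algRounds_le (P : Params) (n S : ℕ) :
    P.algRounds n S ≤ 16 * (P.scanRounds + 1) * (loopCount n S + phaseCount n S + 1) := by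
  have h1 : P.parallelRounds ≤ 16 * (P.scanRounds + 1) := by
    simp only [Params.parallelRounds, Params.partRounds, Params.gatherRounds, Params.totalRounds,
      Params.scanRounds]
    omega
  have h2 : P.globalRounds ≤ 16 * (P.scanRounds + 1) := by
    simp only [Params.globalRounds, Params.heavyRounds, Params.totalRounds]
    omega
  have h3 := Nat.mul_le_mul_left (loopCount n S) h1
  have h4 := Nat.mul_le_mul_left (phaseCount n S) h2
  have h5 : P.startRounds + P.filterRounds + 1 ≤ 16 * (P.scanRounds + 1) := by
    simp only [Params.startRounds, Params.filterRounds, Params.totalRounds]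
    omega
  unfold Params.algRounds
  nlinarith

theorem algRounds_cast_le (P : Params) {n S : ℕ} (hn : 16 ≤ n) (hS : 1 ≤ S) :
    (P.algRounds n (min S n) : ℝ) ≤ (16 * (P.scanRounds + 1) * 1005 : ℕ) *
      (Real.log (Real.log n) ^ 2 + max (Real.log ((n : ℝ) / S)) 0) := by
  have hm : 1 ≤ min S n := le_min hS (by omega)
  have h1 := loopCount_le hn hm (min_le_right S n)
  have h2 := phaseCount_le hn hm (min_le_right S n)
  have h3 : Real.log ((n : ℝ) / (min S n : ℕ)) ≤ max (Real.log ((n : ℝ) / S)) 0 := by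
    rcases le_total S n with h | h
    · rw [min_eq_left h]
      exact le_max_left _ _
    · rw [min_eq_right h, div_self (by exact_mod_cast (by omega : n ≠ 0)), Real.log_one]
      exact le_max_right _ _
  have h4 := one_le_loglog hn
  have h5 : 0 ≤ max (Real.log ((n : ℝ) / S)) 0 := le_max_right _ _
  have h6 : (P.algRounds n (min S n) : ℝ) ≤ (16 * (P.scanRounds + 1) : ℕ) *
      ((loopCount n (min S n) : ℝ) + phaseCount n (min S n) + 1) := by
    exact_mod_cast algRounds_le P n (min S n)
  refine h6.trans ?_
  generalize 16 * (P.scanRounds + 1) = r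
  rw [Nat.cast_mul, mul_assoc]
  refine mul_le_mul_of_nonneg_left ?_ (Nat.cast_nonneg r)
  -- The two counts contribute `600 + 400` times the square and the constants `1 + 3 + 1`, which
  -- `log log n ≥ 1` absorbs; this is the origin of `1005`.
  push_cast
  nlinarith

theorem fits_initialMemories {n p S C : ℕ} {G : SimpleGraph (Fin n)}
    {share : Fin p → List (Fin n × Fin n)} (h : IsInputFor G S share) (hC : 2 ≤ C) :
    Fits (C * S) (n ^ C) (initialMemories share) := by
  refine fun i => ⟨?_, fun w hw => ?_⟩
  · have h1 : (initialMemories share i).length = (share i).length * 2 := by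
      simp [initialMemories, List.length_flatMap]
    rw [h1, mul_comm]
    exact Nat.mul_le_mul hC (h.1 i)
  · obtain ⟨x, -, hx⟩ := List.mem_flatMap.1 hw
    have h2 : w < n := by
      rcases List.mem_pair.1 hx with rfl | rfl
      exacts [x.1.2, x.2.2]
    exact h2.trans_le (Nat.le_self_pow (by omega) n)

/-- The diagonal coupling never disagrees, so every `ε` is allowed. -/
theorem agreesUpTo_map {n : ℕ} (ε : ENNReal) (Y : PMF (Finset (Sym2 (Fin n)))) :
    AgreesUpTo ε (Y.map fun M => some (M.image (Sym2.map Fin.val))) Y := by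
  refine ⟨Y.map fun M => (some (M.image (Sym2.map Fin.val)), M), ?_, ?_, ?_⟩
  · rw [PMF.map_comp]
    rfl
  · rw [PMF.map_comp]
    exact PMF.map_id Y
  · rw [PMF.toOuterMeasure_map_apply]
    simp

end RoundCompression

end

/-! ### The theorem, from the program, the counts and the parameters. -/

open RoundCompression in
theorem mainTheorem4 (δ : ℝ) (hδ : 0 < δ) :
    ∃ C n₀ : ℕ, ∀ n S p : ℕ, n₀ ≤ n → (n : ℝ) ^ δ ≤ S →
      ∀ mm : SimpleGraph (Fin n) → Finset (Sym2 (Fin n)), IsMaximalMatchingRule mm →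
      ∃ (pick : Fin n → Finset (Fin n) → Fin n) (P : Program p),
        IsSelectionRule pick ∧
        (P.rounds : ℝ) ≤
          C * (Real.log (Real.log n) ^ 2 + max (Real.log ((n : ℝ) / S)) 0) ∧
        ∀ (G : SimpleGraph (Fin n)) (share : Fin p → List (Fin n × Fin n)),
          IsInputFor G S share →
          AgreesUpTo (((n : ENNReal) ^ 2)⁻¹)
            (P.output (C * S) (n ^ C) (initialMemories share))
            (parallelAlg mm pick G (min S n)) := by
  -- With `2 / k ≤ δ` the square of the branching factor fits into the space.
  obtain ⟨k, hk⟩ := exists_nat_gt (2 / δ)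
  have hk' : (0 : ℝ) < k := lt_trans (by positivity) hk
  have hk1 : 1 ≤ k := by exact_mod_cast hk'
  have hkδ : 2 / k ≤ δ := by
    rw [div_le_iff₀ hk']
    rw [div_lt_iff₀ hδ] at hk
    linarith
  -- The rounds of a scan for `L = 2 * k` and `D = 5 * k - 1`, a number that depends on `δ` only.
  set s := 1 + (5 * k - 1 + 1) * (2 * (2 * k) + 3) + (2 * (2 * k) + 3) with hs
  -- The three summands pay for the size of words, the space, and the number of rounds.
  set C := 8 * encExp 32 + (26 + 8 * k) + 16 * (s + 1) * 1005 with hC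
  clear_value C
  refine ⟨C, max 16 (2 * k), fun n S p hn hS mm hmm => ?_⟩
  have hn16 : 16 ≤ n := (le_max_left _ _).trans hn
  have hn0 : (0 : ℝ) < n := by exact_mod_cast (by omega : 0 < n)
  have hS1 : 1 ≤ S := by exact_mod_cast (Real.rpow_pos_of_pos hn0 δ).trans_le hS
  have hm : 1 ≤ min S n := le_min hS1 (by omega)
  obtain ⟨B, hB, hBn, hnB, hBS⟩ := exists_branching (by omega) hk1 hkδ hS
  obtain ⟨P, rfl, hL, hD, hKg, hcap, hW, hP⟩ :=
    exists_params (p := p) (C := C) hn16 hk1 ((le_max_right _ _).trans hn) hS1 hB hBn hnB hBS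
      (by omega) (by omega)
  obtain ⟨Q, hQ, hout⟩ := exists_program hP (by omega) hmm hKg.ge
    (fun j hj => ⟨numParts_pos hn16 hm (min_le_right _ _) (le_of_lt_loopCount hj),
      numParts_le hm (iterate_nextDelta_pos (by omega) j).le (iterate_nextDelta_le (by omega) j)⟩)
    (iterate_nextDelta_pos (by omega) _)
  have hscan : P.scanRounds = s := by
    rw [Params.scanRounds, Params.sortRounds, hL, hD]
  refine ⟨minPick, Q, isSelectionRule_minPick, ?_, fun G share h => ?_⟩
  · rw [hQ]
    refine (algRounds_cast_le P hn16 hS1).trans (mul_le_mul_of_nonneg_right ?_ ?_)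
    · rw [hscan]
      exact_mod_cast (by omega : 16 * (s + 1) * 1005 ≤ C)
    · exact add_nonneg (sq_nonneg _) (le_max_right _ _)
  · have hfit := fits_initialMemories (C := C) h (by omega)
    rw [← hcap, ← hW] at hfit ⊢
    rw [hout ⟨G, share, h⟩ hfit]
    exact agreesUpTo_map _ _
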